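/- **Definitions.** A \emph{lax vector} is a vector of $\mathbb{Z}[i]^2$ with coprime entries, considered up to multiplication by units; the lax vector of $(z_1,z_2)$ is identified with the point $z_1/z_2$ of $\mathbb{C}_\infty=\mathbb{C}\cup\{\infty\}$. Two lax vectors form a \emph{basis} if representatives of them form a $\mathbb{Z}[i]$-basis of $\mathbb{Z}[i]^2$; a \emph{superbasis} is a set of three lax vectors any two of which form a basis. An \emph{ultrabasis chamber} is a tetrahedron whose six edges are labelled with six distinct lax vectors such that the labels on each of its four triangles form a superbasis; chambers are considered up to isomorphism of labelled graphs. The \emph{Apollonian kingdom} is the graph with labelled edges obtained from all ultrabasis chambers by identifying any two triangles (\emph{walls}) with the same superbasis labels, matching the labels on their sides. Circles in $\mathbb{C}_\infty$ include lines (with $\infty$). An oriented circle has as its interior the component of the complement to the right of the direction of travel. An oriented circle is \emph{Gaussian} if it is the image of $\mathbb{R}\cup\{\infty\}$, oriented to the right, under a Möbius transformation in $\mathrm{PGL}_2(\mathbb{Z}[i])$. A \emph{Descartes quadruple} is a set of four mutually tangent oriented circles of disjoint interiors. An \emph{Apollonian circle packing} is the collection generated from three mutually tangent oriented circles of disjoint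 interiors by repeatedly adding all circles that complete a mutually tangent triple of the collection to a Descartes quadruple; it is \emph{Gaussian} if all its circles are. Its \emph{Apollonian palace} is the graph with one vertex for each circle and one edge for each tangent pair of circles; in the Gaussian case each edge is labelled with the lax vector corresponding to the point of tangency. **Theorem (Main Bijection).** There is a bijection $\Phi$ from the vertices of the Apollonian kingdom to the oriented Gaussian circles in $\mathbb{C}_\infty$ with the following properties. 1. The components of the Apollonian kingdom are exactly the edge-labelled Apollonian palaces of all Gaussian Apollonian circle packings in $\mathbb{C}_\infty$: for each component $K$, the set $\Phi(K)$ of circles is a Gaussian Apollonian circle packing, $\Phi$ induces an isomorphism of edge-labelled graphs from $K$ onto the Apollonian palace of $\Phi(K)$, and $K\mapsto\Phi(K)$ is a bijection from the set of components onto the set of Gaussian Apollonian circle packings. 2. Sending a chamber to the set of images under $\Phi$ of its vertices is a bijection from the chambers of the kingdom onto the Descartes quadruples of Gaussian circles. 3. Likewise, the walls of the kingdom (there is exactly one for each superbasis) correspond bijectively to the sets of three circles contained in some Descartes quadruple of Gaussian circles. 4. Likewise, the edges of the kingdom correspond bijectively to the pairs of circles that are tangent within some Descartes quadruple of Gaussian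 circles; in particular, two vertices are joined by an edge if and only if the corresponding circles are tangent within some Descartes quadruple of Gaussian circles. -/

import Mathlib

noncomputable section

open Set OnePoint

namespace Apollonian

/-! ### Lax vectors, bases, superbases, ultrabases -/

/-- Primitive vectors of `ℤ[i]²`: vectors with coprime entries. -/
abbrev PrimitiveVector : Type :=
  {v : Fin 2 → GaussianInt // IsCoprime (v 0) (v 1)}

/-- Two primitive vectors are equivalent if they differ by multiplication by a unit of `ℤ[i]`. -/
instance laxSetoid : Setoid PrimitiveVector where
  r v w := ∃ ε : GaussianIntˣ, w.1 = (ε : GaussianInt) • v.1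
  iseqv :=
    { refl := fun v => ⟨1, by simp⟩
      symm := by
        rintro v w ⟨ε, h⟩
        exact ⟨ε⁻¹, by rw [h, smul_smul]; simp⟩
      trans := by
        rintro u v w ⟨ε, h⟩ ⟨δ, h'⟩
        exact ⟨δ * ε, by rw [h', h, smul_smul]; simp⟩ }

/-- Lax vectors of `ℤ[i]²`: primitive vectors up to units. -/
def LaxVector : Type := Quotient laxSetoid

/-- The lax vector of a primitive vector. -/
def PrimitiveVector.lax (v : PrimitiveVector) : LaxVector := Quotient.mk laxSetoid v

/-- The point `z₁ / z₂` of the extended complex plane given by a lax vector `(z₁, z₂)`. -/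
def LaxVector.point : LaxVector → OnePoint ℂ :=
  Quotient.lift
    (fun v : PrimitiveVector =>
      if v.1 1 = 0 then (∞ : OnePoint ℂ)
      else (((GaussianInt.toComplex (v.1 0) / GaussianInt.toComplex (v.1 1) : ℂ)) : OnePoint ℂ))
    (by
      rintro v w ⟨ε, h⟩
      have hε : GaussianInt.toComplex (ε : GaussianInt) ≠ 0 := by
        simp
      have h0 : w.1 0 = ε * v.1 0 := by rw [h]; simp
      have h1 : w.1 1 = ε * v.1 1 := by rw [h]; simp
      by_cases hv : v.1 1 = 0
      · simp [h1, hv]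
      · have hw : w.1 1 ≠ 0 := by rw [h1]; simp [hv]
        simp only [hv, hw, if_false]
        rw [h0, h1, map_mul, map_mul, mul_div_mul_left _ _ hε])

/-- Two lax vectors form a basis if representatives of them form a basis of `ℤ[i]²`. -/
def FormBasis (l m : LaxVector) : Prop :=
  ∃ v w : PrimitiveVector, v.lax = l ∧ w.lax = m ∧
    ∃ b : Module.Basis (Fin 2) GaussianInt (Fin 2 → GaussianInt), b 0 = v.1 ∧ b 1 = w.1

/-- A superbasis: a triple of lax vectors, any two of which form a basis. -/
def IsSuperbasis (s : Set LaxVector) : Prop :=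
  s.ncard = 3 ∧ s.Pairwise FormBasis

/-- The six edges of the tetrahedron with vertex set `Fin 4`. -/
abbrev TetraEdge : Type := {e : Sym2 (Fin 4) // ¬ e.IsDiag}

/-- The edge joining two distinct vertices of the tetrahedron. -/
def tetraEdge (i j : Fin 4) (h : i ≠ j) : TetraEdge := ⟨s(i, j), by simpa using h⟩

/-- The side of a triangle `f` of the tetrahedron that joins its vertices `f i` and `f j`. -/
def side (f : Fin 3 ↪ Fin 4) (i j : Fin 3) (h : i ≠ j) : TetraEdge :=
  tetraEdge (f i) (f j) (f.injective.ne h)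

/-- The labels on the sides of the triangle `f` of a tetrahedron with labelled edges. -/
def sideLabels (label : TetraEdge → LaxVector) (f : Fin 3 ↪ Fin 4) : Set LaxVector :=
  {l | ∃ (i j : Fin 3) (h : i ≠ j), l = label (side f i j h)}

/-- An ultrabasis tetrahedron (with numbered vertices): its six edges are labelled with six
distinct lax vectors, such that the labels on each of its four triangles form a superbasis. -/
structure Ultrabasis where
  label : TetraEdge → LaxVector
  label_injective : Function.Injective label
  superbasis : ∀ f : Fin 3 ↪ Fin 4, IsSuperbasis (sideLabels label f)

/-! ### The Apollonian kingdom -/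

/-- The triangle `f` of `T` and the triangle `g` of `T'` are the same wall: their sides carry the
same labels (with the vertex `f k` matching the vertex `g k`). -/
def SameWall (T T' : Ultrabasis) (f g : Fin 3 ↪ Fin 4) : Prop :=
  ∀ (i j : Fin 3) (h : i ≠ j), T.label (side f i j h) = T'.label (side g i j h)

/-- Identification of the vertices of tetrahedra along common walls. Renumberings of a tetrahedron
share all their walls with it, so they become identified with it as well. -/
inductive VertexGlue : Ultrabasis × Fin 4 → Ultrabasis × Fin 4 → Prop
  | mk (T T' : Ultrabasis) (f g : Fin 3 ↪ Fin 4) (h : SameWall T T' f g) (k : Fin 3) :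
      VertexGlue (T, f k) (T', g k)

/-- Identification of the edges of tetrahedra along common walls. -/
inductive EdgeGlue : Ultrabasis × TetraEdge → Ultrabasis × TetraEdge → Prop
  | mk (T T' : Ultrabasis) (f g : Fin 3 ↪ Fin 4) (h : SameWall T T' f g)
      (i j : Fin 3) (hij : i ≠ j) : EdgeGlue (T, side f i j hij) (T', side g i j hij)

/-- Graphs with labelled edges (a priori with loops and multiple edges). -/
structure LabelledGraph (L : Type) where
  Vert : Type
  Edge : Type
  ends : Edge → Sym2 Vert
  label : Edge → L

/-- The simple graph underlying a labelled graph. -/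
def LabelledGraph.toSimpleGraph {L : Type} (G : LabelledGraph L) : SimpleGraph G.Vert where
  Adj p q := p ≠ q ∧ ∃ e, G.ends e = s(p, q)
  symm := ⟨by
    rintro p q ⟨h, e, he⟩
    exact ⟨h.symm, e, by rw [he, Sym2.eq_swap]⟩⟩
  loopless := ⟨fun _ h => h.1 rfl⟩

/-- The connected components of a labelled graph. -/
abbrev LabelledGraph.Component {L : Type} (G : LabelledGraph L) : Type :=
  G.toSimpleGraph.ConnectedComponent

/-- The Apollonian kingdom: all ultrabasis tetrahedra, identified along common walls. -/
def kingdom : LabelledGraph LaxVector where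
  Vert := Quot VertexGlue
  Edge := Quot EdgeGlue
  ends := Quot.lift (fun x => x.2.1.map (fun i => Quot.mk VertexGlue (x.1, i))) (by
    rintro _ _ ⟨T, T', f, g, h, i, j, hij⟩
    simp only [side, tetraEdge, Sym2.map_mk]
    rw [Quot.sound (VertexGlue.mk T T' f g h i), Quot.sound (VertexGlue.mk T T' f g h j)])
  label := Quot.lift (fun x => x.1.label x.2) (by
    rintro _ _ ⟨T, T', f, g, h, i, j, hij⟩
    exact h i j hij)

/-- The vertex of the kingdom given by the vertex `i` of the tetrahedron `T`. -/
def Ultrabasis.vertex (T : Ultrabasis) (i : Fin 4) : kingdom.Vert := Quot.mk VertexGlue (T, i)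

/-- Two ultrabasis tetrahedra are the same as labelled graphs up to renumbering of the vertices. -/
instance chamberSetoid : Setoid Ultrabasis where
  r T T' := ∃ σ : Equiv.Perm (Fin 4), ∀ (i j : Fin 4) (h : i ≠ j),
    T.label (tetraEdge i j h) = T'.label (tetraEdge (σ i) (σ j) (σ.injective.ne h))
  iseqv :=
    { refl := fun T => ⟨Equiv.refl _, fun _ _ _ => rfl⟩
      symm := by
        rintro T T' ⟨σ, h⟩
        refine ⟨σ.symm, fun i j hij => ?_⟩
        rw [h]
        simp
      trans := by
        rintro T T' T'' ⟨σ, h⟩ ⟨τ, h'⟩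
        exact ⟨σ.trans τ, fun i j hij => by rw [h, h']; rfl⟩ }

/-- Chambers: ultrabasis tetrahedra up to isomorphism of labelled graphs. -/
def Chamber : Type := Quotient chamberSetoid

theorem exists_triangle (i : Fin 4) : ∃ (f : Fin 3 ↪ Fin 4) (k : Fin 3), f k = i := by
  by_cases h : i = 0
  · exact ⟨Fin.castSuccEmb, 0, by simp [h]⟩
  · obtain ⟨k, hk⟩ := Fin.exists_succ_eq.2 h
    exact ⟨Fin.succEmb 3, k, by simpa using hk⟩

/-- The set of vertices in the kingdom of a chamber. -/
def Chamber.vertices : Chamber → Set kingdom.Vert :=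
  Quotient.lift (fun T : Ultrabasis => range T.vertex) (by
    rintro T T' ⟨σ, h⟩
    have key : ∀ i, T.vertex i = T'.vertex (σ i) := by
      intro i
      obtain ⟨f, k, rfl⟩ := exists_triangle i
      exact Quot.sound (VertexGlue.mk T T' f (f.trans σ.toEmbedding)
        (fun a b hab => h _ _ (f.injective.ne hab)) k)
    have : T.vertex = T'.vertex ∘ σ := funext key
    simp only [this, σ.surjective.range_comp])

/-- The set of vertices in the kingdom of the wall with labels `s`, that is, all vertices of all
triangles whose sides are labelled by `s`. -/
def wallVertices (s : Set LaxVector) : Set kingdom.Vert :=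
  {p | ∃ (T : Ultrabasis) (f : Fin 3 ↪ Fin 4) (k : Fin 3),
    sideLabels T.label f = s ∧ p = T.vertex (f k)}

/-! ### Oriented circles in the extended complex plane -/

/-- An oriented circle in `ℂ ∪ {∞}`: a Euclidean circle, or a line together with `∞`. The
orientation is recorded by the interior, one of the two components of the complement
(the one to the right of the direction of travel). -/
@[ext] structure OrientedCircle where
  carrier : Set (OnePoint ℂ)
  interior : Set (OnePoint ℂ)
  isCircle :
    (∃ (c : ℂ) (r : ℝ), 0 < r ∧
      carrier = (fun z : ℂ => (z : OnePoint ℂ)) '' Metric.sphere c r ∧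
      (interior = (fun z : ℂ => (z : OnePoint ℂ)) '' Metric.ball c r ∨
        interior = ((fun z : ℂ => (z : OnePoint ℂ)) '' Metric.closedBall c r)ᶜ)) ∨
    (∃ (a : ℂ) (t : ℝ), a ≠ 0 ∧
      carrier = insert ∞
        ((fun z : ℂ => (z : OnePoint ℂ)) '' {z | ((starRingEnd ℂ) a * z).re = t}) ∧
      interior = (fun z : ℂ => (z : OnePoint ℂ)) '' {z | t < ((starRingEnd ℂ) a * z).re})

/-- The Möbius transformation of `ℂ ∪ {∞}` given by a matrix in `GL₂(ℤ[i])`. -/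
def moebius (M : GL (Fin 2) GaussianInt) (z : OnePoint ℂ) : OnePoint ℂ :=
  Matrix.GeneralLinearGroup.map GaussianInt.toComplex M • z

/-- An oriented circle is Gaussian if it is the image of the real line, oriented to the right
(so that the interior is the lower half-plane), under a Möbius transformation
in `PGL₂(ℤ[i])`. -/
def OrientedCircle.IsGaussian (C : OrientedCircle) : Prop :=
  ∃ M : GL (Fin 2) GaussianInt,
    C.carrier = moebius M '' insert ∞ (range fun x : ℝ => ((x : ℂ) : OnePoint ℂ)) ∧
    C.interior = moebius M '' ((fun z : ℂ => (z : OnePoint ℂ)) '' {z | z.im < 0})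

/-- Two circles are tangent if they meet in exactly one point. -/
def Tangent (C D : OrientedCircle) : Prop := ∃ p, C.carrier ∩ D.carrier = {p}

/-- The circles in `s` are mutually tangent and have disjoint interiors. -/
def MutuallyTangent (s : Set OrientedCircle) : Prop :=
  s.Pairwise fun C D => Tangent C D ∧ Disjoint C.interior D.interior

/-- Descartes quadruples: four mutually tangent oriented circles of disjoint interiors. -/
def IsDescartesQuadruple (q : Set OrientedCircle) : Prop :=
  q.ncard = 4 ∧ MutuallyTangent q

/-- Descartes quadruples of Gaussian circles. -/
def IsGaussianDescartesQuadruple (q : Set OrientedCircle) : Prop :=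
  IsDescartesQuadruple q ∧ ∀ C ∈ q, C.IsGaussian

/-- The circles obtained from the circles in `t` by repeatedly adding all completions of
triples of circles already obtained to Descartes quadruples. -/
inductive Generated (t : Set OrientedCircle) : OrientedCircle → Prop
  | seed (C : OrientedCircle) : C ∈ t → Generated t C
  | completion (A B C D : OrientedCircle) : Generated t A → Generated t B → Generated t C →
      IsDescartesQuadruple {A, B, C, D} → Generated t D

/-- Apollonian circle packings, generated by three mutually tangent oriented circles of disjoint
interiors. -/
def IsApollonianPacking (P : Set OrientedCircle) : Prop :=
  ∃ t : Set OrientedCircle, t.ncard = 3 ∧ MutuallyTangent t ∧ P = {C | Generated t C}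

/-- Gaussian Apollonian circle packings: all circles are Gaussian. -/
def IsGaussianPacking (P : Set OrientedCircle) : Prop :=
  IsApollonianPacking P ∧ ∀ C ∈ P, C.IsGaussian

/-- The Apollonian palace of a packing: its vertices are the circles of the packing, its edges join
tangent circles. -/
def palace (P : Set OrientedCircle) : SimpleGraph P where
  Adj C D := C ≠ D ∧ Tangent C.1 D.1
  symm := ⟨by
    rintro C D ⟨h, p, hp⟩
    exact ⟨h.symm, p, by rw [inter_comm, hp]⟩⟩
  loopless := ⟨fun _ h => h.1 rfl⟩

/-- The label of the edge joining `C` and `D` in a palace is `l`: the lax vector `l` gives the point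
of tangency. -/
def IsTangencyLabel (C D : OrientedCircle) (l : LaxVector) : Prop :=
  C.carrier ∩ D.carrier = {l.point}

/-- The map `Φ` from the vertices of `G` to oriented circles induces an isomorphism of graphs with
labelled edges from the component `K` of `G` onto the edge-labelled Apollonian palace of `P`. -/
structure IsPalaceIso (G : LabelledGraph LaxVector) (Φ : G.Vert → OrientedCircle)
    (K : G.Component) (P : Set OrientedCircle) : Prop where
  vertices : BijOn Φ K.supp P
  edges : BijOn (fun e => (G.ends e).map Φ) {e | ∀ p ∈ G.ends e, p ∈ K.supp}
    (Sym2.map Subtype.val '' (palace P).edgeSet)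
  labels : ∀ e p q, G.ends e = s(p, q) → p ∈ K.supp → q ∈ K.supp →
    IsTangencyLabel (Φ p) (Φ q) (G.label e)

end Apollonian

end

/-!
An oriented circle of the extended plane is the same thing as a Hermitian form `H` on `ℂ²` of
determinant `-1`: the circle is the zero set of `H` and its interior the set where `H < 0`. The
polarized negative of the determinant is a Lorentzian product on these forms, for which the forms of
circles have square `1` and for which distinct externally tangent circles have product `-1`. A lax
vector `l` has the degenerate form `v ↦ |det (v, l)|²`, and two lax vectors form a basis exactly
when the product of their forms is `-1 / 2`.

The link between labels and circles is that the forms of two externally tangent Gaussian circles of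
a Descartes quadruple add up to twice the form of the lax vector of the point of tangency. So the
six labels of an ultrabasis chamber determine four forms: on each triangle, the form of a vertex is
the sum of the forms of the two adjacent labels minus the form of the opposite one. The answer does
not depend on the triangle because of the identity `octahedron_sums`, which makes the sums of the
forms of opposite labels agree. Conversely four forms with the Gram matrix of a Descartes quadruple
and with labels for their pairwise sums come from a unique chamber (`Ultrabasis.exists_form_eq`).
Since vertices of glued walls receive the same form, this defines a map `vertexCircle` on the
vertices of the kingdom.

Everything is now moved to a standard position by `GL₂(ℤ[i])`, which acts transitively on
superbases with a numbering (`exists_act_of_superbasis`); hence every chamber is an image of one of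
the two standard chambers on the standard wall (`Ultrabasis.exists_eq_stdUltrabasis`). This gives
that the circles of the kingdom are exactly the Gaussian ones. For injectivity on vertices
(`vertexForm_injective`), two matrices that send the real line to the same oriented circle differ,
up to a unit, by an element of the modular group; its generators move the standard chamber through
walls that keep the vertex of the real line. For injectivity on edges (`edge_eq_of_form_eq`), the
relevant stabilizer consists of translations, up to signs.

That the Descartes quadruples and tangent triples of Gaussian circles all come from the kingdom is
an integrality argument (`exists_lax_of_triple`): the coefficients of the forms are integers with
the leading ones even, so the sum of two of them is twice an integral multiple of the form of a lax
vector, and the third circle forces this multiple to be one.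

Finally the components. The packing generated by three circles of a chamber stays in the component
of the chamber because each completion of three vertices is a chamber, and it exhausts the component
because one passes from chamber to chamber through walls. It remains to see that two tangent circles
of one component are joined by an edge. Fix a vertex and walk away from it through reduced chains of
chambers (`Away`). The Lorentzian product of the form of the fixed vertex with the last form of the
chain is monotone along the chain by the linear Descartes relation (`Away.lorentz_le`), which
excludes tangency with any vertex outside the chambers of the fixed one.
-/

noncomputable section

open Set OnePoint ComplexConjugate Complex

namespace Apollonian

/-! ### Hermitian forms on `ℂ²` -/

/-- Hermitian forms `a |z|² + b |w|² - 2 Re (β̄ z w̄)` on `ℂ²`, recorded as `(a, b, β)`. -/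
abbrev HermForm : Type := ℝ × ℝ × ℂ

namespace HermForm

/-- The value of a Hermitian form at a vector of `ℂ²`. -/
def eval (H : HermForm) (v : Fin 2 → ℂ) : ℝ :=
  H.1 * normSq (v 0) + H.2.1 * normSq (v 1) - 2 * (conj H.2.2 * v 0 * conj (v 1)).re

/-- The Lorentzian inner product on Hermitian forms, the polarization of minus the determinant. -/
def lorentz : LinearMap.BilinForm ℝ HermForm :=
  LinearMap.mk₂ ℝ (fun H K => H.2.2.re * K.2.2.re + H.2.2.im * K.2.2.im -
      (H.1 * K.2.1 + K.1 * H.2.1) / 2)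
    (fun _ _ _ => by simp; ring) (fun _ _ _ => by simp; ring)
    (fun _ _ _ => by simp; ring) (fun _ _ _ => by simp; ring)

theorem lorentz_apply (H K : HermForm) :
    lorentz H K = H.2.2.re * K.2.2.re + H.2.2.im * K.2.2.im -
      (H.1 * K.2.1 + K.1 * H.2.1) / 2 := rfl

theorem lorentz_comm (H K : HermForm) : lorentz H K = lorentz K H := by
  simp only [lorentz_apply]; ring

@[ext]
theorem ext_coords {H K : HermForm} (h₁ : H.1 = K.1) (h₂ : H.2.1 = K.2.1)
    (h₃ : H.2.2.re = K.2.2.re) (h₄ : H.2.2.im = K.2.2.im) : H = K :=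
  Prod.ext h₁ (Prod.ext h₂ (Complex.ext h₃ h₄))

theorem eval_add (H K : HermForm) (v : Fin 2 → ℂ) : (H + K).eval v = H.eval v + K.eval v := by
  simp [eval]; ring

theorem eval_smul_form (t : ℝ) (H : HermForm) (v : Fin 2 → ℂ) :
    (t • H).eval v = t * H.eval v := by
  simp [eval]; ring

theorem eval_smul (H : HermForm) (k : ℂ) (v : Fin 2 → ℂ) :
    H.eval (k • v) = normSq k * H.eval v := by
  simp [eval, normSq_apply]; ring

theorem ext_eval {H K : HermForm} (h : ∀ v, H.eval v = K.eval v) : H = K := by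
  have h₁ := h ![1, 0]
  have h₂ := h ![0, 1]
  have h₃ := h ![1, 1]
  have h₄ := h ![I, 1]
  simp [eval] at h₁ h₂ h₃ h₄
  ext <;> linarith

/-- The pullback of a Hermitian form under a linear map. -/
def pull (M : Matrix (Fin 2) (Fin 2) ℂ) : HermForm →ₗ[ℝ] HermForm where
  toFun H := (H.eval (M.col 0), H.eval (M.col 1),
    conj (-(H.1 * M 0 0 * conj (M 0 1)) - H.2.1 * M 1 0 * conj (M 1 1) +
      conj H.2.2 * M 0 0 * conj (M 1 1) + H.2.2 * M 1 0 * conj (M 0 1)))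
  map_add' H K := by ext <;> simp [eval] <;> ring
  map_smul' t H := by ext <;> simp [eval] <;> ring

theorem eval_pull (M : Matrix (Fin 2) (Fin 2) ℂ) (H : HermForm) (v : Fin 2 → ℂ) :
    (pull M H).eval v = H.eval (M.mulVec v) := by
  simp [pull, eval, Matrix.mulVec, dotProduct, Fin.sum_univ_two, normSq_apply, Matrix.col]
  ring

theorem pull_mul (M N : Matrix (Fin 2) (Fin 2) ℂ) (H : HermForm) :
    pull (M * N) H = pull N (pull M H) :=
  ext_eval fun v => by simp only [eval_pull, Matrix.mulVec_mulVec]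

theorem pull_one (H : HermForm) : pull 1 H = H :=
  ext_eval fun v => by simp [eval_pull]

theorem lorentz_pull (M : Matrix (Fin 2) (Fin 2) ℂ) (H K : HermForm) :
    lorentz (pull M H) (pull M K) = normSq M.det * lorentz H K := by
  simp [pull, eval, lorentz_apply, normSq_apply, Matrix.det_fin_two, Matrix.col]
  ring

/-- The degenerate form `v ↦ |det (v, l)|²` that vanishes exactly on the line spanned by `l`. -/
def null (l : Fin 2 → ℂ) : HermForm := (normSq (l 1), normSq (l 0), l 0 * conj (l 1))

theorem eval_null (l v : Fin 2 → ℂ) : (null l).eval v = normSq (v 0 * l 1 - v 1 * l 0) := by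
  simp [null, eval, normSq_apply]; ring

theorem lorentz_null (l m : Fin 2 → ℂ) :
    lorentz (null l) (null m) = -normSq (l 0 * m 1 - l 1 * m 0) / 2 := by
  simp [null, lorentz_apply, normSq_apply]; ring

theorem null_smul (k : ℂ) (l : Fin 2 → ℂ) : null (k • l) = normSq k • null l := by
  ext <;> simp [null, normSq_apply] <;> ring

theorem pull_null (M : Matrix (Fin 2) (Fin 2) ℂ) (l : Fin 2 → ℂ) :
    pull M (null (M.mulVec l)) = normSq M.det • null l :=
  ext_eval fun v => by
    rw [eval_pull, eval_smul_form, eval_null, eval_null, ← normSq_mul]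
    congr 1
    simp [Matrix.mulVec, dotProduct, Fin.sum_univ_two, Matrix.det_fin_two]
    ring

theorem lorentz_nondegenerate {H : HermForm} (h : ∀ K, lorentz H K = 0) : H = 0 := by
  have h₁ := h (1, 0, 0)
  have h₂ := h (0, 1, 0)
  have h₃ := h (0, 0, 1)
  have h₄ := h (0, 0, I)
  simp [lorentz_apply] at h₁ h₂ h₃ h₄
  ext <;> simp [*]

/-- In the four-dimensional space of Hermitian forms, a form orthogonal to four pairwise orthogonal
non-isotropic ones vanishes. -/
theorem eq_zero_of_orthogonal {e : Fin 4 → HermForm} (he : ∀ i, lorentz (e i) (e i) ≠ 0)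
    (ho : ∀ i j, i ≠ j → lorentz (e i) (e j) = 0) {H : HermForm}
    (hH : ∀ i, lorentz H (e i) = 0) : H = 0 := by
  have hli : LinearIndependent ℝ e :=
    LinearMap.BilinForm.linearIndependent_of_iIsOrtho (B := lorentz)
      (by rw [LinearMap.BilinForm.iIsOrtho_def]; exact ho)
      (by intro i; exact he i)
  have hspan : Submodule.span ℝ (range e) = ⊤ :=
    hli.span_eq_top_of_card_eq_finrank (by simp)
  refine lorentz_nondegenerate fun K => ?_
  have hle : Submodule.span ℝ (range e) ≤ LinearMap.ker (lorentz H) := by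
    rw [Submodule.span_le]
    rintro _ ⟨i, rfl⟩
    exact hH i
  exact hle (hspan ▸ Submodule.mem_top)

/-- The orthogonal complement of three pairwise orthogonal non-isotropic forms is a line. -/
theorem smul_eq_smul_of_orthogonal {d : Fin 3 → HermForm} (hd : ∀ i, lorentz (d i) (d i) ≠ 0)
    (ho : ∀ i j, i ≠ j → lorentz (d i) (d j) = 0) {s t : HermForm}
    (hs : ∀ i, lorentz s (d i) = 0) (ht : ∀ i, lorentz t (d i) = 0) (htt : lorentz t t ≠ 0) :
    lorentz t t • s = lorentz s t • t := by
  rw [← sub_eq_zero]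
  have ht' : ∀ i, lorentz (d i) t = 0 := fun i => by rw [lorentz_comm, ht]
  refine eq_zero_of_orthogonal (e := Fin.cons t d) ?_ ?_ ?_
  · intro k
    induction k using Fin.cases with
    | zero => simpa using htt
    | succ k => simpa using hd k
  · intro k l hkl
    induction k using Fin.cases with
    | zero =>
      induction l using Fin.cases with
      | zero => exact absurd rfl hkl
      | succ l => simpa using ht l
    | succ k =>
      induction l using Fin.cases with
      | zero => simpa using ht' k
      | succ l => simpa using ho k l (fun h => hkl (by rw [h]))
  · intro k
    rw [map_sub, LinearMap.sub_apply, LinearMap.map_smul, LinearMap.map_smul,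
      LinearMap.smul_apply, LinearMap.smul_apply]
    induction k using Fin.cases with
    | zero => simp only [Fin.cons_zero, smul_eq_mul]; ring
    | succ k => simp [hs, ht]

/-- Six null vectors arranged like the vertices of an octahedron, with inner product `-1/2` along
its edges, have equal sums over the three pairs of opposite vertices. The three differences of
opposite vectors span a definite subspace orthogonal to the three sums, which therefore lie in a
line; comparing lengths shows that they agree. -/
theorem octahedron_sums {n m : Fin 3 → HermForm}
    (hn : ∀ i, lorentz (n i) (n i) = 0) (hm : ∀ i, lorentz (m i) (m i) = 0)
    (hneg : ∀ i, lorentz (n i) (m i) < 0)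
    (hnn : ∀ i j, i ≠ j → lorentz (n i) (n j) = -1 / 2)
    (hmm : ∀ i j, i ≠ j → lorentz (m i) (m j) = -1 / 2)
    (hnm : ∀ i j, i ≠ j → lorentz (n i) (m j) = -1 / 2) (i j : Fin 3) :
    n i + m i = n j + m j := by
  rcases eq_or_ne i j with rfl | hij
  · rfl
  have hmn : ∀ i j, i ≠ j → lorentz (m i) (n j) = -1 / 2 := fun i j h => by
    rw [lorentz_comm, hnm j i h.symm]
  have hc : ∀ i, lorentz (m i) (n i) = lorentz (n i) (m i) := fun i => lorentz_comm _ _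
  have hdd : ∀ i j, i ≠ j → lorentz (n i - m i) (n j - m j) = 0 := fun i j h => by
    simp [hnn i j h, hmm i j h, hnm i j h, hmn i j h]
  have hdd' : ∀ i, lorentz (n i - m i) (n i - m i) = -2 * lorentz (n i) (m i) := fun i => by
    simp [hn, hm, hc]; ring
  have hsd : ∀ i j, lorentz (n i + m i) (n j - m j) = 0 := fun i j => by
    rcases eq_or_ne i j with rfl | h
    · simp [hn, hm, hc]
    · simp [hnn i j h, hmm i j h, hnm i j h, hmn i j h]
  have hss : ∀ i j, i ≠ j → lorentz (n i + m i) (n j + m j) = -2 := fun i j h => by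
    simp [hnn i j h, hmm i j h, hnm i j h, hmn i j h]; norm_num
  have hss' : ∀ i, lorentz (n i + m i) (n i + m i) = 2 * lorentz (n i) (m i) := fun i => by
    simp [hn, hm, hc]; ring
  have hprop : lorentz (n j + m j) (n j + m j) • (n i + m i) =
      lorentz (n i + m i) (n j + m j) • (n j + m j) :=
    smul_eq_smul_of_orthogonal (d := fun i => n i - m i)
      (fun i => by rw [hdd']; exact ne_of_gt (by linarith [hneg i])) hdd
      (hsd i) (hsd j) (by rw [hss']; exact ne_of_lt (by linarith [hneg j]))
  -- Pairing with the third sum determines the factor.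
  obtain ⟨k, hki, hkj⟩ : ∃ k, i ≠ k ∧ j ≠ k :=
    (by decide : ∀ i j : Fin 3, ∃ k, i ≠ k ∧ j ≠ k) i j
  have := congrArg (fun X => lorentz X (n k + m k)) hprop
  simp only [LinearMap.map_smul, LinearMap.smul_apply, smul_eq_mul] at this
  rw [hss _ _ hki, hss _ _ hkj, hss _ _ hij] at this
  rw [show lorentz (n j + m j) (n j + m j) = -2 by linarith, hss _ _ hij] at hprop
  exact smul_right_injective _ (by norm_num : (-2 : ℝ) ≠ 0) hprop

end HermForm

open HermForm

/-! ### The Hermitian form of a lax vector -/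

/-- The complex vector of a vector of Gaussian integers. -/
def complexVec (v : Fin 2 → GaussianInt) : Fin 2 → ℂ := fun i => GaussianInt.toComplex (v i)

theorem complexVec_smul (k : GaussianInt) (v : Fin 2 → GaussianInt) :
    complexVec (k • v) = GaussianInt.toComplex k • complexVec v := by
  ext i; simp [complexVec]

theorem norm_eq_one_iff_isUnit (z : GaussianInt) : z.norm = 1 ↔ IsUnit z := by
  rw [Zsqrtd.isUnit_iff_norm_isUnit, Int.isUnit_iff]
  have := GaussianInt.norm_nonneg z
  omega

theorem normSq_toComplex_unit (ε : GaussianIntˣ) :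
    normSq (GaussianInt.toComplex (ε : GaussianInt)) = 1 := by
  rw [← GaussianInt.intCast_real_norm, (norm_eq_one_iff_isUnit _).2 ε.isUnit, Int.cast_one]

/-- The degenerate Hermitian form that vanishes at a lax vector. -/
def LaxVector.form : LaxVector → HermForm :=
  Quotient.lift (fun v : PrimitiveVector => null (complexVec v.1)) (by
    rintro v w ⟨ε, h⟩
    simp only [h, complexVec_smul, null_smul, normSq_toComplex_unit, one_smul])

theorem form_lax (v : PrimitiveVector) : v.lax.form = null (complexVec v.1) := rfl

theorem LaxVector.exists_rep (l : LaxVector) : ∃ v : PrimitiveVector, v.lax = l :=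
  Quotient.exists_rep l

theorem lorentz_form_lax (v w : PrimitiveVector) :
    lorentz v.lax.form w.lax.form = -((v.1 0 * w.1 1 - v.1 1 * w.1 0).norm : ℝ) / 2 := by
  rw [form_lax, form_lax, lorentz_null, GaussianInt.intCast_real_norm]
  simp [complexVec]

theorem LaxVector.lorentz_form_self (l : LaxVector) : lorentz l.form l.form = 0 := by
  obtain ⟨v, rfl⟩ := l.exists_rep
  rw [lorentz_form_lax]
  simp [mul_comm]

theorem lax_eq_of_det_eq_zero {v w : PrimitiveVector}
    (h : v.1 0 * w.1 1 - v.1 1 * w.1 0 = 0) : v.lax = w.lax := by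
  obtain ⟨a, b, hab⟩ := v.2
  obtain ⟨c, d, hcd⟩ := w.2
  have hw : w.1 = (a * w.1 0 + b * w.1 1) • v.1 := by
    ext1 i
    fin_cases i
    · simp only [Fin.zero_eta, Pi.smul_apply, smul_eq_mul]
      linear_combination w.1 0 * (-hab) - b * h
    · simp only [Fin.mk_one, Pi.smul_apply, smul_eq_mul]
      linear_combination w.1 1 * (-hab) + a * h
  have h1 : (c * v.1 0 + d * v.1 1) * (a * w.1 0 + b * w.1 1) = 1 := by
    have h0 := congrFun hw 0
    have h1 := congrFun hw 1
    simp only [Pi.smul_apply, smul_eq_mul] at h0 h1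
    linear_combination hcd - c * h0 - d * h1
  exact Quotient.sound ⟨⟨_, _, by rw [mul_comm]; exact h1, h1⟩, hw⟩

theorem LaxVector.eq_of_lorentz_form_eq_zero {l m : LaxVector}
    (h : lorentz l.form m.form = 0) : l = m := by
  obtain ⟨v, rfl⟩ := l.exists_rep
  obtain ⟨w, rfl⟩ := m.exists_rep
  rw [lorentz_form_lax] at h
  refine lax_eq_of_det_eq_zero (GaussianInt.norm_eq_zero.1 ?_)
  have : ((v.1 0 * w.1 1 - v.1 1 * w.1 0).norm : ℝ) = 0 := by linarith
  exact_mod_cast this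

theorem LaxVector.form_injective : Function.Injective LaxVector.form := fun l m h =>
  LaxVector.eq_of_lorentz_form_eq_zero (by rw [h, m.lorentz_form_self])

theorem LaxVector.lorentz_form_neg {l m : LaxVector} (h : l ≠ m) :
    lorentz l.form m.form < 0 := by
  refine lt_of_le_of_ne ?_ fun h' => h (LaxVector.eq_of_lorentz_form_eq_zero h')
  obtain ⟨v, rfl⟩ := l.exists_rep
  obtain ⟨w, rfl⟩ := m.exists_rep
  rw [lorentz_form_lax, GaussianInt.intCast_real_norm]
  linarith [normSq_nonneg (GaussianInt.toComplex (v.1 0 * w.1 1 - v.1 1 * w.1 0))]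

theorem exists_basis_iff_isUnit (v w : Fin 2 → GaussianInt) :
    (∃ b : Module.Basis (Fin 2) GaussianInt (Fin 2 → GaussianInt), b 0 = v ∧ b 1 = w) ↔
      IsUnit (v 0 * w 1 - v 1 * w 0) := by
  have hdet : (Pi.basisFun GaussianInt (Fin 2)).det ![v, w] = v 0 * w 1 - v 1 * w 0 := by
    rw [Pi.basisFun_det_apply, Matrix.det_fin_two]
    simp [Matrix.of_apply]
  rw [← hdet, ← Module.Basis.is_basis_iff_det]
  constructor
  · rintro ⟨b, rfl, rfl⟩
    have : ![b 0, b 1] = b := by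
      funext i; fin_cases i <;> rfl
    rw [this]
    exact ⟨b.linearIndependent, b.span_eq⟩
  · rintro ⟨h₁, h₂⟩
    exact ⟨Module.Basis.mk h₁ h₂.ge, by simp, by simp⟩

/-- Two lax vectors form a basis exactly when their forms have inner product `-1/2`. -/
theorem formBasis_iff {l m : LaxVector} : FormBasis l m ↔ lorentz l.form m.form = -1 / 2 := by
  have key : ∀ v w : PrimitiveVector, IsUnit (v.1 0 * w.1 1 - v.1 1 * w.1 0) ↔
      lorentz v.lax.form w.lax.form = -1 / 2 := fun v w => by
    rw [lorentz_form_lax, ← norm_eq_one_iff_isUnit, ← Int.cast_inj (α := ℝ), Int.cast_one]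
    constructor <;> intro h <;> linarith
  constructor
  · rintro ⟨v, w, rfl, rfl, h⟩
    exact (key v w).1 ((exists_basis_iff_isUnit _ _).1 h)
  · intro h
    obtain ⟨v, rfl⟩ := l.exists_rep
    obtain ⟨w, rfl⟩ := m.exists_rep
    exact ⟨v, w, rfl, rfl, (exists_basis_iff_isUnit _ _).2 ((key v w).2 h)⟩

/-! ### The action of `GL₂(ℤ[i])` on Hermitian forms -/

/-- The complex matrix of an element of `GL₂(ℤ[i])`. -/
def complexMat (M : GL (Fin 2) GaussianInt) : Matrix (Fin 2) (Fin 2) ℂ :=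
  (Matrix.GeneralLinearGroup.map GaussianInt.toComplex M).1

theorem complexMat_apply (M : GL (Fin 2) GaussianInt) (i j : Fin 2) :
    complexMat M i j = GaussianInt.toComplex (M.1 i j) := rfl

theorem complexMat_mul (M N : GL (Fin 2) GaussianInt) :
    complexMat (M * N) = complexMat M * complexMat N := by
  simp [complexMat]

theorem complexMat_one : complexMat 1 = 1 := by simp [complexMat]

theorem normSq_det_complexMat (M : GL (Fin 2) GaussianInt) : normSq (complexMat M).det = 1 := by
  have : (complexMat M).det = GaussianInt.toComplex M.1.det :=
    (RingHom.map_det GaussianInt.toComplex M.1).symm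
  rw [this, ← GaussianInt.intCast_real_norm,
    (norm_eq_one_iff_isUnit _).2 ((Matrix.isUnit_iff_isUnit_det _).1 M.isUnit), Int.cast_one]

/-- The action of `GL₂(ℤ[i])` on Hermitian forms: `(M H)(v) = H (M⁻¹ v)`. -/
def act (M : GL (Fin 2) GaussianInt) : HermForm →ₗ[ℝ] HermForm := pull (complexMat M⁻¹)

theorem act_mul (M N : GL (Fin 2) GaussianInt) (H : HermForm) :
    act (M * N) H = act M (act N H) := by
  rw [act, mul_inv_rev, complexMat_mul, pull_mul]; rfl

theorem act_one (H : HermForm) : act 1 H = H := by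
  rw [act, inv_one, complexMat_one, pull_one]

theorem act_inv_act (M : GL (Fin 2) GaussianInt) (H : HermForm) : act M⁻¹ (act M H) = H := by
  rw [← act_mul, inv_mul_cancel, act_one]

theorem act_act_inv (M : GL (Fin 2) GaussianInt) (H : HermForm) : act M (act M⁻¹ H) = H := by
  rw [← act_mul, mul_inv_cancel, act_one]

theorem act_injective (M : GL (Fin 2) GaussianInt) : Function.Injective (act M) :=
  Function.LeftInverse.injective (act_inv_act M)

theorem lorentz_act (M : GL (Fin 2) GaussianInt) (H K : HermForm) :
    lorentz (act M H) (act M K) = lorentz H K := by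
  rw [act, lorentz_pull, normSq_det_complexMat, one_mul]

theorem act_null (M : GL (Fin 2) GaussianInt) (l : Fin 2 → ℂ) :
    act M (null l) = null ((complexMat M).mulVec l) := by
  have h := pull_null (complexMat M⁻¹) ((complexMat M).mulVec l)
  rwa [Matrix.mulVec_mulVec, ← complexMat_mul, inv_mul_cancel, complexMat_one, Matrix.one_mulVec,
    normSq_det_complexMat, one_smul] at h

theorem complexVec_mulVec (M : GL (Fin 2) GaussianInt) (v : Fin 2 → GaussianInt) :
    complexVec (M.1.mulVec v) = (complexMat M).mulVec (complexVec v) := by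
  ext i
  simp [complexVec, Matrix.mulVec, dotProduct, complexMat_apply]

theorem isCoprime_mulVec (M : GL (Fin 2) GaussianInt) (v : PrimitiveVector) :
    IsCoprime (M.1.mulVec v.1 0) (M.1.mulVec v.1 1) := by
  obtain ⟨a, b, h⟩ := v.2
  have hv : (M⁻¹).1.mulVec (M.1.mulVec v.1) = v.1 := by
    rw [Matrix.mulVec_mulVec, ← Units.val_mul, inv_mul_cancel]; simp
  have h0 := congrFun hv 0
  have h1 := congrFun hv 1
  rw [Matrix.mulVec, dotProduct, Fin.sum_univ_two] at h0 h1
  exact ⟨a * (M⁻¹).1 0 0 + b * (M⁻¹).1 1 0, a * (M⁻¹).1 0 1 + b * (M⁻¹).1 1 1, by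
    linear_combination h + a * h0 + b * h1⟩

/-- The image of a lax vector under `GL₂(ℤ[i])`, in terms of forms. -/
theorem LaxVector.exists_form_eq_act (M : GL (Fin 2) GaussianInt) (l : LaxVector) :
    ∃ m : LaxVector, m.form = act M l.form := by
  obtain ⟨v, rfl⟩ := l.exists_rep
  exact ⟨PrimitiveVector.lax ⟨M.1.mulVec v.1, isCoprime_mulVec M v⟩, by
    rw [form_lax, form_lax, act_null, complexVec_mulVec]⟩

/-- The group `GL₂(ℤ[i])` acts transitively on ordered superbases. -/
theorem exists_act_of_superbasis {l₁ l₂ l₃ : LaxVector}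
    (h₁₂ : lorentz l₁.form l₂.form = -1 / 2) (h₁₃ : lorentz l₁.form l₃.form = -1 / 2)
    (h₂₃ : lorentz l₂.form l₃.form = -1 / 2) :
    ∃ M : GL (Fin 2) GaussianInt, l₁.form = act M (null ![1, 0]) ∧
      l₂.form = act M (null ![0, 1]) ∧ l₃.form = act M (null ![I, 1]) := by
  have key : ∀ v w : PrimitiveVector, lorentz v.lax.form w.lax.form = -1 / 2 →
      IsUnit (v.1 0 * w.1 1 - v.1 1 * w.1 0) := fun v w h => by
    rw [lorentz_form_lax] at h
    rw [← norm_eq_one_iff_isUnit, ← Int.cast_inj (α := ℝ), Int.cast_one]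
    linarith
  obtain ⟨u, rfl⟩ := l₁.exists_rep
  obtain ⟨v, rfl⟩ := l₂.exists_rep
  obtain ⟨w, rfl⟩ := l₃.exists_rep
  obtain ⟨d, hd⟩ := key u v h₁₂
  obtain ⟨β, hβ⟩ := key u w h₁₃
  obtain ⟨α, hα⟩ := key v w h₂₃
  -- By Cramer's rule `d • w = β • v - α • u`, which after rescaling reads `w' = i u' + v'`.
  let i : GaussianIntˣ := ⟨⟨0, 1⟩, ⟨0, -1⟩, by decide, by decide⟩
  have hi : (i : GaussianInt) * i = -1 := by decide
  have hii : (i : GaussianInt) = ⟨0, 1⟩ := rfl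
  have hI : GaussianInt.toComplex (i : GaussianInt) = I := by
    simp [hii, GaussianInt.toComplex_def₂, Complex.ext_iff]
  let A : Matrix (Fin 2) (Fin 2) GaussianInt :=
    !![i * α * u.1 0, β * v.1 0; i * α * u.1 1, β * v.1 1]
  have hA : A.det = (i * α * β * d : GaussianIntˣ) := by
    simp only [A, Matrix.det_fin_two_of, Units.val_mul, hd]
    ring
  let M : GL (Fin 2) GaussianInt := Matrix.GeneralLinearGroup.mk'' A (hA ▸ Units.isUnit _)
  have hM : ∀ a b, complexMat M a b = GaussianInt.toComplex (A a b) := fun _ _ => rfl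
  have null_unit : ∀ (ε : GaussianIntˣ) (l : Fin 2 → GaussianInt),
      null (complexVec l) = null (complexVec ((ε : GaussianInt) • l)) := fun ε l => by
    rw [complexVec_smul, null_smul, normSq_toComplex_unit, one_smul]
  refine ⟨M, ?_, ?_, ?_⟩
  · rw [form_lax, act_null, null_unit (i * α)]
    congr 1
    ext k
    fin_cases k <;> simp [complexVec, hM, A, Matrix.mulVec, dotProduct]
  · rw [form_lax, act_null, null_unit β]
    congr 1
    ext k
    fin_cases k <;> simp [complexVec, hM, A, Matrix.mulVec, dotProduct]
  · rw [form_lax, act_null, null_unit d]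
    congr 1
    ext k
    fin_cases k
    · simp only [complexVec, hM, A, Matrix.mulVec, dotProduct, Fin.sum_univ_two, ← hI]
      simp only [Fin.zero_eta, Pi.smul_apply, smul_eq_mul, Matrix.of_apply, Matrix.cons_val_zero,
        Matrix.cons_val_one, ← map_mul, mul_one, ← map_add]
      congr 1
      linear_combination w.1 0 * hd - v.1 0 * hβ + u.1 0 * hα - α * u.1 0 * hi
    · simp only [complexVec, hM, A, Matrix.mulVec, dotProduct, Fin.sum_univ_two, ← hI]
      simp only [Fin.mk_one, Pi.smul_apply, smul_eq_mul, Matrix.of_apply, Matrix.cons_val_zero,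
        Matrix.cons_val_one, ← map_mul, mul_one, ← map_add]
      congr 1
      linear_combination w.1 1 * hd - v.1 1 * hβ + u.1 1 * hα - α * u.1 1 * hi

/-! ### Ultrabases and quadruples of Hermitian forms -/

theorem tetraEdge_comm (i j : Fin 4) (h : i ≠ j) : tetraEdge i j h = tetraEdge j i h.symm :=
  Subtype.ext Sym2.eq_swap

theorem exists_eq_tetraEdge (e : TetraEdge) : ∃ i j h, e = tetraEdge i j h := by
  obtain ⟨e, he⟩ := e
  induction e using Sym2.inductionOn with
  | hf i j => exact ⟨i, j, by simpa using he, rfl⟩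

theorem sideLabels_eq (label : TetraEdge → LaxVector) (f : Fin 3 ↪ Fin 4) :
    sideLabels label f = {label (side f 0 1 (by decide)), label (side f 0 2 (by decide)),
      label (side f 1 2 (by decide))} := by
  have hc : ∀ i j h, side f i j h = side f j i h.symm := fun i j h => tetraEdge_comm _ _ _
  ext l
  constructor
  · rintro ⟨i, j, h, rfl⟩
    fin_cases i <;> fin_cases j <;>
      first
      | exact absurd rfl h
      | (simp; done)
      | exact Or.inl (congrArg label (hc _ _ _))
      | exact Or.inr (Or.inl (congrArg label (hc _ _ _)))
      | exact Or.inr (Or.inr (congrArg label (hc _ _ _)))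
  · rintro (rfl | rfl | rfl)
    exacts [⟨_, _, _, rfl⟩, ⟨_, _, _, rfl⟩, ⟨_, _, _, rfl⟩]

/-- The triangle of the tetrahedron with three given vertices. -/
def triangle {i j k : Fin 4} (hij : i ≠ j) (hik : i ≠ k) (hjk : j ≠ k) : Fin 3 ↪ Fin 4 where
  toFun := ![i, j, k]
  inj' a b h := by
    fin_cases a <;> fin_cases b <;> simp_all

namespace Ultrabasis

/-- The form of the label of an edge of a tetrahedron; `0` for a degenerate edge. -/
def edgeForm (T : Ultrabasis) (i j : Fin 4) : HermForm :=
  if h : i ≠ j then (T.label (tetraEdge i j h)).form else 0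

theorem edgeForm_eq (T : Ultrabasis) {i j : Fin 4} (h : i ≠ j) :
    T.edgeForm i j = (T.label (tetraEdge i j h)).form := dif_pos h

theorem edgeForm_comm (T : Ultrabasis) (i j : Fin 4) : T.edgeForm i j = T.edgeForm j i := by
  by_cases h : i = j
  · rw [h]
  · rw [T.edgeForm_eq h, T.edgeForm_eq (Ne.symm h), tetraEdge_comm]

theorem lorentz_edgeForm_self (T : Ultrabasis) (i j : Fin 4) :
    lorentz (T.edgeForm i j) (T.edgeForm i j) = 0 := by
  unfold edgeForm
  split_ifs
  · exact LaxVector.lorentz_form_self _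
  · simp

theorem lorentz_edgeForm_neg (T : Ultrabasis) {i j k l : Fin 4} (h : i ≠ j) (h' : k ≠ l)
    (hne : s(i, j) ≠ s(k, l)) : lorentz (T.edgeForm i j) (T.edgeForm k l) < 0 := by
  rw [T.edgeForm_eq h, T.edgeForm_eq h']
  exact LaxVector.lorentz_form_neg fun he => hne (congrArg Subtype.val (T.label_injective he))

theorem lorentz_edgeForm_adjacent (T : Ultrabasis) {i j k : Fin 4} (hij : i ≠ j) (hik : i ≠ k)
    (hjk : j ≠ k) : lorentz (T.edgeForm i j) (T.edgeForm i k) = -1 / 2 := by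
  rw [T.edgeForm_eq hij, T.edgeForm_eq hik]
  refine formBasis_iff.1 ((T.superbasis (triangle hij hik hjk)).2 ⟨0, 1, by decide, rfl⟩
    ⟨0, 2, by decide, rfl⟩ fun he => ?_)
  rcases Sym2.eq_iff.1 (congrArg Subtype.val (T.label_injective he)) with h | h
  exacts [hjk h.2, hik h.1]

/-- Two distinct edges of a tetrahedron that share a vertex are sides of a triangle. -/
theorem lorentz_edgeForm_of_share (T : Ultrabasis) {i j k l : Fin 4} (h : i ≠ j ∧ k ≠ l ∧
    s(i, j) ≠ s(k, l) ∧ (i = k ∨ i = l ∨ j = k ∨ j = l)) :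
    lorentz (T.edgeForm i j) (T.edgeForm k l) = -1 / 2 := by
  obtain ⟨hij, hkl, hne, rfl | rfl | rfl | rfl⟩ := h
  · exact T.lorentz_edgeForm_adjacent hij hkl fun h => hne (by rw [h])
  · rw [T.edgeForm_comm k i]
    exact T.lorentz_edgeForm_adjacent hij hkl.symm fun h => hne (by rw [h, Sym2.eq_swap])
  · rw [T.edgeForm_comm i j]
    exact T.lorentz_edgeForm_adjacent hij.symm hkl fun h => hne (by rw [h, Sym2.eq_swap])
  · rw [T.edgeForm_comm i j, T.edgeForm_comm k j]
    exact T.lorentz_edgeForm_adjacent hij.symm hkl.symm fun h => hne (by rw [h])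

/-- The Hermitian form of the circle at a vertex of an ultrabasis. Half the sum of the forms of two
tangent circles is the form of the tangency point, so the form of a circle is recovered from
the labels on a wall. -/
def form (T : Ultrabasis) (i : Fin 4) : HermForm :=
  T.edgeForm i (i + 1) + T.edgeForm i (i + 2) - T.edgeForm (i + 1) (i + 2)

/-- The forms of two vertices of an ultrabasis add up to twice the form of the label between
them. -/
theorem form_add_form_edgeForm (T : Ultrabasis) {i j : Fin 4} (h : i ≠ j) :
    T.form i + T.form j = (2 : ℝ) • T.edgeForm i j := by
  have c := T.edgeForm_comm
  -- Opposite edges of the tetrahedron are opposite vertices of the octahedron of edges.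
  have key := octahedron_sums (n := fun i : Fin 3 => T.edgeForm 0 i.succ)
    (m := fun i : Fin 3 => T.edgeForm (i + 1).succ (i + 2).succ)
    (fun i => T.lorentz_edgeForm_self _ _) (fun i => T.lorentz_edgeForm_self _ _)
    (fun i => T.lorentz_edgeForm_neg (by revert i; decide) (by revert i; decide)
      (by revert i; decide))
    (fun i j hij => T.lorentz_edgeForm_of_share (by revert i j; decide))
    (fun i j hij => T.lorentz_edgeForm_of_share (by revert i j; decide))
    (fun i j hij => T.lorentz_edgeForm_of_share (by revert i j; decide))
  have k₁ : T.edgeForm 0 1 + T.edgeForm 2 3 = T.edgeForm 0 2 + T.edgeForm 3 1 := key 0 1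
  have k₂ : T.edgeForm 0 1 + T.edgeForm 2 3 = T.edgeForm 0 3 + T.edgeForm 1 2 := key 0 2
  have f0 : T.form 0 = T.edgeForm 0 1 + T.edgeForm 0 2 - T.edgeForm 1 2 := rfl
  have f1 : T.form 1 = T.edgeForm 1 2 + T.edgeForm 3 1 - T.edgeForm 2 3 := by rw [c 3 1]; rfl
  have f2 : T.form 2 = T.edgeForm 2 3 + T.edgeForm 0 2 - T.edgeForm 0 3 := by
    rw [c 0 2, c 0 3]; rfl
  have f3 : T.form 3 = T.edgeForm 0 3 + T.edgeForm 3 1 - T.edgeForm 0 1 := by rw [c 0 3]; rfl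
  have main : ∀ i j : Fin 4, i < j → T.form i + T.form j = (2 : ℝ) • T.edgeForm i j := by
    intro i j hij
    fin_cases i <;> fin_cases j <;> first | exact absurd hij (by decide) | skip
    · show T.form 0 + T.form 1 = (2 : ℝ) • T.edgeForm 0 1
      rw [f0, f1]; linear_combination (norm := module) -k₁
    · show T.form 0 + T.form 2 = (2 : ℝ) • T.edgeForm 0 2
      rw [f0, f2]; linear_combination (norm := module) k₂
    · show T.form 0 + T.form 3 = (2 : ℝ) • T.edgeForm 0 3
      rw [f0, f3]; linear_combination (norm := module) k₂ - k₁
    · show T.form 1 + T.form 2 = (2 : ℝ) • T.edgeForm 1 2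
      rw [f1, f2]; linear_combination (norm := module) k₂ - k₁
    · show T.form 1 + T.form 3 = (2 : ℝ) • T.edgeForm 1 3
      rw [f1, f3, c 1 3]; linear_combination (norm := module) -k₂
    · show T.form 2 + T.form 3 = (2 : ℝ) • T.edgeForm 2 3
      rw [f2, f3]; linear_combination (norm := module) -k₁
  rcases lt_or_gt_of_ne h with h | h
  · exact main i j h
  · rw [add_comm, T.edgeForm_comm, main j i h]

theorem form_add_form (T : Ultrabasis) {i j : Fin 4} (h : i ≠ j) :
    T.form i + T.form j = (2 : ℝ) • (T.label (tetraEdge i j h)).form := by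
  rw [T.form_add_form_edgeForm h, T.edgeForm_eq]

theorem form_eq (T : Ultrabasis) {i j k : Fin 4} (hij : i ≠ j) (hik : i ≠ k) (hjk : j ≠ k) :
    T.form i = T.edgeForm i j + T.edgeForm i k - T.edgeForm j k := by
  have h₁ := T.form_add_form_edgeForm hij
  have h₂ := T.form_add_form_edgeForm hik
  have h₃ := T.form_add_form_edgeForm hjk
  linear_combination (norm := module) (1 / 2 : ℝ) • h₁ + (1 / 2 : ℝ) • h₂ - (1 / 2 : ℝ) • h₃

theorem lorentz_form_self (T : Ultrabasis) (i : Fin 4) : lorentz (T.form i) (T.form i) = 1 := by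
  obtain ⟨j, k, hij, hik, hjk⟩ : ∃ j k, i ≠ j ∧ i ≠ k ∧ j ≠ k :=
    (by decide : ∀ i : Fin 4, ∃ j k, i ≠ j ∧ i ≠ k ∧ j ≠ k) i
  have h₁ := T.lorentz_edgeForm_adjacent hij hik hjk
  have h₂ := T.lorentz_edgeForm_adjacent hij.symm hjk hik
  have h₃ := T.lorentz_edgeForm_adjacent hik.symm hjk.symm hij
  rw [T.edgeForm_comm j i] at h₂
  rw [T.edgeForm_comm k i, T.edgeForm_comm k j] at h₃
  rw [T.form_eq hij hik hjk]
  simp only [map_add, map_sub, LinearMap.add_apply, LinearMap.sub_apply, lorentz_edgeForm_self,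
    h₁, h₂, h₃, lorentz_comm (T.edgeForm i k) (T.edgeForm i j),
    lorentz_comm (T.edgeForm j k) (T.edgeForm i j), lorentz_comm (T.edgeForm j k) (T.edgeForm i k)]
  norm_num

theorem lorentz_form_of_ne (T : Ultrabasis) {i j : Fin 4} (h : i ≠ j) :
    lorentz (T.form i) (T.form j) = -1 := by
  have h₀ : lorentz (T.form i + T.form j) (T.form i + T.form j) = 0 := by
    rw [T.form_add_form_edgeForm h]
    simp [lorentz_edgeForm_self]
  simp only [map_add, LinearMap.add_apply, T.lorentz_form_self,
    lorentz_comm (T.form j) (T.form i)] at h₀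
  linarith

theorem lorentz_form (T : Ultrabasis) (i j : Fin 4) :
    lorentz (T.form i) (T.form j) = if i = j then 1 else -1 := by
  split_ifs with h
  · rw [h, T.lorentz_form_self]
  · exact T.lorentz_form_of_ne h

theorem form_injective (T : Ultrabasis) : Function.Injective T.form := by
  intro i j h
  by_contra hij
  have := T.lorentz_form_of_ne hij
  rw [h, T.lorentz_form_self] at this
  norm_num at this

theorem label_eq_of_form_eq {T T' : Ultrabasis} {i j i' j' : Fin 4} (h : i ≠ j) (h' : i' ≠ j')
    (hi : T.form i = T'.form i') (hj : T.form j = T'.form j') :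
    T.label (tetraEdge i j h) = T'.label (tetraEdge i' j' h') := by
  apply LaxVector.form_injective
  have := T.form_add_form h
  rw [hi, hj, T'.form_add_form h'] at this
  exact smul_right_injective _ (two_ne_zero' ℝ) this.symm

@[ext]
theorem ext_form {T T' : Ultrabasis} (h : ∀ i, T.form i = T'.form i) : T = T' := by
  have : T.label = T'.label := by
    ext1 e
    obtain ⟨i, j, hij, rfl⟩ := exists_eq_tetraEdge e
    exact label_eq_of_form_eq hij hij (h i) (h j)
  cases T
  cases T'
  congr

/-- Quadruples of forms with inner products `-1`, all of whose sums are twice the form of a lax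
vector, come from ultrabases. -/
theorem exists_form_eq {h : Fin 4 → HermForm}
    (hl : ∀ i j, lorentz (h i) (h j) = if i = j then 1 else -1)
    (hs : ∀ i j, i ≠ j → ∃ l : LaxVector, h i + h j = (2 : ℝ) • l.form) :
    ∃ T : Ultrabasis, T.form = h := by
  have hs' : ∀ e : TetraEdge, ∃ l : LaxVector, ∀ i j hij, e = tetraEdge i j hij →
      h i + h j = (2 : ℝ) • l.form := by
    intro e
    obtain ⟨i, j, hij, rfl⟩ := exists_eq_tetraEdge e
    obtain ⟨l, hl⟩ := hs i j hij
    refine ⟨l, fun a b hab he => ?_⟩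
    rcases Sym2.eq_iff.1 (congrArg Subtype.val he) with ⟨rfl, rfl⟩ | ⟨rfl, rfl⟩
    · exact hl
    · rw [add_comm, hl]
  choose label hlabel using hs'
  have hL : ∀ i j hij, (label (tetraEdge i j hij)).form = (1 / 2 : ℝ) • (h i + h j) := by
    intro i j hij
    rw [hlabel _ i j hij rfl, smul_smul]
    norm_num
  have hadj : ∀ i j k (hij : i ≠ j) (hik : i ≠ k), j ≠ k →
      FormBasis (label (tetraEdge i j hij)) (label (tetraEdge i k hik)) := by
    intro i j k hij hik hjk
    rw [formBasis_iff, hL, hL]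
    simp only [LinearMap.map_smul, LinearMap.smul_apply, map_add, LinearMap.add_apply, hl, hjk, hik,
      hij.symm, smul_eq_mul, if_true, if_false]
    norm_num
  have hinj : Function.Injective label := by
    have key : ∀ i j k l (hij : i ≠ j) (hkl : k ≠ l), label (tetraEdge i j hij) =
        label (tetraEdge k l hkl) → i = k ∨ i = l := by
      intro i j k l hij hkl he
      have h₁ := hlabel _ i j hij rfl
      rw [he, ← hlabel _ k l hkl rfl] at h₁
      have h₂ := congrArg (lorentz (h i)) h₁
      rw [map_add, map_add, hl, hl, hl, hl, if_pos rfl, if_neg hij] at h₂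
      by_contra! hne
      rw [if_neg hne.1, if_neg hne.2] at h₂
      norm_num at h₂
    intro e e' he
    obtain ⟨i, j, hij, rfl⟩ := exists_eq_tetraEdge e
    obtain ⟨k, l, hkl, rfl⟩ := exists_eq_tetraEdge e'
    have h₁ := key _ _ _ _ hij hkl he
    have h₂ := key j i k l hij.symm hkl (by rw [← he, tetraEdge_comm])
    refine Subtype.ext (Sym2.eq_iff.2 ?_)
    rcases h₁ with rfl | rfl <;> rcases h₂ with rfl | rfl
    exacts [absurd rfl hij, Or.inl ⟨rfl, rfl⟩, Or.inr ⟨rfl, rfl⟩, absurd rfl hij]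
  refine ⟨⟨label, hinj, fun f => ?_⟩, ?_⟩
  · rw [sideLabels_eq]
    have hf : ∀ i j : Fin 3, i ≠ j → f i ≠ f j := fun i j hij => f.injective.ne hij
    have e₁ : FormBasis (label (side f 0 1 (by decide))) (label (side f 0 2 (by decide))) :=
      hadj _ _ _ _ _ (hf _ _ (by decide))
    have e₂ : FormBasis (label (side f 0 1 (by decide))) (label (side f 1 2 (by decide))) := by
      have := hadj (f 1) (f 0) (f 2) (hf _ _ (by decide)) (hf _ _ (by decide)) (hf _ _ (by decide))
      rwa [tetraEdge_comm (f 1) (f 0)] at this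
    have e₃ : FormBasis (label (side f 0 2 (by decide))) (label (side f 1 2 (by decide))) := by
      have := hadj (f 2) (f 0) (f 1) (hf _ _ (by decide)) (hf _ _ (by decide)) (hf _ _ (by decide))
      rwa [tetraEdge_comm (f 2) (f 0), tetraEdge_comm (f 2) (f 1)] at this
    have hsymm : ∀ {l m}, FormBasis l m → FormBasis m l := fun h => by
      rw [formBasis_iff] at h ⊢; rw [lorentz_comm, h]
    have hne : ∀ {l m}, FormBasis l m → l ≠ m := by
      rintro l _ h rfl
      rw [formBasis_iff, LaxVector.lorentz_form_self] at h
      norm_num at h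
    refine ⟨ncard_eq_three.2 ⟨_, _, _, hne e₁, hne e₂, hne e₃, rfl⟩, ?_⟩
    rintro _ (rfl | rfl | rfl) _ (rfl | rfl | rfl) h'
    exacts [absurd rfl h', e₁, e₂, hsymm e₁, absurd rfl h', e₃, hsymm e₂, hsymm e₃, absurd rfl h']
  · ext1 i
    obtain ⟨j, k, hij, hik, hjk⟩ : ∃ j k, i ≠ j ∧ i ≠ k ∧ j ≠ k :=
      (by decide : ∀ i : Fin 4, ∃ j k, i ≠ j ∧ i ≠ k ∧ j ≠ k) i
    rw [form_eq _ hij hik hjk, edgeForm_eq _ hij, edgeForm_eq _ hik, edgeForm_eq _ hjk]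
    simp only [hL]
    module

theorem exists_form_comp (T : Ultrabasis) (σ : Equiv.Perm (Fin 4)) :
    ∃ T' : Ultrabasis, T'.form = T.form ∘ σ :=
  exists_form_eq (fun i j => by simp [T.lorentz_form])
    (fun i j h => ⟨_, T.form_add_form (σ.injective.ne h)⟩)

end Ultrabasis

theorem sameWall_iff {T T' : Ultrabasis} {f g : Fin 3 ↪ Fin 4} :
    SameWall T T' f g ↔ ∀ k, T.form (f k) = T'.form (g k) := by
  constructor
  · intro h k
    obtain ⟨a, b, hka, hkb, hab⟩ : ∃ a b, k ≠ a ∧ k ≠ b ∧ a ≠ b :=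
      (by decide : ∀ k : Fin 3, ∃ a b, k ≠ a ∧ k ≠ b ∧ a ≠ b) k
    have key : ∀ i j, i ≠ j → T.edgeForm (f i) (f j) = T'.edgeForm (g i) (g j) := by
      intro i j hij
      rw [T.edgeForm_eq (f.injective.ne hij), T'.edgeForm_eq (g.injective.ne hij)]
      exact congrArg LaxVector.form (h i j hij)
    rw [T.form_eq (f.injective.ne hka) (f.injective.ne hkb) (f.injective.ne hab),
      T'.form_eq (g.injective.ne hka) (g.injective.ne hkb) (g.injective.ne hab),
      key _ _ hka, key _ _ hkb, key _ _ hab]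
  · intro h i j hij
    exact Ultrabasis.label_eq_of_form_eq _ _ (h i) (h j)

/-- The Hermitian form of a vertex of the kingdom. -/
def vertexForm : kingdom.Vert → HermForm :=
  Quot.lift (fun x : Ultrabasis × Fin 4 => x.1.form x.2) (by
    rintro _ _ ⟨T, T', f, g, h, k⟩
    exact sameWall_iff.1 h k)

@[simp]
theorem vertexForm_vertex (T : Ultrabasis) (i : Fin 4) : vertexForm (T.vertex i) = T.form i := rfl

theorem exists_vertex (p : kingdom.Vert) : ∃ (T : Ultrabasis) (i : Fin 4), p = T.vertex i := by
  obtain ⟨⟨T, i⟩, rfl⟩ := Quot.exists_rep p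
  exact ⟨T, i, rfl⟩

theorem lorentz_vertexForm_self (p : kingdom.Vert) :
    lorentz (vertexForm p) (vertexForm p) = 1 := by
  obtain ⟨T, i, rfl⟩ := exists_vertex p
  exact T.lorentz_form_self i

/-- The edge of the kingdom given by two vertices of a tetrahedron. -/
def Ultrabasis.edge (T : Ultrabasis) (i j : Fin 4) (h : i ≠ j) : kingdom.Edge :=
  Quot.mk EdgeGlue (T, tetraEdge i j h)

theorem exists_edge (e : kingdom.Edge) :
    ∃ (T : Ultrabasis) (i j : Fin 4) (h : i ≠ j), e = T.edge i j h := by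
  obtain ⟨⟨T, e⟩, rfl⟩ := Quot.exists_rep e
  obtain ⟨i, j, h, rfl⟩ := exists_eq_tetraEdge e
  exact ⟨T, i, j, h, rfl⟩

theorem ends_edge (T : Ultrabasis) (i j : Fin 4) (h : i ≠ j) :
    kingdom.ends (T.edge i j h) = s(T.vertex i, T.vertex j) := rfl

theorem label_edge (T : Ultrabasis) (i j : Fin 4) (h : i ≠ j) :
    kingdom.label (T.edge i j h) = T.label (tetraEdge i j h) := rfl

theorem edge_comm (T : Ultrabasis) (i j : Fin 4) (h : i ≠ j) :
    T.edge i j h = T.edge j i h.symm := by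
  rw [Ultrabasis.edge, Ultrabasis.edge, tetraEdge_comm]

theorem vertex_eq_of_wall {T T' : Ultrabasis} {f g : Fin 3 ↪ Fin 4}
    (h : ∀ k, T.form (f k) = T'.form (g k)) (k : Fin 3) : T.vertex (f k) = T'.vertex (g k) :=
  Quot.sound (VertexGlue.mk T T' f g (sameWall_iff.2 h) k)

theorem edge_eq_of_wall {T T' : Ultrabasis} {f g : Fin 3 ↪ Fin 4}
    (h : ∀ k, T.form (f k) = T'.form (g k)) (i j : Fin 3) (hij : i ≠ j) :
    T.edge (f i) (f j) (f.injective.ne hij) = T'.edge (g i) (g j) (g.injective.ne hij) :=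
  Quot.sound (EdgeGlue.mk T T' f g (sameWall_iff.2 h) i j hij)

theorem exists_triangle_pair {i j : Fin 4} (h : i ≠ j) :
    ∃ (f : Fin 3 ↪ Fin 4), f 0 = i ∧ f 1 = j := by
  obtain ⟨k, hik, hjk⟩ : ∃ k, i ≠ k ∧ j ≠ k :=
    (by decide : ∀ i j : Fin 4, ∃ k, i ≠ k ∧ j ≠ k) i j
  exact ⟨triangle h hik hjk, rfl, rfl⟩

theorem vertex_eq_of_renumbering {T T' : Ultrabasis} {σ : Equiv.Perm (Fin 4)}
    (h : T'.form = T.form ∘ σ) (i : Fin 4) : T'.vertex i = T.vertex (σ i) := by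
  obtain ⟨f, k, rfl⟩ := exists_triangle i
  exact vertex_eq_of_wall (g := f.trans σ.toEmbedding) (fun a => by rw [h]; rfl) k

theorem edge_eq_of_renumbering {T T' : Ultrabasis} {σ : Equiv.Perm (Fin 4)}
    (h : T'.form = T.form ∘ σ) (i j : Fin 4) (hij : i ≠ j) :
    T'.edge i j hij = T.edge (σ i) (σ j) (σ.injective.ne hij) := by
  obtain ⟨f, rfl, rfl⟩ := exists_triangle_pair hij
  exact edge_eq_of_wall (g := f.trans σ.toEmbedding) (fun a => by rw [h]; rfl) 0 1 (by decide)

/-! ### The standard chambers and their images -/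

/-- The form of the real line, with the lower half-plane as interior. -/
def realForm : HermForm := (0, 0, -I)

/-- The forms of the standard Descartes quadruples: the lines `Im z = 0` and `Im z = 1` together
with the circles of diameter `1` centred at `i / 2` and `η + i / 2`, where `η = ± 1`. -/
def stdQuad (η : ℤˣ) : Fin 4 → HermForm :=
  ![realForm, (0, 2, I), (2, 0, I), (2, 2, 2 * ((η : ℤ) : ℂ) + I)]

theorem stdQuad_eq_of_ne (η : ℤˣ) {i : Fin 4} (h : i ≠ 3) : stdQuad η i = stdQuad 1 i := by
  obtain rfl | rfl | rfl : i = 0 ∨ i = 1 ∨ i = 2 := by omega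
  all_goals simp [stdQuad]

theorem lorentz_stdQuad (η : ℤˣ) (i j : Fin 4) :
    lorentz (stdQuad η i) (stdQuad η j) = if i = j then 1 else -1 := by
  rcases Int.units_eq_one_or η with rfl | rfl <;> fin_cases i <;> fin_cases j <;>
    simp [stdQuad, realForm, lorentz_apply] <;> norm_num

theorem stdQuad_add (η : ℤˣ) {i j : Fin 4} (h : i ≠ j) :
    ∃ l : LaxVector, stdQuad η i + stdQuad η j = (2 : ℝ) • l.form := by
  wlog hij : i < j generalizing i j
  · obtain ⟨l, hl⟩ := this h.symm (lt_of_le_of_ne (not_lt.1 hij) h.symm)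
    exact ⟨l, by rw [add_comm, hl]⟩
  have key : ∀ v : PrimitiveVector,
      stdQuad η i + stdQuad η j = (2 : ℝ) • null (complexVec v.1) →
      ∃ l : LaxVector, stdQuad η i + stdQuad η j = (2 : ℝ) • l.form := fun v hv => ⟨v.lax, hv⟩
  have hcop : ∀ x : GaussianInt, IsCoprime (![x, 1] 0) (![x, 1] 1) := fun x => ⟨0, 1, by simp⟩
  have hcop' : ∀ x : GaussianInt, IsCoprime (![1, x] 0) (![1, x] 1) := fun x => ⟨1, 0, by simp⟩
  have hI : GaussianInt.toComplex ⟨0, 1⟩ = I := by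
    simp [GaussianInt.toComplex_def₂, Complex.ext_iff]
  fin_cases i <;> fin_cases j <;> first | exact absurd hij (by decide) | skip
  · refine key ⟨![1, 0], hcop' 0⟩ ?_
    ext <;> simp [stdQuad, realForm, null, complexVec]
  · refine key ⟨![0, 1], hcop 0⟩ ?_
    ext <;> simp [stdQuad, realForm, null, complexVec]
  · refine key ⟨![((η : ℤ) : GaussianInt), 1], hcop _⟩ ?_
    rcases Int.units_eq_one_or η with rfl | rfl <;>
      ext <;> simp [stdQuad, realForm, null, complexVec]
  · refine key ⟨![⟨0, 1⟩, 1], hcop _⟩ ?_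
    ext <;> simp [stdQuad, null, complexVec, hI]
    norm_num
  · refine key ⟨![((η : ℤ) : GaussianInt) + ⟨0, 1⟩, 1], hcop _⟩ ?_
    rcases Int.units_eq_one_or η with rfl | rfl <;>
      ext <;> simp [stdQuad, null, complexVec, hI, normSq_apply] <;> norm_num
  · refine key ⟨![1, ((η : ℤ) : GaussianInt) - ⟨0, 1⟩], hcop' _⟩ ?_
    rcases Int.units_eq_one_or η with rfl | rfl <;>
      ext <;> simp [stdQuad, null, complexVec, hI, normSq_apply] <;> norm_num

theorem exists_form_eq_act_stdQuad (M : GL (Fin 2) GaussianInt) (η : ℤˣ) :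
    ∃ T : Ultrabasis, T.form = fun i => act M (stdQuad η i) :=
  Ultrabasis.exists_form_eq (fun i j => by rw [lorentz_act, lorentz_stdQuad]) fun i j h => by
    obtain ⟨l, hl⟩ := stdQuad_add η h
    obtain ⟨m, hm⟩ := l.exists_form_eq_act M
    exact ⟨m, by rw [← map_add, hl, LinearMap.map_smul, hm]⟩

/-- The image of a standard chamber under an element of `GL₂(ℤ[i])`. -/
def stdUltrabasis (M : GL (Fin 2) GaussianInt) (η : ℤˣ) : Ultrabasis :=
  (exists_form_eq_act_stdQuad M η).choose

theorem form_stdUltrabasis (M : GL (Fin 2) GaussianInt) (η : ℤˣ) (i : Fin 4) :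
    (stdUltrabasis M η).form i = act M (stdQuad η i) :=
  congrFun (exists_form_eq_act_stdQuad M η).choose_spec i

/-- Exactly two forms complete the standard triple to a Descartes quadruple. -/
theorem exists_eq_stdQuad {H : HermForm} (h : lorentz H H = 1)
    (h₀ : lorentz (stdQuad 1 0) H = -1) (h₁ : lorentz (stdQuad 1 1) H = -1)
    (h₂ : lorentz (stdQuad 1 2) H = -1) : ∃ η, H = stdQuad η 3 := by
  obtain ⟨a, b, x, y⟩ := H
  simp [stdQuad, realForm, lorentz_apply] at h h₀ h₁ h₂
  obtain rfl : y = 1 := by linarith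
  obtain rfl : a = 2 := by linarith
  obtain rfl : b = 2 := by linarith
  have hx : (x - 2) * (x + 2) = 0 := by linarith
  rcases mul_eq_zero.1 hx with hx | hx
  · exact ⟨1, by ext <;> simp [stdQuad]; linarith⟩
  · exact ⟨-1, by ext <;> simp [stdQuad]; linarith⟩

/-- Triples of forms with inner products `-1` whose sums are given by lax vectors are images of the
standard triple. -/
theorem exists_act_eq_of_triple {A B C : HermForm} {l₁ l₂ l₃ : LaxVector}
    (hA : lorentz A A = 1) (hB : lorentz B B = 1) (hC : lorentz C C = 1)
    (hAB : lorentz A B = -1) (hAC : lorentz A C = -1) (hBC : lorentz B C = -1)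
    (h₁ : A + B = (2 : ℝ) • l₁.form) (h₂ : A + C = (2 : ℝ) • l₂.form)
    (h₃ : B + C = (2 : ℝ) • l₃.form) :
    ∃ M, A = act M (stdQuad 1 0) ∧ B = act M (stdQuad 1 1) ∧ C = act M (stdQuad 1 2) := by
  have e₁ : l₁.form = (1 / 2 : ℝ) • (A + B) := by rw [h₁]; module
  have e₂ : l₂.form = (1 / 2 : ℝ) • (A + C) := by rw [h₂]; module
  have e₃ : l₃.form = (1 / 2 : ℝ) • (B + C) := by rw [h₃]; module
  have hBA := (lorentz_comm B A).trans hAB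
  obtain ⟨M, m₁, m₂, m₃⟩ := exists_act_of_superbasis (l₁ := l₁) (l₂ := l₂) (l₃ := l₃)
    (by rw [e₁, e₂]; simp [hA, hAC, hBA, hBC]; norm_num)
    (by rw [e₁, e₃]; simp [hB, hAC, hAB, hBC]; norm_num)
    (by rw [e₂, e₃]; simp [hC, hAC, hAB, (lorentz_comm C B).trans hBC]; norm_num)
  refine ⟨M, ?_, ?_, ?_⟩
  · have : A = l₁.form + l₂.form - l₃.form := by rw [e₁, e₂, e₃]; module
    rw [this, m₁, m₂, m₃, ← map_add, ← map_sub]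
    congr 1
    ext <;> simp [stdQuad, realForm, null]
  · have : B = l₁.form + l₃.form - l₂.form := by rw [e₁, e₂, e₃]; module
    rw [this, m₁, m₂, m₃, ← map_add, ← map_sub]
    congr 1
    ext <;> simp [stdQuad, null]; norm_num
  · have : C = l₂.form + l₃.form - l₁.form := by rw [e₁, e₂, e₃]; module
    rw [this, m₁, m₂, m₃, ← map_add, ← map_sub]
    congr 1
    ext <;> simp [stdQuad, null]; norm_num

/-- Every ultrabasis is the image of a standard one. -/
theorem Ultrabasis.exists_eq_stdUltrabasis (T : Ultrabasis) : ∃ M η, T = stdUltrabasis M η := by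
  have hn := fun {i j : Fin 4} (h : i ≠ j) => T.lorentz_form_of_ne h
  obtain ⟨M, h₀, h₁, h₂⟩ := exists_act_eq_of_triple (T.lorentz_form_self 0)
    (T.lorentz_form_self 1) (T.lorentz_form_self 2) (hn (by decide)) (hn (by decide))
    (hn (by decide)) (T.form_add_form (i := 0) (j := 1) (by decide))
    (T.form_add_form (i := 0) (j := 2) (by decide))
    (T.form_add_form (i := 1) (j := 2) (by decide))
  have key : ∀ i, T.form i = act M (stdQuad 1 i) → i ≠ 3 →
      lorentz (stdQuad 1 i) (act M⁻¹ (T.form 3)) = -1 := fun i hi h => by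
    rw [← lorentz_act M, act_act_inv, ← hi, hn h]
  obtain ⟨η, hη⟩ := exists_eq_stdQuad (H := act M⁻¹ (T.form 3))
    (by rw [lorentz_act, T.lorentz_form_self]) (key 0 h₀ (by decide)) (key 1 h₁ (by decide))
    (key 2 h₂ (by decide))
  refine ⟨M, η, Ultrabasis.ext_form fun i => ?_⟩
  rw [form_stdUltrabasis]
  by_cases hi : i = 3
  · rw [hi, ← hη, act_act_inv]
  · rw [stdQuad_eq_of_ne η hi]
    obtain rfl | rfl | rfl : i = 0 ∨ i = 1 ∨ i = 2 := by omega
    exacts [h₀, h₁, h₂]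

/-! ### The stabilizer of the real line -/

theorem eval_act (M : GL (Fin 2) GaussianInt) (H : HermForm) (v : Fin 2 → ℂ) :
    (act M H).eval ((complexMat M).mulVec v) = H.eval v := by
  rw [act, eval_pull, Matrix.mulVec_mulVec, ← complexMat_mul, inv_mul_cancel, complexMat_one,
    Matrix.one_mulVec]

theorem act_eq_iff_pull {M : GL (Fin 2) GaussianInt} {H K : HermForm} :
    act M H = K ↔ pull (complexMat M) K = H := by
  have : pull (complexMat M) K = act M⁻¹ K := by rw [act, inv_inv]
  rw [this]
  constructor
  · rintro rfl; rw [act_inv_act]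
  · rintro rfl; rw [act_act_inv]

/-- Matrices that differ by a scalar of norm `1` act in the same way. -/
theorem act_eq_act_of_smul {M N : GL (Fin 2) GaussianInt} {c : ℂ} (hc : normSq c = 1)
    (h : complexMat M = c • complexMat N) (H : HermForm) : act M H = act N H := by
  rw [act_eq_iff_pull]
  refine ext_eval fun v => ?_
  rw [eval_pull, h, Matrix.smul_mulVec, eval_smul, hc, one_mul, eval_act]

/-- The embedding of the modular group. -/
def ofModular : Matrix.SpecialLinearGroup (Fin 2) ℤ →* GL (Fin 2) GaussianInt :=
  Matrix.SpecialLinearGroup.toGL.comp (Matrix.SpecialLinearGroup.map (Int.castRingHom GaussianInt))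

theorem complexMat_ofModular (γ : Matrix.SpecialLinearGroup (Fin 2) ℤ) (i j : Fin 2) :
    complexMat (ofModular γ) i j = (γ i j : ℂ) := by
  simp [complexMat_apply, ofModular]

theorem gaussian_unit_cases {z : GaussianInt} (h : z.norm = 1) :
    z = 1 ∨ z = -1 ∨ z = ⟨0, 1⟩ ∨ z = ⟨0, -1⟩ := by
  obtain ⟨x, y⟩ := z
  have h' : x * x + y * y = 1 := by simpa [Zsqrtd.norm] using h
  have hx : x ≤ 1 := by nlinarith
  have hx' : -1 ≤ x := by nlinarith
  have hy : y ≤ 1 := by nlinarith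
  have hy' : -1 ≤ y := by nlinarith
  interval_cases x <;> interval_cases y <;> simp_all [Zsqrtd.ext_iff]

/-- The stabilizer in `GL₂(ℤ[i])` of the oriented real line is the modular group, up to scalars.
If `D` is the determinant of a matrix in the stabilizer, each entry satisfies `x = D x̄`; for
`D = ± i` all entries would be divisible by `1 + i`. -/
theorem exists_modular_of_act_realForm {W : GL (Fin 2) GaussianInt}
    (h : act W realForm = realForm) :
    ∃ (γ : Matrix.SpecialLinearGroup (Fin 2) ℤ) (c : ℂ), normSq c = 1 ∧
      complexMat W = c • complexMat (ofModular γ) := by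
  rw [act_eq_iff_pull] at h
  obtain ⟨a, ha⟩ : ∃ a, a = W.1 0 0 := ⟨_, rfl⟩
  obtain ⟨b, hb⟩ : ∃ b, b = W.1 0 1 := ⟨_, rfl⟩
  obtain ⟨c, hc⟩ : ∃ c, c = W.1 1 0 := ⟨_, rfl⟩
  obtain ⟨d, hd⟩ : ∃ d, d = W.1 1 1 := ⟨_, rfl⟩
  have hac := congrArg Prod.fst h
  have hbd := congrArg (fun H : HermForm => H.2.1) h
  have hre := congrArg (fun H : HermForm => H.2.2.re) h
  have him := congrArg (fun H : HermForm => H.2.2.im) h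
  simp [pull, eval, realForm, complexMat_apply, ← ha, ← hb, ← hc, ← hd, Matrix.col,
    ← GaussianInt.intCast_re, ← GaussianInt.intCast_im] at hac hbd hre him
  norm_cast at hac hbd hre him
  have h_one : Int.negSucc 0 = -1 := rfl
  rw [h_one] at him
  have e₁ : a * star d - c * star b = 1 := by
    ext
    · simp; linarith only [him]
    · simp; linarith only [hre]
  have e₂ : a * star c = star a * c := by
    ext
    · simp
    · simp; linarith
  have e₃ : b * star d = star b * d := by
    ext
    · simp
    · simp; linarith
  have e₁' : star a * d - star c * b = 1 := by
    have := congrArg star e₁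
    simp only [star_sub, star_mul, star_star, star_one] at this
    rw [← this]; ring
  obtain ⟨D, hD⟩ : ∃ D, D = a * d - b * c := ⟨_, rfl⟩
  have h₁ : a = D * star a := by rw [hD]; linear_combination -a * e₁' - b * e₂
  have h₂ : b = D * star b := by rw [hD]; linear_combination -b * e₁ + a * e₃
  have h₃ : c = D * star c := by rw [hD]; linear_combination -c * e₁' - d * e₂
  have h₄ : d = D * star d := by rw [hD]; linear_combination -d * e₁ + c * e₃
  have hDn : D.norm = 1 := by
    rw [norm_eq_one_iff_isUnit, hD, ha, hb, hc, hd, ← Matrix.det_fin_two]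
    exact (Matrix.isUnit_iff_isUnit_det _).1 W.isUnit
  clear e₁ e₂ e₃ e₁' hac hbd hre him
  simp only [Zsqrtd.ext_iff] at h₁ h₂ h₃ h₄ hD
  -- The entries of `W` are `k` times the entries of an integral matrix of determinant `1`.
  suffices ∃ (p q r s : ℤ) (k : GaussianInt), k.norm = 1 ∧ p * s - q * r = 1 ∧
      a = k * p ∧ b = k * q ∧ c = k * r ∧ d = k * s by
    obtain ⟨p, q, r, s, k, hk, hdet, ha', hb', hc', hd'⟩ := this
    obtain ⟨γ, hγ⟩ : ∃ γ : Matrix.SpecialLinearGroup (Fin 2) ℤ,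
        ∀ i j, γ i j = !![p, q; r, s] i j :=
      ⟨⟨!![p, q; r, s], by simpa using hdet⟩, fun _ _ => rfl⟩
    refine ⟨γ, GaussianInt.toComplex k, ?_, ?_⟩
    · rw [← GaussianInt.intCast_real_norm, hk, Int.cast_one]
    · ext i j
      rw [Matrix.smul_apply, complexMat_ofModular, hγ]
      fin_cases i <;> fin_cases j <;>
        simp [complexMat_apply, ← ha, ← hb, ← hc, ← hd, ha', hb', hc', hd']
  obtain ⟨a₁, a₂⟩ := a
  obtain ⟨b₁, b₂⟩ := b
  obtain ⟨c₁, c₂⟩ := c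
  obtain ⟨d₁, d₂⟩ := d
  rcases gaussian_unit_cases hDn with rfl | rfl | rfl | rfl <;> simp at h₁ h₂ h₃ h₄ hD
  · obtain rfl : a₂ = 0 := by omega
    obtain rfl : b₂ = 0 := by omega
    obtain rfl : c₂ = 0 := by omega
    obtain rfl : d₂ = 0 := by omega
    exact ⟨a₁, b₁, c₁, d₁, 1, by simp, by linarith, by simp [Zsqrtd.ext_iff]⟩
  · obtain rfl : a₁ = 0 := by omega
    obtain rfl : b₁ = 0 := by omega
    obtain rfl : c₁ = 0 := by omega
    obtain rfl : d₁ = 0 := by omega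
    exact ⟨a₂, b₂, c₂, d₂, ⟨0, 1⟩, by decide, by linarith, by simp [Zsqrtd.ext_iff]⟩
  · obtain ⟨rfl, -⟩ := h₁
    obtain ⟨rfl, -⟩ := h₂
    obtain ⟨rfl, -⟩ := h₃
    obtain ⟨rfl, -⟩ := h₄
    have : 2 * (a₁ * d₁ - b₁ * c₁) = 1 := by linarith
    omega
  · obtain ⟨rfl, -⟩ := h₁
    obtain ⟨rfl, -⟩ := h₂
    obtain ⟨rfl, -⟩ := h₃
    obtain ⟨rfl, -⟩ := h₄
    have : 2 * (a₂ * d₂ - b₂ * c₂) = 1 := by linarith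
    omega

/-- The stabilizer in `GL₂(ℤ[i])` of the line `Im z = 0` and the line `Im z = 1` consists of the
integral translations, up to scalars. -/
theorem exists_translation_of_act {W : GL (Fin 2) GaussianInt} (h₀ : act W realForm = realForm)
    (h₁ : act W (stdQuad 1 1) = stdQuad 1 1) :
    ∃ (n : ℤ) (c : ℂ), normSq c = 1 ∧
      complexMat W = c • complexMat (ofModular (ModularGroup.T ^ n)) := by
  obtain ⟨γ, c, hc, hW⟩ := exists_modular_of_act_realForm h₀
  have hsum : act W (null ![1, 0]) = null ![1, 0] := by
    have : null ![1, 0] = (1 / 2 : ℝ) • (realForm + stdQuad 1 1) := by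
      ext <;> simp [null, realForm, stdQuad]
    rw [this, LinearMap.map_smul, map_add, h₀, h₁]
  rw [act_eq_act_of_smul hc hW, act_null] at hsum
  have hr : γ 1 0 = 0 := by
    have := congrArg Prod.fst hsum
    simpa [null, Matrix.mulVec, dotProduct, complexMat_ofModular] using this
  have hdet : γ 0 0 * γ 1 1 = 1 := by
    have := γ.det_coe
    rw [Matrix.det_fin_two] at this
    rw [hr] at this
    linarith
  have hT : ∀ n i j, complexMat (ofModular (ModularGroup.T ^ n)) i j =
      ((!![1, n; 0, 1] i j : ℤ) : ℂ) := fun n i j => by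
    rw [complexMat_ofModular, ModularGroup.coe_T_zpow]
  rcases Int.mul_eq_one_iff_eq_one_or_neg_one.1 hdet with ⟨h, h'⟩ | ⟨h, h'⟩
  · refine ⟨γ 0 1, c, hc, ?_⟩
    ext i j
    rw [hW, Matrix.smul_apply, Matrix.smul_apply, complexMat_ofModular, hT]
    fin_cases i <;> fin_cases j <;> simp [h, h', hr]
  · refine ⟨-γ 0 1, -c, by rwa [normSq_neg], ?_⟩
    ext i j
    rw [hW, Matrix.smul_apply, Matrix.smul_apply, complexMat_ofModular, hT]
    fin_cases i <;> fin_cases j <;> simp [h, h', hr]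

/-! ### Vertices and edges of the kingdom are determined by their forms -/

theorem complexMat_ofModular_T : complexMat (ofModular ModularGroup.T) = !![1, 1; 0, 1] := by
  ext i j
  rw [complexMat_ofModular]
  fin_cases i <;> fin_cases j <;> simp [ModularGroup.T]

theorem complexMat_ofModular_S : complexMat (ofModular ModularGroup.S) = !![0, -1; 1, 0] := by
  ext i j
  rw [complexMat_ofModular]
  fin_cases i <;> fin_cases j <;> simp [ModularGroup.S]

theorem act_ofModular_T (i : Fin 4) (h : i = 0 ∨ i = 1) :
    act (ofModular ModularGroup.T) (stdQuad 1 i) = stdQuad 1 i := by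
  rw [act_eq_iff_pull]
  rcases h with rfl | rfl <;>
    ext <;> simp [pull, eval, stdQuad, realForm, complexMat_ofModular_T, Matrix.col]

theorem act_ofModular_T_two : act (ofModular ModularGroup.T) (stdQuad 1 2) = stdQuad 1 3 := by
  rw [act_eq_iff_pull]
  ext <;> simp [pull, eval, stdQuad, complexMat_ofModular_T, Matrix.col]
  norm_num

theorem act_ofModular_S_zero :
    act (ofModular ModularGroup.S) (stdQuad 1 0) = stdQuad 1 0 := by
  rw [act_eq_iff_pull]
  ext <;> simp [pull, eval, stdQuad, realForm, complexMat_ofModular_S, Matrix.col]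

theorem act_ofModular_S_one : act (ofModular ModularGroup.S) (stdQuad 1 1) = stdQuad 1 2 := by
  rw [act_eq_iff_pull]
  ext <;> simp [pull, eval, stdQuad, complexMat_ofModular_S, Matrix.col]

theorem act_ofModular_S_two : act (ofModular ModularGroup.S) (stdQuad 1 2) = stdQuad 1 1 := by
  rw [act_eq_iff_pull]
  ext <;> simp [pull, eval, stdQuad, complexMat_ofModular_S, Matrix.col]

/-- The triangle `012` of the tetrahedron. -/
def triangle₀₁₂ : Fin 3 ↪ Fin 4 :=
  triangle (i := 0) (j := 1) (k := 2) (by decide) (by decide) (by decide)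

/-- The two standard tetrahedra of opposite chirality share a wall. -/
theorem stdUltrabasis_wall_neg (M : GL (Fin 2) GaussianInt) (k : Fin 3) :
    (stdUltrabasis M (-1)).form (triangle₀₁₂ k) = (stdUltrabasis M 1).form (triangle₀₁₂ k) := by
  rw [form_stdUltrabasis, form_stdUltrabasis, stdQuad_eq_of_ne]
  revert k
  decide

theorem stdUltrabasis_wall_T (M : GL (Fin 2) GaussianInt) (k : Fin 3) :
    (stdUltrabasis (M * ofModular ModularGroup.T) 1).form (triangle₀₁₂ k) =
      (stdUltrabasis M 1).form (triangle (i := 0) (j := 1) (k := 3)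
        (by decide) (by decide) (by decide) k) := by
  rw [form_stdUltrabasis, form_stdUltrabasis, act_mul]
  fin_cases k
  · exact congrArg (act M) (act_ofModular_T 0 (Or.inl rfl))
  · exact congrArg (act M) (act_ofModular_T 1 (Or.inr rfl))
  · exact congrArg (act M) act_ofModular_T_two

theorem stdUltrabasis_wall_S (M : GL (Fin 2) GaussianInt) (k : Fin 3) :
    (stdUltrabasis (M * ofModular ModularGroup.S) 1).form (triangle₀₁₂ k) =
      (stdUltrabasis M 1).form (triangle (i := 0) (j := 2) (k := 1)
        (by decide) (by decide) (by decide) k) := by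
  rw [form_stdUltrabasis, form_stdUltrabasis, act_mul]
  fin_cases k
  · exact congrArg (act M) act_ofModular_S_zero
  · exact congrArg (act M) act_ofModular_S_one
  · exact congrArg (act M) act_ofModular_S_two

theorem stdUltrabasis_congr {M N : GL (Fin 2) GaussianInt} (h : ∀ H, act M H = act N H)
    (η : ℤˣ) : stdUltrabasis M η = stdUltrabasis N η :=
  Ultrabasis.ext_form fun i => by rw [form_stdUltrabasis, form_stdUltrabasis, h]

/-- The vertices of the tetrahedra around a fixed circle are all identified, because the modular
group is generated by two elements that move a tetrahedron to a neighbouring one. -/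
theorem vertex_mul_ofModular (γ : Matrix.SpecialLinearGroup (Fin 2) ℤ) :
    ∀ M, (stdUltrabasis (M * ofModular γ) 1).vertex 0 = (stdUltrabasis M 1).vertex 0 := by
  have hγ : γ ∈ Subgroup.closure {ModularGroup.S, ModularGroup.T} := by
    rw [SpecialLinearGroup.SL2Z_generators]; trivial
  induction hγ using Subgroup.closure_induction with
  | mem x hx =>
    rintro M
    rcases hx with rfl | rfl
    · exact vertex_eq_of_wall (stdUltrabasis_wall_S M) 0
    · exact vertex_eq_of_wall (stdUltrabasis_wall_T M) 0
  | one => intro M; rw [map_one, mul_one]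
  | mul x y _ _ hx hy => intro M; rw [map_mul, ← mul_assoc, hy, hx]
  | inv x _ hx => intro M; rw [← hx, map_inv, inv_mul_cancel_right]

theorem edge_mul_ofModular_T_zpow (n : ℤ) : ∀ M,
    (stdUltrabasis (M * ofModular (ModularGroup.T ^ n)) 1).edge 0 1 (by decide) =
      (stdUltrabasis M 1).edge 0 1 (by decide) := by
  have key : ∀ M, (stdUltrabasis (M * ofModular ModularGroup.T) 1).edge 0 1 (by decide) =
      (stdUltrabasis M 1).edge 0 1 (by decide) := fun M =>
    edge_eq_of_wall (stdUltrabasis_wall_T M) 0 1 (by decide)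
  induction n using Int.induction_on with
  | zero => intro M; rw [zpow_zero, map_one, mul_one]
  | succ n ih => intro M; rw [zpow_add_one, map_mul, ← mul_assoc, key, ih]
  | pred n ih =>
    intro M
    rw [← key, mul_assoc, ← map_mul, ← zpow_add_one, sub_add_cancel, ih]

theorem exists_perm (i j : Fin 4) (h : i ≠ j) : ∃ σ : Equiv.Perm (Fin 4), σ 0 = i ∧ σ 1 = j := by
  by_cases h₁ : Equiv.swap 0 i 1 = j
  · exact ⟨Equiv.swap 0 i, Equiv.swap_apply_left _ _, h₁⟩
  · refine ⟨Equiv.swap (Equiv.swap 0 i 1) j * Equiv.swap 0 i, ?_, ?_⟩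
    · rw [Equiv.Perm.mul_apply, Equiv.swap_apply_left, Equiv.swap_apply_of_ne_of_ne _ h]
      intro h'
      have := (Equiv.swap 0 i).injective ((Equiv.swap_apply_left 0 i).trans h')
      exact absurd this (by decide)
    · rw [Equiv.Perm.mul_apply, Equiv.swap_apply_left]

theorem edge_eq_stdUltrabasis (T : Ultrabasis) (i j : Fin 4) (h : i ≠ j) :
    ∃ M, T.edge i j h = (stdUltrabasis M 1).edge 0 1 (by decide) ∧
      T.vertex i = (stdUltrabasis M 1).vertex 0 ∧ T.form i = act M (stdQuad 1 0) ∧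
      T.form j = act M (stdQuad 1 1) := by
  obtain ⟨σ, rfl, rfl⟩ := exists_perm i j h
  obtain ⟨T', hT'⟩ := T.exists_form_comp σ
  have h₀ := vertex_eq_of_renumbering hT' 0
  have h₁ := edge_eq_of_renumbering hT' 0 1 (by decide)
  have f₀ := congrFun hT' 0
  have f₁ := congrFun hT' 1
  obtain ⟨M, η, rfl⟩ := T'.exists_eq_stdUltrabasis
  simp only [form_stdUltrabasis, Function.comp_apply] at f₀ f₁
  refine ⟨M, h₁.symm.trans ?_, h₀.symm.trans ?_, ?_, ?_⟩
  · rcases Int.units_eq_one_or η with rfl | rfl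
    · rfl
    · exact edge_eq_of_wall (stdUltrabasis_wall_neg M) 0 1 (by decide)
  · rcases Int.units_eq_one_or η with rfl | rfl
    · rfl
    · exact vertex_eq_of_wall (stdUltrabasis_wall_neg M) 0
  · rw [← f₀, stdQuad_eq_of_ne η (by decide)]
  · rw [← f₁, stdQuad_eq_of_ne η (by decide)]

/-- Two standard chambers with the same form at vertex `0` differ by the stabilizer of the real line,
that is by the modular group, which fixes this vertex of the kingdom. -/
theorem vertexForm_injective : Function.Injective vertexForm := by
  have key : ∀ p, ∃ M, p = (stdUltrabasis M 1).vertex 0 := fun p => by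
    obtain ⟨T, i, rfl⟩ := exists_vertex p
    obtain ⟨j, hj⟩ := exists_ne i
    obtain ⟨M, -, h, -⟩ := edge_eq_stdUltrabasis T i j hj.symm
    exact ⟨M, h⟩
  intro p q h
  obtain ⟨M, rfl⟩ := key p
  obtain ⟨N, rfl⟩ := key q
  rw [vertexForm_vertex, vertexForm_vertex, form_stdUltrabasis, form_stdUltrabasis] at h
  obtain ⟨γ, c, hc, hγ⟩ := exists_modular_of_act_realForm (W := M⁻¹ * N)
    (by rw [act_mul]; exact act_injective M ((act_act_inv _ _).trans h.symm))
  rw [← vertex_mul_ofModular γ M]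
  congr 1
  refine stdUltrabasis_congr (fun H => ?_) 1
  rw [act_mul, ← act_eq_act_of_smul hc hγ, ← act_mul, mul_inv_cancel_left]

/-- Two standard chambers with the same forms at vertices `0` and `1` differ by a translation, which
leads through walls that contain the edge between them. -/
theorem edge_eq_of_form_eq {T T' : Ultrabasis} {i j i' j' : Fin 4} (h : i ≠ j) (h' : i' ≠ j')
    (hi : T.form i = T'.form i') (hj : T.form j = T'.form j') :
    T.edge i j h = T'.edge i' j' h' := by
  obtain ⟨M, he, -, h₀, h₁⟩ := edge_eq_stdUltrabasis T i j h
  obtain ⟨N, he', -, h₀', h₁'⟩ := edge_eq_stdUltrabasis T' i' j' h'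
  have hW : ∀ k, act M (stdQuad 1 k) = act N (stdQuad 1 k) →
      act (M⁻¹ * N) (stdQuad 1 k) = stdQuad 1 k := fun k hk => by
    rw [act_mul, ← hk, act_inv_act]
  obtain ⟨n, c, hc, hn⟩ := exists_translation_of_act (W := M⁻¹ * N)
    (hW 0 (by rw [← h₀, ← h₀', hi])) (hW 1 (by rw [← h₁, ← h₁', hj]))
  rw [he, he', ← edge_mul_ofModular_T_zpow n M]
  congr 1
  refine stdUltrabasis_congr (fun H => ?_) 1
  rw [act_mul, ← act_eq_act_of_smul hc hn, ← act_mul, mul_inv_cancel_left]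

/-! ### Oriented circles and Hermitian forms -/

/-- Homogeneous coordinates of a point of the extended complex plane. -/
def homog (p : OnePoint ℂ) : Fin 2 → ℂ := p.elim ![1, 0] fun z => ![z, 1]

theorem homog_infty : homog ∞ = ![1, 0] := rfl

theorem homog_coe (z : ℂ) : homog (z : OnePoint ℂ) = ![z, 1] := rfl

namespace HermForm

/-- The points of the extended complex plane at which a form vanishes. -/
def zeroSet (H : HermForm) : Set (OnePoint ℂ) := {p | H.eval (homog p) = 0}

/-- The points of the extended complex plane at which a form is negative. -/
def negSet (H : HermForm) : Set (OnePoint ℂ) := {p | H.eval (homog p) < 0}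

theorem mem_zeroSet {H : HermForm} {p : OnePoint ℂ} : p ∈ H.zeroSet ↔ H.eval (homog p) = 0 :=
  Iff.rfl

theorem mem_negSet {H : HermForm} {p : OnePoint ℂ} : p ∈ H.negSet ↔ H.eval (homog p) < 0 :=
  Iff.rfl

theorem eval_infty (H : HermForm) : H.eval (homog ∞) = H.1 := by simp [eval, homog_infty]

theorem eval_coe {H : HermForm} (h : lorentz H H = 1) (ha : H.1 ≠ 0) (z : ℂ) :
    H.eval (homog z) = H.1 * (dist z (H.2.2 / H.1) ^ 2 - (1 / |H.1|) ^ 2) := by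
  obtain ⟨a, b, x, y⟩ := H
  simp only [lorentz_apply] at h
  replace ha : a ≠ 0 := ha
  rw [Complex.dist_eq, Complex.sq_norm, one_div, inv_pow, sq_abs]
  simp [eval, homog_coe, normSq_apply, Complex.div_re, Complex.div_im]
  field_simp
  linear_combination -h

theorem eval_coe_line {H : HermForm} (ha : H.1 = 0) (z : ℂ) :
    H.eval (homog z) = H.2.1 - 2 * (conj H.2.2 * z).re := by
  simp [eval, homog_coe, ha]

theorem zeroSet_of_ne {H : HermForm} (h : lorentz H H = 1) (ha : H.1 ≠ 0) :
    H.zeroSet = (fun z : ℂ => (z : OnePoint ℂ)) '' Metric.sphere (H.2.2 / H.1) (1 / |H.1|) := by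
  ext p
  induction p using OnePoint.rec with
  | infty => simp [mem_zeroSet, eval_infty, ha]
  | coe z =>
    simp only [mem_zeroSet, eval_coe h ha, mul_eq_zero, ha, false_or, sub_eq_zero, mem_image,
      OnePoint.coe_eq_coe, exists_eq_right, Metric.mem_sphere]
    exact pow_left_inj₀ dist_nonneg (by positivity) two_ne_zero

theorem negSet_of_pos {H : HermForm} (h : lorentz H H = 1) (ha : 0 < H.1) :
    H.negSet = (fun z : ℂ => (z : OnePoint ℂ)) '' Metric.ball (H.2.2 / H.1) (1 / |H.1|) := by
  ext p
  induction p using OnePoint.rec with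
  | infty => simp [mem_negSet, eval_infty, ha.le]
  | coe z =>
    simp only [mem_negSet, eval_coe h ha.ne', mul_neg_iff, ha, ha.not_gt, true_and, false_and,
      or_false, sub_neg, mem_image, OnePoint.coe_eq_coe, exists_eq_right, Metric.mem_ball]
    exact pow_lt_pow_iff_left₀ dist_nonneg (by positivity) two_ne_zero

theorem negSet_of_neg {H : HermForm} (h : lorentz H H = 1) (ha : H.1 < 0) :
    H.negSet =
      ((fun z : ℂ => (z : OnePoint ℂ)) '' Metric.closedBall (H.2.2 / H.1) (1 / |H.1|))ᶜ := by
  ext p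
  induction p using OnePoint.rec with
  | infty => simp [mem_negSet, eval_infty, ha]
  | coe z =>
    simp only [mem_negSet, eval_coe h ha.ne, mul_neg_iff, ha, ha.not_gt, true_and, false_and,
      false_or, sub_pos, mem_compl_iff, mem_image, OnePoint.coe_eq_coe, exists_eq_right,
      Metric.mem_closedBall, not_le]
    exact pow_lt_pow_iff_left₀ (by positivity) dist_nonneg two_ne_zero

theorem zeroSet_of_eq {H : HermForm} (ha : H.1 = 0) :
    H.zeroSet = insert ∞
      ((fun z : ℂ => (z : OnePoint ℂ)) '' {z | (conj H.2.2 * z).re = H.2.1 / 2}) := by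
  ext p
  induction p using OnePoint.rec with
  | infty => simp [mem_zeroSet, eval_infty, ha]
  | coe z =>
    rw [mem_zeroSet, eval_coe_line ha]
    simp only [mem_insert_iff, OnePoint.coe_ne_infty, false_or, mem_image, OnePoint.coe_eq_coe,
      exists_eq_right, mem_ofPred_eq]
    constructor <;> intro h <;> linarith

theorem negSet_of_eq {H : HermForm} (ha : H.1 = 0) :
    H.negSet = (fun z : ℂ => (z : OnePoint ℂ)) '' {z | H.2.1 / 2 < (conj H.2.2 * z).re} := by
  ext p
  induction p using OnePoint.rec with
  | infty => simp [mem_negSet, eval_infty, ha]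
  | coe z =>
    rw [mem_negSet, eval_coe_line ha]
    simp only [mem_image, OnePoint.coe_eq_coe, exists_eq_right, mem_ofPred_eq]
    constructor <;> intro h <;> linarith

/-- The oriented circle of a normalized Hermitian form: the form vanishes on the circle and is
negative on its interior. -/
def circle (H : HermForm) (h : lorentz H H = 1) : OrientedCircle where
  carrier := H.zeroSet
  interior := H.negSet
  isCircle := by
    by_cases ha : H.1 = 0
    · refine Or.inr ⟨H.2.2, H.2.1 / 2, ?_, zeroSet_of_eq ha, negSet_of_eq ha⟩
      intro h0
      simp [lorentz_apply, ha, h0] at h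
    · refine Or.inl ⟨H.2.2 / H.1, 1 / |H.1|, by positivity, zeroSet_of_ne h ha, ?_⟩
      rcases lt_or_gt_of_ne ha with ha' | ha'
      · exact Or.inr (negSet_of_neg h ha')
      · exact Or.inl (negSet_of_pos h ha')

theorem circle_congr {H K : HermForm} (h : H = K) (hH : lorentz H H = 1) (hK : lorentz K K = 1) :
    H.circle hH = K.circle hK := by
  subst h; rfl

end HermForm

theorem OrientedCircle.exists_eq_circle (C : OrientedCircle) : ∃ H h, C = HermForm.circle H h := by
  obtain ⟨S, U, ⟨c, r, hr, rfl, hU⟩ | ⟨a, t, ha, rfl, rfl⟩⟩ := C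
  · have key : ∀ s : ℝ, s * s = 1 → ∃ H : HermForm, lorentz H H = 1 ∧ H.1 = s / r ∧
        H.2.2 / H.1 = c ∧ 1 / |H.1| = r := by
      intro s hs
      have hs0 : s ≠ 0 := by rintro rfl; simp at hs
      have hs1 : |s| = 1 := by
        have := abs_mul_abs_self s
        rw [hs] at this
        nlinarith [abs_nonneg s]
      refine ⟨(s / r, s * (normSq c - r ^ 2) / r, (s / r : ℝ) * c), ?_, rfl, ?_, ?_⟩
      · simp only [lorentz_apply, normSq_apply, re_ofReal_mul, im_ofReal_mul]
        field_simp
        linear_combination 2 * r ^ 2 * hs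
      · have : ((s / r : ℝ) : ℂ) ≠ 0 := by
          rw [Ne, ofReal_eq_zero]; positivity
        simp only
        field_simp
      · rw [abs_div, hs1, abs_of_pos hr]; simp
    rcases hU with rfl | rfl
    · obtain ⟨H, h, ha, hc, hr'⟩ := key 1 (by norm_num)
      have ha' : 0 < H.1 := by rw [ha]; positivity
      refine ⟨H, h, OrientedCircle.ext ?_ ?_⟩
      · exact ((zeroSet_of_ne h ha'.ne').trans (by rw [hc, hr'])).symm
      · exact ((negSet_of_pos h ha').trans (by rw [hc, hr'])).symm
    · obtain ⟨H, h, ha, hc, hr'⟩ := key (-1) (by norm_num)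
      have ha' : H.1 < 0 := by rw [ha, neg_div]; simpa using hr
      refine ⟨H, h, OrientedCircle.ext ?_ ?_⟩
      · exact ((zeroSet_of_ne h ha'.ne).trans (by rw [hc, hr'])).symm
      · exact ((negSet_of_neg h ha').trans (by rw [hc, hr'])).symm
  · have hn : 0 < ‖a‖ := norm_pos_iff.2 ha
    have hre : ∀ z : ℂ, (conj ((‖a‖⁻¹ : ℝ) * a) * z).re = ‖a‖⁻¹ * (conj a * z).re := fun z => by
      rw [map_mul, conj_ofReal, mul_assoc, re_ofReal_mul]
    refine ⟨(0, 2 * (‖a‖⁻¹ * t), (‖a‖⁻¹ : ℝ) * a), ?_, OrientedCircle.ext ?_ ?_⟩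
    · have : a.re * a.re + a.im * a.im = ‖a‖ ^ 2 := by rw [Complex.sq_norm, normSq_apply]
      simp only [lorentz_apply, re_ofReal_mul, im_ofReal_mul]
      field_simp
      linear_combination this
    · refine Eq.trans ?_ (zeroSet_of_eq rfl).symm
      simp only [hre]
      congr 3
      ext z
      rw [mul_div_cancel_left₀ _ two_ne_zero, mul_right_inj' (by positivity)]
    · refine Eq.trans ?_ (negSet_of_eq rfl).symm
      simp only [hre]
      congr 2
      ext z
      rw [mul_div_cancel_left₀ _ two_ne_zero, mul_lt_mul_iff_right₀ (by positivity)]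

/-! ### Möbius transformations and Gaussian circles -/

theorem moebius_mul (M N : GL (Fin 2) GaussianInt) (p : OnePoint ℂ) :
    moebius (M * N) p = moebius M (moebius N p) := by
  simp only [moebius, map_mul, mul_smul]

theorem moebius_moebius_inv (M : GL (Fin 2) GaussianInt) (p : OnePoint ℂ) :
    moebius M (moebius M⁻¹ p) = p := by
  rw [← moebius_mul, mul_inv_cancel, moebius, map_one, one_smul]

theorem moebius_injective (M : GL (Fin 2) GaussianInt) : Function.Injective (moebius M) :=
  MulAction.injective _

theorem mulVec_homog (M : GL (Fin 2) GaussianInt) (p : OnePoint ℂ) :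
    ∃ k : ℂ, k ≠ 0 ∧ (complexMat M).mulVec (homog p) = k • homog (moebius M p) := by
  have hdet : complexMat M 0 0 * complexMat M 1 1 - complexMat M 0 1 * complexMat M 1 0 ≠ 0 := by
    rw [← Matrix.det_fin_two, ← normSq_pos, normSq_det_complexMat]
    exact one_pos
  have hM : ∀ i j, (Matrix.GeneralLinearGroup.map GaussianInt.toComplex M).1 i j =
      complexMat M i j := fun _ _ => rfl
  induction p using OnePoint.rec with
  | infty =>
    rw [moebius, OnePoint.smul_infty_eq_ite, hM, hM]
    split_ifs with h
    · refine ⟨complexMat M 0 0, fun h0 => hdet (by rw [h, h0]; ring), ?_⟩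
      ext i
      fin_cases i <;> simp [Matrix.mulVec, dotProduct, homog_infty, h]
    · refine ⟨complexMat M 1 0, h, ?_⟩
      ext i
      fin_cases i <;> simp [Matrix.mulVec, dotProduct, homog_infty, homog_coe]
      field_simp
  | coe z =>
    rw [moebius, OnePoint.smul_some_eq_ite, hM, hM, hM, hM]
    split_ifs with h
    · refine ⟨complexMat M 0 0 * z + complexMat M 0 1, fun h0 => hdet ?_, ?_⟩
      · by_cases hc : complexMat M 1 0 = 0
        · rw [hc, zero_mul, zero_add] at h
          rw [hc, h]; ring
        · refine (mul_eq_zero.1 (?_ : complexMat M 1 0 * _ = 0)).resolve_left hc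
          linear_combination complexMat M 0 0 * complexMat M 1 0 * h -
            complexMat M 1 0 * complexMat M 1 0 * h0
      · ext i
        fin_cases i <;> simp [Matrix.mulVec, dotProduct, homog_infty, homog_coe, h]
    · refine ⟨complexMat M 1 0 * z + complexMat M 1 1, h, ?_⟩
      ext i
      fin_cases i <;> simp [Matrix.mulVec, dotProduct, homog_coe]
      rw [← mul_div_assoc, mul_div_cancel_left₀ _ h]

theorem eval_act_homog (M : GL (Fin 2) GaussianInt) (H : HermForm) (p : OnePoint ℂ) :
    ∃ t : ℝ, 0 < t ∧ H.eval (homog p) = t * (act M H).eval (homog (moebius M p)) := by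
  obtain ⟨k, hk, h⟩ := mulVec_homog M p
  exact ⟨normSq k, normSq_pos.2 hk, by rw [← eval_act M, h, eval_smul]⟩

theorem zeroSet_act (M : GL (Fin 2) GaussianInt) (H : HermForm) :
    (act M H).zeroSet = moebius M '' H.zeroSet := by
  have key : ∀ p, moebius M p ∈ (act M H).zeroSet ↔ p ∈ H.zeroSet := fun p => by
    obtain ⟨t, ht, h⟩ := eval_act_homog M H p
    rw [mem_zeroSet, mem_zeroSet, h, mul_eq_zero, or_iff_right ht.ne']
  ext p
  constructor
  · intro hp
    rw [← moebius_moebius_inv M p, key] at hp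
    exact ⟨_, hp, moebius_moebius_inv M p⟩
  · rintro ⟨q, hq, rfl⟩
    exact (key q).2 hq

theorem negSet_act (M : GL (Fin 2) GaussianInt) (H : HermForm) :
    (act M H).negSet = moebius M '' H.negSet := by
  have key : ∀ p, moebius M p ∈ (act M H).negSet ↔ p ∈ H.negSet := fun p => by
    obtain ⟨t, ht, h⟩ := eval_act_homog M H p
    rw [mem_negSet, mem_negSet, h, ← neg_pos, ← neg_pos (a := t * _), ← mul_neg,
      mul_pos_iff_of_pos_left ht]
  ext p
  constructor
  · intro hp
    rw [← moebius_moebius_inv M p, key] at hp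
    exact ⟨_, hp, moebius_moebius_inv M p⟩
  · rintro ⟨q, hq, rfl⟩
    exact (key q).2 hq

theorem lorentz_realForm : lorentz realForm realForm = 1 := by
  simp [lorentz_apply, realForm]

theorem eval_realForm (z : ℂ) : realForm.eval (homog z) = 2 * z.im := by
  simp [eval, realForm, homog_coe]

theorem zeroSet_realForm :
    realForm.zeroSet = insert ∞ (range fun x : ℝ => ((x : ℂ) : OnePoint ℂ)) := by
  ext p
  induction p using OnePoint.rec with
  | infty => simp [mem_zeroSet, eval, realForm, homog_infty]
  | coe z =>
    simp only [mem_zeroSet, eval_realForm, mem_insert_iff, OnePoint.coe_ne_infty, false_or,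
      mem_range, OnePoint.coe_eq_coe]
    constructor
    · intro h
      exact ⟨z.re, Complex.ext rfl (by simp; linarith)⟩
    · rintro ⟨x, rfl⟩
      simp

theorem negSet_realForm :
    realForm.negSet = (fun z : ℂ => (z : OnePoint ℂ)) '' {z | z.im < 0} := by
  ext p
  induction p using OnePoint.rec with
  | infty => simp [mem_negSet, eval, realForm, homog_infty]
  | coe z =>
    simp only [mem_negSet, eval_realForm, mem_image, OnePoint.coe_eq_coe, exists_eq_right,
      mem_ofPred_eq]
    constructor <;> intro h <;> linarith

theorem lorentz_act_realForm (M : GL (Fin 2) GaussianInt) :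
    lorentz (act M realForm) (act M realForm) = 1 := by
  rw [lorentz_act, lorentz_realForm]

theorem OrientedCircle.isGaussian_iff {C : OrientedCircle} :
    C.IsGaussian ↔ ∃ M, C = (act M realForm).circle (lorentz_act_realForm M) := by
  refine exists_congr fun M => ?_
  rw [OrientedCircle.ext_iff, ← zeroSet_realForm, ← negSet_realForm, ← zeroSet_act, ← negSet_act]
  rfl

/-! ### Tangency -/

theorem lorentz_null_right (H : HermForm) (l : Fin 2 → ℂ) :
    lorentz H (null l) = -H.eval l / 2 := by
  simp [null, eval, lorentz_apply, normSq_apply]; ring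

theorem eval_null_homog_eq_zero_iff (l : LaxVector) (p : OnePoint ℂ) :
    l.form.eval (homog p) = 0 ↔ p = l.point := by
  obtain ⟨v, rfl⟩ := l.exists_rep
  have hv : v.1 1 = 0 → v.1 0 ≠ 0 := fun h h' => by
    have := v.2
    rw [h, h'] at this
    exact not_isCoprime_zero_zero this
  rw [form_lax, eval_null, normSq_eq_zero]
  change _ ↔ p = if v.1 1 = 0 then (∞ : OnePoint ℂ)
    else ((GaussianInt.toComplex (v.1 0) / GaussianInt.toComplex (v.1 1) : ℂ) : OnePoint ℂ)
  induction p using OnePoint.rec with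
  | infty =>
    split_ifs with h <;> simp [homog_infty, complexVec, h]
  | coe z =>
    split_ifs with h
    · simp [homog_coe, complexVec, h, hv h]
    · have h' : GaussianInt.toComplex (v.1 1) ≠ 0 := by simpa using h
      rw [OnePoint.coe_eq_coe, eq_div_iff h', ← sub_eq_zero (a := z * _)]
      simp only [homog_coe, complexVec, Matrix.cons_val_zero, Matrix.cons_val_one, one_mul]

theorem form_eq_smul_null_point (l : LaxVector) :
    ∃ k : ℝ, 0 < k ∧ l.form = k • null (homog l.point) := by
  obtain ⟨v, rfl⟩ := l.exists_rep
  have hv : v.1 1 = 0 → v.1 0 ≠ 0 := fun h h' => by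
    have := v.2
    rw [h, h'] at this
    exact not_isCoprime_zero_zero this
  have key : ∀ k : ℂ, k ≠ 0 → complexVec v.1 = k • homog v.lax.point →
      ∃ k : ℝ, 0 < k ∧ v.lax.form = k • null (homog v.lax.point) := fun k hk h =>
    ⟨normSq k, normSq_pos.2 hk, by rw [form_lax, h, null_smul]⟩
  have hp : v.lax.point = if v.1 1 = 0 then (∞ : OnePoint ℂ)
    else ((GaussianInt.toComplex (v.1 0) / GaussianInt.toComplex (v.1 1) : ℂ) : OnePoint ℂ) := rfl
  by_cases h : v.1 1 = 0
  · refine key (GaussianInt.toComplex (v.1 0)) (by simpa using hv h) ?_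
    rw [hp, if_pos h]
    ext i
    fin_cases i <;> simp [complexVec, homog_infty, h]
  · have h' : GaussianInt.toComplex (v.1 1) ≠ 0 := by simpa using h
    refine key (GaussianInt.toComplex (v.1 1)) h' ?_
    rw [hp, if_neg h]
    ext i
    fin_cases i <;> simp [complexVec, homog_coe]
    field_simp

theorem lorentz_eq_neg_one_of_add {A H : HermForm} {l : LaxVector} (hA : lorentz A A = 1)
    (hH : lorentz H H = 1) (h : A + H = (2 : ℝ) • l.form) : lorentz A H = -1 := by
  have h₀ : lorentz (A + H) (A + H) = 0 := by
    rw [h]; simp [LaxVector.lorentz_form_self]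
  simp only [map_add, LinearMap.add_apply, hA, hH, lorentz_comm H A] at h₀
  linarith

/-- Two circles whose forms add up to twice the form of a lax vector are tangent at the point of
that lax vector. -/
theorem zeroSet_inter_of_add {A H : HermForm} {l : LaxVector} (hA : lorentz A A = 1)
    (hH : lorentz H H = 1) (h : A + H = (2 : ℝ) • l.form) :
    A.zeroSet ∩ H.zeroSet = {l.point} := by
  have hsum : ∀ p, A.eval (homog p) + H.eval (homog p) = 2 * l.form.eval (homog p) := fun p => by
    rw [← eval_add, h, eval_smul_form]
  ext p
  rw [mem_singleton_iff, ← eval_null_homog_eq_zero_iff, mem_inter_iff, mem_zeroSet, mem_zeroSet]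
  constructor
  · rintro ⟨h₁, h₂⟩
    have := hsum p
    linarith
  · intro hp
    have hAl : lorentz A l.form = 0 := by
      have : lorentz A (A + H) = 0 := by
        rw [map_add, hA, lorentz_eq_neg_one_of_add hA hH h]; norm_num
      rw [h] at this
      simpa using this
    have h₁ : A.eval (homog p) = 0 := by
      obtain ⟨k, hk, hl⟩ := form_eq_smul_null_point l
      rw [(eval_null_homog_eq_zero_iff l p).1 hp]
      rw [hl, LinearMap.map_smul, lorentz_null_right] at hAl
      have := (mul_eq_zero.1 hAl).resolve_left hk.ne'
      linarith
    refine ⟨h₁, ?_⟩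
    have := hsum p
    linarith

theorem disjoint_negSet_of_nonneg {A H : HermForm} (h : ∀ v, 0 ≤ (A + H).eval v) :
    Disjoint A.negSet H.negSet := by
  rw [Set.disjoint_left]
  intro p h₁ h₂
  have := h (homog p)
  rw [eval_add] at this
  rw [mem_negSet] at h₁ h₂
  linarith

theorem LaxVector.eval_form_nonneg (l : LaxVector) (v : Fin 2 → ℂ) : 0 ≤ l.form.eval v := by
  obtain ⟨w, rfl⟩ := l.exists_rep
  rw [form_lax, eval_null]
  exact normSq_nonneg _

/-- A circle meets the real line in exactly one point only if its form is, up to the orientation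
of the circle, a degenerate real form minus the form of the real line. -/
theorem tangent_realForm {a b x y : ℝ} (h : x * x + y * y - a * b = 1) {p : OnePoint ℂ}
    (hp : realForm.zeroSet ∩ zeroSet ((a, b, ⟨x, y⟩) : HermForm) = {p}) :
    (y = 1 ∨ y = -1) ∧ (a = 0 ∧ x = 0 ∧ b ≠ 0 ∨ ∃ t, a ≠ 0 ∧ x = a * t ∧ b = a * t ^ 2) := by
  have hmem : ∀ q, q ∈ realForm.zeroSet ∩ zeroSet ((a, b, ⟨x, y⟩) : HermForm) ↔ q = p := fun q => by
    rw [hp, mem_singleton_iff]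
  have hinf : a = 0 ↔ ∞ = p := by
    rw [← hmem]
    simp [mem_zeroSet, homog_infty, eval, realForm]
  have hreal : ∀ t : ℝ, a * t ^ 2 - 2 * x * t + b = 0 ↔ ((t : ℂ) : OnePoint ℂ) = p := fun t => by
    rw [← hmem]
    simp only [mem_inter_iff, mem_zeroSet, eval_realForm]
    simp [homog_coe, eval]
    constructor <;> intro h <;> linarith
  have hy : x ^ 2 = a * b → y = 1 ∨ y = -1 := fun hx => by
    have : (y - 1) * (y + 1) = 0 := by linarith
    rcases mul_eq_zero.1 this with h | h
    · left; linarith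
    · right; linarith
  by_cases ha : a = 0
  · have hp' := hinf.1 ha
    have hno : ∀ t : ℝ, -2 * x * t + b ≠ 0 := fun t ht => by
      have := (hreal t).1 (by rw [ha]; linarith)
      rw [← hp'] at this
      exact OnePoint.coe_ne_infty _ this
    have hx : x = 0 := by
      by_contra hx
      exact hno (b / (2 * x)) (by field_simp; ring)
    refine ⟨hy (by rw [hx, ha]; ring), Or.inl ⟨ha, hx, ?_⟩⟩
    intro hb
    exact hno 0 (by rw [hb]; ring)
  · obtain ⟨t, rfl⟩ : ∃ t : ℝ, p = ((t : ℂ) : OnePoint ℂ) := by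
      have := ((hmem p).2 rfl).1
      rw [zeroSet_realForm] at this
      rcases this with h | ⟨t, ht⟩
      · exact absurd (hinf.2 h.symm) ha
      · exact ⟨t, ht.symm⟩
    have h₁ := (hreal t).2 rfl
    -- The second root of the quadratic coincides with `t`.
    have h₂ : 2 * x / a - t = t := by
      have := (hreal (2 * x / a - t)).1 (by field_simp; linear_combination a * h₁)
      rwa [OnePoint.coe_eq_coe, ofReal_inj] at this
    have hx : x = a * t := by field_simp at h₂; linarith
    have hb : b = a * t ^ 2 := by rw [hx] at h₁; linarith
    exact ⟨hy (by rw [hx, hb]; ring), Or.inr ⟨t, ha, hx, hb⟩⟩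

theorem lorentz_of_tangent_realForm {H : HermForm} (h : lorentz H H = 1) {p : OnePoint ℂ}
    (hp : realForm.zeroSet ∩ H.zeroSet = {p}) :
    lorentz realForm H = 1 ∨ lorentz realForm H = -1 := by
  obtain ⟨a, b, x, y⟩ := H
  simp only [lorentz_apply] at h
  obtain ⟨hy, -⟩ := tangent_realForm (by linarith) hp
  rcases hy with rfl | rfl
  · right; simp [lorentz_apply, realForm]
  · left; simp [lorentz_apply, realForm]

/-- Two forms with product `-1` whose sum is positive semidefinite and nonzero. For forms of circles
this is external tangency with disjoint interiors; the sum vanishes when the two circles are the two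
orientations of one circle. -/
structure ExtTangent (A H : HermForm) : Prop where
  lorentz_eq : lorentz A H = -1
  nonneg : ∀ v, 0 ≤ (A + H).eval v
  ne_zero : A + H ≠ 0

theorem extTangent_realForm {H : HermForm} (h : lorentz H H = 1) {p : OnePoint ℂ}
    (hp : realForm.zeroSet ∩ H.zeroSet = {p}) (hd : Disjoint realForm.negSet H.negSet) :
    ExtTangent realForm H := by
  obtain ⟨a, b, x, y⟩ := H
  simp only [lorentz_apply] at h
  -- Disjointness is tested below at points of the lower half-plane: far from the real line or close
  -- to it, according to the sign that is to be excluded.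
  have hdis : ∀ z : ℂ, z.im < 0 →
      0 ≤ a * (z.re ^ 2 + z.im ^ 2) + b - 2 * (x * z.re + y * z.im) := fun z hz => by
    by_contra! hneg
    have h₁ : (z : OnePoint ℂ) ∈ realForm.negSet := by
      rw [mem_negSet, eval_realForm]; linarith
    refine Set.disjoint_left.1 hd h₁ ?_
    rw [mem_negSet]
    simp [homog_coe, eval, normSq_apply]
    linarith
  obtain ⟨hy, hcase⟩ := tangent_realForm (by linarith) hp
  rcases hcase with ⟨rfl, rfl, hb⟩ | ⟨t, ha, rfl, rfl⟩
  · have hy1 : y = 1 := by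
      refine hy.resolve_right ?_
      rintro rfl
      have := hdis ⟨0, -(|b| + 1)⟩ (by show -(|b| + 1) < 0; linarith [abs_nonneg b])
      simp at this
      linarith [le_abs_self b, abs_nonneg b]
    subst hy1
    have hb0 : 0 < b := by
      refine lt_of_le_of_ne (not_lt.1 fun hb' => ?_) hb.symm
      have := hdis ⟨0, b / 4⟩ (by simp; linarith)
      simp at this
      linarith
    refine ⟨by simp [lorentz_apply, realForm], fun v => ?_, fun h0 => ?_⟩
    · simp [eval, realForm]
      exact mul_nonneg hb0.le (normSq_nonneg _)
    · have := congrArg (fun K : HermForm => K.2.1) h0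
      simp [realForm] at this
      exact hb this
  · have hy1 : y = 1 := by
      refine hy.resolve_right ?_
      rintro rfl
      have := hdis ⟨t, -(1 / (|a| + 1))⟩ (by simp; positivity)
      simp only at this
      have h1 : a * (1 / (|a| + 1)) ^ 2 - 2 * (1 / (|a| + 1)) < 0 := by
        have h2 : 0 < 1 / (|a| + 1) := by positivity
        have h3 : a * (1 / (|a| + 1)) < 1 := by
          rw [mul_one_div, div_lt_one (by positivity)]
          linarith [le_abs_self a]
        nlinarith
      nlinarith
    subst hy1
    have ha0 : 0 < a := by
      refine lt_of_le_of_ne (not_lt.1 fun ha' => ?_) ha.symm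
      have := hdis ⟨t, 4 / a⟩ (div_neg_of_pos_of_neg (by norm_num) ha')
      simp only at this
      have h1 : a * (t ^ 2 + (4 / a) ^ 2) + a * t ^ 2 - 2 * (a * t * t + 1 * (4 / a)) = 8 / a := by
        field_simp; ring
      have h2 : 8 / a < 0 := div_neg_of_pos_of_neg (by norm_num) ha'
      linarith
    refine ⟨by simp [lorentz_apply, realForm], fun v => ?_, fun h0 => ?_⟩
    · have : (realForm + ((a, a * t ^ 2, ⟨a * t, 1⟩) : HermForm)).eval v =
          a * normSq (v 0 - t * v 1) := by
        simp [eval, realForm, normSq_apply]; ring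
      rw [this]
      exact mul_nonneg ha0.le (normSq_nonneg _)
    · have := congrArg Prod.fst h0
      simp [realForm] at this
      exact ha this

theorem act_zero_sets {M : GL (Fin 2) GaussianInt} {H : HermForm} {p : OnePoint ℂ}
    (hp : (act M realForm).zeroSet ∩ H.zeroSet = {p}) :
    realForm.zeroSet ∩ (act M⁻¹ H).zeroSet = {moebius M⁻¹ p} := by
  rw [← image_singleton, ← hp, image_inter (moebius_injective _), ← zeroSet_act, ← zeroSet_act,
    act_inv_act]

theorem lorentz_of_tangent {M : GL (Fin 2) GaussianInt} {H : HermForm} (h : lorentz H H = 1)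
    {p : OnePoint ℂ} (hp : (act M realForm).zeroSet ∩ H.zeroSet = {p}) :
    lorentz (act M realForm) H = 1 ∨ lorentz (act M realForm) H = -1 := by
  rw [← act_act_inv M H, lorentz_act]
  exact lorentz_of_tangent_realForm (by rw [lorentz_act, h]) (act_zero_sets hp)

theorem extTangent_of_tangent {M : GL (Fin 2) GaussianInt} {H : HermForm} (h : lorentz H H = 1)
    {p : OnePoint ℂ} (hp : (act M realForm).zeroSet ∩ H.zeroSet = {p})
    (hd : Disjoint (act M realForm).negSet H.negSet) : ExtTangent (act M realForm) H := by
  have hd' : Disjoint realForm.negSet (act M⁻¹ H).negSet := by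
    rw [← act_inv_act M realForm, negSet_act, negSet_act M⁻¹ H,
      disjoint_image_iff (moebius_injective _)]
    exact hd
  obtain ⟨h₁, h₂, h₃⟩ := extTangent_realForm (H := act M⁻¹ H) (by rw [lorentz_act, h])
    (act_zero_sets hp) hd'
  have hH : act M realForm + H = act M (realForm + act M⁻¹ H) := by
    rw [map_add, act_act_inv]
  refine ⟨by rw [← h₁, ← lorentz_act M realForm, act_act_inv], fun v => ?_, fun h0 => h₃ ?_⟩
  · rw [hH, act, eval_pull]
    exact h₂ _
  · rw [hH] at h0
    exact act_injective M (h0.trans (map_zero _).symm)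

/-- A Gaussian circle determines its Hermitian form. -/
theorem act_realForm_eq_of_sets {M : GL (Fin 2) GaussianInt} {H : HermForm} (h : lorentz H H = 1)
    (hz : (act M realForm).zeroSet = H.zeroSet) (hn : (act M realForm).negSet = H.negSet) :
    act M realForm = H := by
  have hz' : realForm.zeroSet = (act M⁻¹ H).zeroSet := by
    rw [zeroSet_act, ← hz, ← zeroSet_act, act_inv_act]
  have hn' : realForm.negSet = (act M⁻¹ H).negSet := by
    rw [negSet_act, ← hn, ← negSet_act, act_inv_act]
  suffices realForm = act M⁻¹ H by rw [this, act_act_inv]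
  have h' : lorentz (act M⁻¹ H) (act M⁻¹ H) = 1 := by rw [lorentz_act, h]
  generalize act M⁻¹ H = K at hz' hn' h'
  obtain ⟨a, b, x, y⟩ := K
  -- The points `∞`, `0`, `1` determine the form up to sign, and `-i` determines the sign.
  have h₁ : ∞ ∈ realForm.zeroSet := by rw [zeroSet_realForm]; exact mem_insert _ _
  have h₂ : ∀ t : ℝ, ((t : ℂ) : OnePoint ℂ) ∈ realForm.zeroSet := fun t => by
    rw [zeroSet_realForm]; exact mem_insert_of_mem _ ⟨t, rfl⟩
  have h₃ := h₂ 0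
  have h₄ := h₂ 1
  have h₅ : ((-I : ℂ) : OnePoint ℂ) ∈ realForm.negSet := by
    rw [negSet_realForm]; exact ⟨-I, by simp, rfl⟩
  rw [hz', mem_zeroSet] at h₁ h₃ h₄
  rw [hn', mem_negSet] at h₅
  simp [eval, homog_infty, homog_coe, lorentz_apply] at h₁ h₃ h₄ h₅ h'
  subst h₁ h₃
  obtain rfl : x = 0 := by linarith
  have hy : (y - 1) * (y + 1) = 0 := by linarith
  have : y = -1 := by
    rcases mul_eq_zero.1 hy with hy | hy <;> linarith
  ext <;> simp [realForm, this]

/-! ### Integrality and the labels of tangent circles -/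

/-- A nonzero positive semidefinite degenerate Hermitian form over `ℤ[i]` is a positive integral
multiple of the form of a lax vector. -/
theorem exists_eq_smul_form {a b : ℤ} {B : GaussianInt} (ha : 0 ≤ a)
    (hne : 0 < a + b) (h : B.norm = a * b) :
    ∃ (n : ℤ) (l : LaxVector), 0 < n ∧
      (((a : ℝ), (b : ℝ), GaussianInt.toComplex B) : HermForm) = (n : ℝ) • l.form := by
  suffices ∃ (n : ℤ) (v : PrimitiveVector), 0 < n ∧ a = n * (v.1 1).norm ∧
      b = n * (v.1 0).norm ∧ B = n * (v.1 0 * star (v.1 1)) by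
    obtain ⟨n, v, hn, h₁, h₂, h₃⟩ := this
    refine ⟨n, v.lax, hn, ?_⟩
    rw [form_lax, h₁, h₂, h₃]
    ext <;> simp [null, complexVec]
  rcases ha.eq_or_lt with rfl | ha
  · refine ⟨b, ⟨![1, 0], 1, 0, by simp⟩, by simpa using hne, by simp, by simp, ?_⟩
    rw [zero_mul, GaussianInt.norm_eq_zero] at h
    simp [h]
  · -- The kernel of the form is spanned by `(B, a)`, so the primitive vector is `(B, a) / gcd B a`.
    obtain ⟨l₀, hl₀⟩ := EuclideanDomain.gcd_dvd_left B (a : GaussianInt)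
    obtain ⟨l₁, hl₁⟩ := EuclideanDomain.gcd_dvd_right B (a : GaussianInt)
    have hbez := EuclideanDomain.gcd_eq_gcd_ab B (a : GaussianInt)
    set g := EuclideanDomain.gcd B (a : GaussianInt)
    set u := EuclideanDomain.gcdA B (a : GaussianInt)
    set w := EuclideanDomain.gcdB B (a : GaussianInt)
    have ha0 : (a : GaussianInt) ≠ 0 := by exact_mod_cast ha.ne'
    have hg : g ≠ 0 := by rintro h0; rw [h0, zero_mul] at hl₁; exact ha0 hl₁
    have hl₁0 : l₁ ≠ 0 := by rintro h0; rw [h0, mul_zero] at hl₁; exact ha0 hl₁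
    have hcop : u * l₀ + w * l₁ = 1 := by
      apply mul_left_cancel₀ hg
      linear_combination -hbez - u * hl₀ - w * hl₁
    have hcop' : star u * star l₀ + star w * star l₁ = 1 := by
      have := congrArg star hcop
      simpa using this
    have hstar : g * l₁ = star g * star l₁ := by
      rw [← hl₁, ← star_mul', ← hl₁]
      ext <;> simp
    have hB : (g * l₀) * (star g * star l₀) = g * l₁ * b := by
      rw [← hl₁, ← star_mul', ← hl₀, ← Zsqrtd.norm_eq_mul_conj, h]
      push_cast; ring
    have hB' : star g * star l₀ * l₀ = l₁ * b := by
      apply mul_left_cancel₀ hg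
      linear_combination hB
    -- Hence `l₁` divides `star g`, with real quotient.
    obtain ⟨k, hk⟩ : l₁ ∣ star g := by
      have hd : l₁ ∣ star g * star l₀ := by
        refine IsCoprime.dvd_of_dvd_mul_right ⟨w, u, by rw [← hcop]; ring⟩ ⟨b, hB'⟩
      have : star g = star g * star l₀ * star u + l₁ * (g * star w) := by
        linear_combination -star g * hcop' - star w * hstar
      rw [this]
      exact dvd_add (Dvd.dvd.mul_right hd _) (dvd_mul_right _ _)
    have hg' : g = star l₁ * star k := by
      rw [← star_mul', ← hk, star_star]
    have haN : (a : GaussianInt) = star k * (l₁.norm : ℤ) := by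
      rw [Zsqrtd.norm_eq_mul_conj, hl₁, hg']; ring
    have hN : 0 < l₁.norm := GaussianInt.norm_pos.2 hl₁0
    have hk_im : k.im = 0 := by
      have := congrArg Zsqrtd.im haN
      simp at this
      exact this.resolve_right hl₁0
    have hk_re : a = k.re * l₁.norm := by
      have := congrArg Zsqrtd.re haN
      simpa using this
    have hk' : star k = (k.re : ℤ) := by
      ext <;> simp [hk_im]
    have hkpos : 0 < k.re := by
      by_contra! hneg
      nlinarith
    have hBk : B = k.re * (l₀ * star l₁) := by
      rw [hl₀, hg', hk']; ring
    refine ⟨k.re, ⟨![l₀, l₁], u, w, hcop⟩, hkpos, hk_re, ?_, hBk⟩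
    have h₁ : B.norm = k.re ^ 2 * (l₀.norm * l₁.norm) := by
      rw [hBk, Zsqrtd.norm_mul, Zsqrtd.norm_mul, Zsqrtd.norm_conj, Zsqrtd.norm_intCast]; ring
    rw [h, hk_re] at h₁
    apply mul_left_cancel₀ (mul_pos hkpos hN).ne'
    show _ = k.re * l₁.norm * (k.re * l₀.norm)
    linear_combination h₁

/-- The form of a Gaussian circle has coefficients in `ℤ[i]`, with even leading coefficients. -/
theorem act_realForm_integral (M : GL (Fin 2) GaussianInt) : ∃ a b x y : ℤ,
    act M realForm = (2 * (a : ℝ), 2 * (b : ℝ), (⟨x, y⟩ : ℂ)) := by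
  obtain ⟨p, hp⟩ : ∃ p, p = (M⁻¹).1 0 0 := ⟨_, rfl⟩
  obtain ⟨q, hq⟩ : ∃ q, q = (M⁻¹).1 0 1 := ⟨_, rfl⟩
  obtain ⟨r, hr⟩ : ∃ r, r = (M⁻¹).1 1 0 := ⟨_, rfl⟩
  obtain ⟨s, hs⟩ : ∃ s, s = (M⁻¹).1 1 1 := ⟨_, rfl⟩
  refine ⟨p.im * r.re - p.re * r.im, q.im * s.re - q.re * s.im,
    p.re * s.im - p.im * s.re + r.im * q.re - r.re * q.im,
    -(p.re * s.re) - p.im * s.im + r.im * q.im + r.re * q.re, ?_⟩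
  ext <;> simp [act, pull, eval, realForm, complexMat_apply, Matrix.col, ← hp, ← hq, ← hr, ← hs] <;>
    ring

theorem even_of_sum_sq {x y k : ℤ} (h : x * x + y * y = 4 * k) : 2 ∣ x ∧ 2 ∣ y := by
  rcases Int.even_or_odd' x with ⟨m, rfl | rfl⟩ <;> rcases Int.even_or_odd' y with ⟨n, rfl | rfl⟩
  · exact ⟨dvd_mul_right _ _, dvd_mul_right _ _⟩
  all_goals ring_nf at h; omega

theorem ExtTangent.exists_eq_smul_form {M N : GL (Fin 2) GaussianInt}
    (h : ExtTangent (act M realForm) (act N realForm)) :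
    ∃ (n : ℤ) (l : LaxVector), 0 < n ∧
      act M realForm + act N realForm = (2 * n : ℝ) • l.form := by
  have h₀ : lorentz (act M realForm + act N realForm) (act M realForm + act N realForm) = 0 := by
    simp only [map_add, LinearMap.add_apply, lorentz_act_realForm, h.lorentz_eq,
      lorentz_comm (act N realForm) (act M realForm)]
    norm_num
  have h₁ := h.nonneg
  have h₂ := h.ne_zero
  obtain ⟨a, b, x, y, hM⟩ := act_realForm_integral M
  obtain ⟨a', b', x', y', hN⟩ := act_realForm_integral N
  have hsum : act M realForm + act N realForm =
      (2 * ((a + a' : ℤ) : ℝ), 2 * ((b + b' : ℤ) : ℝ), ⟨(x + x' : ℤ), (y + y' : ℤ)⟩) := by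
    rw [hM, hN]; ext <;> simp <;> ring
  rw [hsum] at h₀ h₁ h₂ ⊢
  generalize a + a' = a at *
  generalize b + b' = b at *
  generalize x + x' = x at *
  generalize y + y' = y at *
  have hn : x * x + y * y = 4 * (a * b) := by
    simp only [lorentz_apply] at h₀
    have : (x * x + y * y : ℝ) = 4 * (a * b) := by linarith
    exact_mod_cast this
  have ha : 0 ≤ a := by
    have := h₁ ![1, 0]
    simp [eval] at this
    exact this
  have hb : 0 ≤ b := by
    have := h₁ ![0, 1]
    simp [eval] at this
    exact this
  obtain ⟨⟨x, rfl⟩, ⟨y, rfl⟩⟩ := even_of_sum_sq hn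
  have hxy : x * x + y * y = a * b := by linarith
  have hab : 0 < a + b := by
    by_contra! hab
    obtain rfl : a = 0 := by omega
    obtain rfl : b = 0 := by omega
    obtain rfl : x = 0 := by nlinarith
    obtain rfl : y = 0 := by nlinarith
    exact h₂ (by ext <;> simp)
  obtain ⟨n, l, hn, hl⟩ := Apollonian.exists_eq_smul_form (B := ⟨x, y⟩) ha hab
    (by rw [Zsqrtd.norm_def]; linarith)
  refine ⟨n, l, hn, ?_⟩
  rw [mul_smul, ← hl]
  ext <;> simp

/-- If two externally tangent Gaussian circles have a common externally tangent Gaussian circle,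
then the sum of their forms is exactly twice the form of a lax vector. In general it is twice a
positive integral multiple `n` of such a form; the third circle gives a factorization `n m k = 1`
over the integers. -/
theorem exists_lax_of_triple {M N P : GL (Fin 2) GaussianInt}
    (h₁ : ExtTangent (act M realForm) (act N realForm))
    (h₂ : ExtTangent (act M realForm) (act P realForm))
    (h₃ : lorentz (act N realForm) (act P realForm) = -1) :
    ∃ l : LaxVector, act M realForm + act N realForm = (2 : ℝ) • l.form := by
  obtain ⟨n, l, hn, hl⟩ := h₁.exists_eq_smul_form
  obtain ⟨m, l', hm, hl'⟩ := h₂.exists_eq_smul_form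
  have h : lorentz (act M realForm + act N realForm) (act M realForm + act P realForm) = -2 := by
    simp only [map_add, LinearMap.add_apply, lorentz_act_realForm, h₁.lorentz_eq, h₂.lorentz_eq, h₃,
      lorentz_comm (act N realForm) (act M realForm)]
    norm_num
  obtain ⟨v, rfl⟩ := l.exists_rep
  obtain ⟨w, rfl⟩ := l'.exists_rep
  rw [hl, hl', LinearMap.map_smul, LinearMap.map_smul, LinearMap.smul_apply,
    lorentz_form_lax] at h
  generalize (v.1 0 * w.1 1 - v.1 1 * w.1 0).norm = k at h
  have hnm : n * (m * k) = 1 := by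
    have : (n * (m * k) : ℝ) = 1 := by
      simp only [smul_eq_mul] at h
      linarith
    exact_mod_cast this
  obtain rfl : n = 1 := by
    rcases Int.eq_one_or_neg_one_of_mul_eq_one hnm with h | h <;> omega
  exact ⟨v.lax, by rw [hl]; simp⟩

/-! ### Neighbouring chambers -/

/-- Two ultrabases that share the wall opposite to the vertex `j` are equal or related by the linear
Descartes relation. -/
theorem form_eq_or_of_wall {T T' : Ultrabasis} {j : Fin 4}
    (h : ∀ i, i ≠ j → T'.form i = T.form i) :
    T'.form j = T.form j ∨ T'.form j = (2 : ℝ) • ∑ i, T.form i - (3 : ℝ) • T.form j := by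
  obtain ⟨T₁, h₁⟩ := T.exists_form_comp (Equiv.swap j 3)
  obtain ⟨T₂, h₂⟩ := T'.exists_form_comp (Equiv.swap j 3)
  have hj : T₁.form 3 = T.form j := by rw [h₁]; simp
  have hj' : T₂.form 3 = T'.form j := by rw [h₂]; simp
  have hsum : ∑ i, T.form i = ∑ i, T₁.form i := by
    rw [h₁]; exact (Equiv.sum_comp (Equiv.swap j 3) T.form).symm
  have hw : ∀ i, i ≠ 3 → T₂.form i = T₁.form i := fun i hi => by
    rw [h₁, h₂]
    refine h _ fun h' => hi ?_
    exact (Equiv.swap j 3).injective (h'.trans (Equiv.swap_apply_right _ _).symm)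
  obtain ⟨M, η, rfl⟩ := T₁.exists_eq_stdUltrabasis
  rw [← hj, ← hj', hsum]
  have key : ∀ i, i ≠ 3 → lorentz (stdQuad 1 i) (act M⁻¹ (T₂.form 3)) = -1 := fun i hi => by
    rw [← lorentz_act M, act_act_inv, ← stdQuad_eq_of_ne η hi, ← form_stdUltrabasis, ← hw i hi,
      T₂.lorentz_form_of_ne hi]
  obtain ⟨θ, hθ⟩ := exists_eq_stdQuad (H := act M⁻¹ (T₂.form 3))
    (by rw [lorentz_act, T₂.lorentz_form_self]) (key 0 (by decide)) (key 1 (by decide))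
    (key 2 (by decide))
  have h3 : T₂.form 3 = act M (stdQuad θ 3) := by rw [← hθ, act_act_inv]
  simp only [h3, form_stdUltrabasis, ← map_sum, ← LinearMap.map_smul, ← map_sub]
  have hneg : stdQuad (-η) 3 =
      (2 : ℝ) • ∑ i, stdQuad η i - (3 : ℝ) • stdQuad η 3 := by
    ext <;> simp [stdQuad, realForm, Fin.sum_univ_four] <;> ring
  by_cases hθη : θ = η
  · exact Or.inl (by rw [hθη])
  · obtain rfl := Int.units_ne_iff_eq_neg.1 hθη
    exact Or.inr (by rw [hneg])

/-- Properties of ultrabases that are invariant under passage through walls are constant on the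
components of the kingdom. -/
theorem wall_induction {Q : Ultrabasis → Prop}
    (hQ : ∀ (T T' : Ultrabasis) (f g : Fin 3 ↪ Fin 4), (∀ k, T.form (f k) = T'.form (g k)) →
      Q T → Q T') {T T' : Ultrabasis} {i j : Fin 4}
    (h : kingdom.toSimpleGraph.Reachable (T.vertex i) (T'.vertex j)) (hT : Q T) : Q T' := by
  have hglue : ∀ x y : Ultrabasis × Fin 4, Quot.mk VertexGlue x = Quot.mk VertexGlue y →
      (Q x.1 ↔ Q y.1) := by
    intro x y hxy
    induction Quot.eqvGen_exact hxy with
    | rel _ _ h =>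
      obtain ⟨T, T', f, g, h, k⟩ := h
      rw [sameWall_iff] at h
      exact ⟨hQ _ _ f g h, hQ _ _ g f fun k => (h k).symm⟩
    | refl => rfl
    | symm _ _ _ ih => exact (ih (Quot.eqvGen_sound ‹_›)).symm
    | trans _ _ _ _ _ ih₁ ih₂ =>
      exact (ih₁ (Quot.eqvGen_sound ‹_›)).trans (ih₂ (Quot.eqvGen_sound ‹_›))
  have hvert : ∀ {p}, (∃ T i, T.vertex i = p ∧ Q T) → ∀ T i, T.vertex i = p → Q T := by
    rintro p ⟨T, i, rfl, hT⟩ T' j h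
    exact (hglue (T', j) (T, i) h).2 hT
  have hwalk : ∀ {p q} (_ : kingdom.toSimpleGraph.Walk p q),
      (∃ T i, T.vertex i = p ∧ Q T) → ∃ T i, T.vertex i = q ∧ Q T := by
    intro p q w
    induction w with
    | nil => exact id
    | cons hadj _ ih =>
      intro hp
      refine ih ?_
      obtain ⟨-, e, he⟩ := hadj
      obtain ⟨T, i, j, hij, rfl⟩ := exists_edge e
      rw [ends_edge, Sym2.eq_iff] at he
      rcases he with ⟨h₁, h₂⟩ | ⟨h₁, h₂⟩
      · exact ⟨T, j, h₂, hvert hp T i h₁⟩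
      · exact ⟨T, i, h₁, hvert hp T j h₂⟩
  obtain ⟨w⟩ := h
  exact hvert (hwalk w ⟨T, i, rfl, hT⟩) T' j rfl

theorem vertex_injective (T : Ultrabasis) : Function.Injective T.vertex := fun _ _ h =>
  T.form_injective (congrArg vertexForm h)

theorem adj_vertex (T : Ultrabasis) {i j : Fin 4} (h : i ≠ j) :
    kingdom.toSimpleGraph.Adj (T.vertex i) (T.vertex j) :=
  ⟨(vertex_injective T).ne h, T.edge i j h, rfl⟩

theorem reachable_vertex (T : Ultrabasis) (i j : Fin 4) :
    kingdom.toSimpleGraph.Reachable (T.vertex i) (T.vertex j) := by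
  by_cases h : i = j
  · rw [h]
  · exact (adj_vertex T h).reachable

/-! ### Tangencies within a component -/

/-- The ultrabasis `T'` is obtained from `T` by passing through the wall opposite to the
vertex `j`. -/
def Neighbor (T T' : Ultrabasis) (j : Fin 4) : Prop :=
  (∀ i, i ≠ j → T'.form i = T.form i) ∧
    T'.form j = (2 : ℝ) • ∑ i, T.form i - (3 : ℝ) • T.form j

theorem sum_eq_add_sum_erase {M : Type*} [AddCommMonoid M] (h : Fin 4 → M) (j : Fin 4) :
    ∑ i, h i = h j + ∑ i ∈ Finset.univ.erase j, h i :=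
  (Finset.add_sum_erase _ _ (Finset.mem_univ j)).symm

theorem Neighbor.eq_of_neighbor {T T' T'' : Ultrabasis} {j : Fin 4} (h : Neighbor T T' j)
    (h' : Neighbor T' T'' j) : T'' = T := by
  refine Ultrabasis.ext_form fun i => ?_
  by_cases hi : i = j
  · subst hi
    have hs : ∑ k ∈ Finset.univ.erase i, T'.form k = ∑ k ∈ Finset.univ.erase i, T.form k :=
      Finset.sum_congr rfl fun k hk => h.1 k (Finset.ne_of_mem_erase hk)
    rw [h'.2, sum_eq_add_sum_erase, hs, h.2, sum_eq_add_sum_erase T.form i]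
    module
  · rw [h'.1 i hi, h.1 i hi]

theorem Neighbor.renumber {T T' T₁ T₁' : Ultrabasis} {j : Fin 4} (h : Neighbor T T' j)
    {σ : Equiv.Perm (Fin 4)} (h₁ : T₁.form = T.form ∘ σ) (h₁' : T₁'.form = T'.form ∘ σ) :
    Neighbor T₁ T₁' (σ.symm j) := by
  constructor
  · intro i hi
    rw [h₁, h₁']
    exact h.1 _ fun h' => hi (by rw [← h', Equiv.symm_apply_apply])
  · rw [h₁, h₁', Function.comp_apply, Function.comp_apply, Equiv.apply_symm_apply, h.2,
      ← Equiv.sum_comp σ T.form]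
    rfl

/-- The ultrabasis `T` is reached by leaving a chamber that contains the circle with form `C`
through the wall opposite to `C` and then passing through walls without turning back, the last of
them being opposite to the vertex `m`. -/
inductive Away (C : HermForm) : Ultrabasis → Fin 4 → Prop
  | base (T T' : Ultrabasis) (i : Fin 4) : T.form i = C → Neighbor T T' i → Away C T' i
  | step (T T' : Ultrabasis) (m j : Fin 4) : Away C T m → j ≠ m → Neighbor T T' j → Away C T' j

theorem Away.renumber {C : HermForm} {T T₁ : Ultrabasis} {m : Fin 4} (h : Away C T m)
    {σ : Equiv.Perm (Fin 4)} (h₁ : T₁.form = T.form ∘ σ) : Away C T₁ (σ.symm m) := by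
  induction h generalizing T₁ with
  | base T T' i hi hn =>
    obtain ⟨T₀, h₀⟩ := T.exists_form_comp σ
    exact Away.base T₀ T₁ _ (by rw [h₀]; simpa using hi) (hn.renumber h₀ h₁)
  | step T T' m j _ hj hn ih =>
    obtain ⟨T₀, h₀⟩ := T.exists_form_comp σ
    exact Away.step T₀ T₁ _ _ (ih h₀) (σ.symm.injective.ne hj) (hn.renumber h₀ h₁)

/-- Passing through the last wall once more leads back. -/
theorem Away.back {C : HermForm} {T T' : Ultrabasis} {m : Fin 4} (h : Away C T m)
    (hn : Neighbor T T' m) : (∃ i, T'.form i = C) ∨ ∃ k, Away C T' k := by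
  cases h with
  | base T₀ _ _ hi h₀ =>
    rw [h₀.eq_of_neighbor hn]
    exact Or.inl ⟨m, hi⟩
  | step T₀ _ k _ h₀ hk hn₀ =>
    rw [hn₀.eq_of_neighbor hn]
    exact Or.inr ⟨k, h₀⟩

theorem exists_opposite (g : Fin 3 ↪ Fin 4) : ∃ j, j ∉ range g ∧ ∀ i, i ≠ j → i ∈ range g := by
  obtain ⟨j, hj⟩ : ∃ j, j ∉ range g := by
    by_contra! hall
    have := Fintype.card_le_of_surjective g hall
    simp at this
  have hcard : (Finset.univ.map g).card = (Finset.univ.erase j).card := by simp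
  have hsub : Finset.univ.map g ⊆ Finset.univ.erase j := by
    intro i hi
    obtain ⟨k, -, rfl⟩ := Finset.mem_map.1 hi
    exact Finset.mem_erase.2 ⟨fun h' => hj ⟨k, h'⟩, Finset.mem_univ _⟩
  refine ⟨j, hj, fun i hi => ?_⟩
  have : i ∈ Finset.univ.map g := by
    rw [Finset.eq_of_subset_of_card_le hsub hcard.ge]
    simpa using hi
  obtain ⟨k, -, hk⟩ := Finset.mem_map.1 this
  exact ⟨k, hk⟩

/-- Being a chamber that contains a given circle, or one reached by moving away from it, is invariant
under passage through walls, hence holds in the whole component of the circle. -/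
theorem mem_or_away {C : HermForm} (T T' : Ultrabasis) (f g : Fin 3 ↪ Fin 4)
    (h : ∀ k, T.form (f k) = T'.form (g k)) (hT : (∃ i, T.form i = C) ∨ ∃ m, Away C T m) :
    (∃ i, T'.form i = C) ∨ ∃ m, Away C T' m := by
  obtain ⟨σ, hσ⟩ : ∃ σ : Equiv.Perm (Fin 4), ∀ k, σ (g k) = f k := by
    have := Equiv.Perm.isMultiplyPretransitive (Fin 4) 3
    obtain ⟨σ, hσ⟩ := MulAction.exists_smul_eq (Equiv.Perm (Fin 4)) g f
    exact ⟨σ, fun k => by rw [← hσ]; rfl⟩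
  obtain ⟨T₁, h₁⟩ := T.exists_form_comp σ
  have hT₁ : (∃ i, T₁.form i = C) ∨ ∃ m, Away C T₁ m := by
    rcases hT with ⟨i, hi⟩ | ⟨m, hm⟩
    · exact Or.inl ⟨σ.symm i, by rw [h₁]; simpa using hi⟩
    · exact Or.inr ⟨_, hm.renumber h₁⟩
  obtain ⟨j, -, hg⟩ := exists_opposite g
  have hw : ∀ i, i ≠ j → T'.form i = T₁.form i := by
    intro i hi
    obtain ⟨k, rfl⟩ := hg i hi
    rw [← h k, h₁, Function.comp_apply, hσ]
  rcases form_eq_or_of_wall hw with he | he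
  · have : T' = T₁ := Ultrabasis.ext_form fun i => by
      by_cases hi : i = j
      · rw [hi, he]
      · exact hw i hi
    rwa [this]
  · have hn : Neighbor T₁ T' j := ⟨hw, he⟩
    rcases hT₁ with ⟨i, hi⟩ | ⟨m, hm⟩
    · by_cases hij : i = j
      · subst hij
        exact Or.inr ⟨_, Away.base T₁ T' _ hi hn⟩
      · exact Or.inl ⟨i, by rw [hw i hij, hi]⟩
    · by_cases hjm : j = m
      · subst hjm
        exact hm.back hn
      · exact Or.inr ⟨_, Away.step T₁ T' m j hm hjm hn⟩

/-- Replacing `x j` by its reflection in the linear Descartes relation yields a new strict maximum,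
provided that all entries are at least `1` and that `x j` is not the previous strict maximum. -/
theorem lt_reflection {x : Fin 4 → ℝ} {m j : Fin 4} (h₁ : ∀ i, 1 ≤ x i)
    (hm : ∀ i, i ≠ m → x i < x m) (hj : j ≠ m) (i : Fin 4) :
    x i < 2 * ∑ k, x k - 3 * x j := by
  have him : x i ≤ x m := by
    by_cases h : i = m
    · rw [h]
    · exact (hm i h).le
  have hsum : x j + x m < ∑ k, x k := by
    have hpair : ∑ k ∈ {j, m}, x k = x j + x m := Finset.sum_pair hj
    rw [← hpair]
    obtain ⟨k, hk⟩ : ∃ k, k ∉ ({j, m} : Finset (Fin 4)) :=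
      (by decide : ∀ j m : Fin 4, ∃ k, k ∉ ({j, m} : Finset (Fin 4))) j m
    exact Finset.sum_lt_sum_of_subset (Finset.subset_univ _) (Finset.mem_univ k) hk
      (by linarith [h₁ k]) fun l _ _ => by linarith [h₁ l]
  linarith [hm j hj]

/-- Moving away from a circle, the inner products with it decrease: they are at most `-1`, smallest
at the vertex that was added last, and equal to `-1` only at circles that share a chamber
with it. -/
theorem Away.lorentz_le {C : HermForm} {T : Ultrabasis} {m : Fin 4} (h : Away C T m) :
    (∀ i, 1 ≤ -lorentz C (T.form i)) ∧
    (∀ i, i ≠ m → -lorentz C (T.form i) < -lorentz C (T.form m)) ∧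
    ∀ i, lorentz C (T.form i) = -1 →
      ∃ (T₀ : Ultrabasis) (k l : Fin 4), k ≠ l ∧ T₀.form k = C ∧ T₀.form l = T.form i := by
  have hrefl : ∀ {T T' : Ultrabasis} {j}, Neighbor T T' j → -lorentz C (T'.form j) =
      2 * ∑ i, -lorentz C (T.form i) - 3 * -lorentz C (T.form j) := fun hn => by
    rw [hn.2, map_sub, LinearMap.map_smul, LinearMap.map_smul, map_sum, Finset.sum_neg_distrib]
    simp only [smul_eq_mul]
    ring
  induction h with
  | base T T' i hi hn =>
    subst hi
    have hval : ∀ k, k ≠ i → lorentz (T.form i) (T'.form k) = -1 := fun k hk => by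
      rw [hn.1 k hk, T.lorentz_form_of_ne (Ne.symm hk)]
    -- The inner product with the reflected form: `2 * (3 * 1 - 1) - 3 * (-1) = 7`.
    have hval' : -lorentz (T.form i) (T'.form i) = 7 := by
      have hs : ∑ k ∈ Finset.univ.erase i, -lorentz (T.form i) (T.form k) = 3 := by
        rw [Finset.sum_congr rfl (g := fun _ => (1 : ℝ))]
        · simp
        · intro k hk
          rw [T.lorentz_form_of_ne (Finset.ne_of_mem_erase hk).symm]
          norm_num
      rw [hrefl hn, sum_eq_add_sum_erase _ i, hs, T.lorentz_form_self]
      norm_num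
    refine ⟨fun k => ?_, fun k hk => ?_, fun k hk => ?_⟩
    · by_cases hk : k = i
      · rw [hk, hval']; norm_num
      · rw [hval k hk]; norm_num
    · rw [hval', hval k hk]; norm_num
    · by_cases hki : k = i
      · rw [hki] at hk
        rw [hk] at hval'
        norm_num at hval'
      · exact ⟨T, i, k, Ne.symm hki, rfl, (hn.1 k hki).symm⟩
  | step T T' m j _ hj hn ih =>
    obtain ⟨ih₁, ih₂, ih₃⟩ := ih
    have hlt : ∀ i, -lorentz C (T.form i) < -lorentz C (T'.form j) := fun i => by
      rw [hrefl hn]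
      exact lt_reflection (x := fun i => -lorentz C (T.form i)) ih₁ ih₂ hj i
    refine ⟨fun k => ?_, fun k hk => ?_, fun k hk => ?_⟩
    · by_cases hk : k = j
      · rw [hk]; exact (ih₁ j).trans (hlt j).le
      · rw [hn.1 k hk]; exact ih₁ k
    · rw [hn.1 k hk]; exact hlt k
    · by_cases hkj : k = j
      · have := hlt j
        rw [hkj] at hk
        linarith [ih₁ j]
      · rw [hn.1 k hkj] at hk ⊢
        exact ih₃ k hk

/-! ### The circle of a vertex of the kingdom -/

/-- The oriented circle of a vertex of the kingdom. -/
def vertexCircle (p : kingdom.Vert) : OrientedCircle :=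
  (vertexForm p).circle (lorentz_vertexForm_self p)

theorem exists_vertexForm_eq_act (p : kingdom.Vert) : ∃ M, vertexForm p = act M realForm := by
  obtain ⟨T, i, rfl⟩ := exists_vertex p
  obtain ⟨j, hj⟩ := exists_ne i
  obtain ⟨M, -, -, h, -⟩ := edge_eq_stdUltrabasis T i j hj.symm
  exact ⟨M, h⟩

theorem vertexCircle_isGaussian (p : kingdom.Vert) : (vertexCircle p).IsGaussian := by
  obtain ⟨M, hM⟩ := exists_vertexForm_eq_act p
  exact OrientedCircle.isGaussian_iff.2 ⟨M, circle_congr hM _ _⟩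

theorem vertexCircle_injective : Function.Injective vertexCircle := by
  intro p q h
  obtain ⟨M, hM⟩ := exists_vertexForm_eq_act p
  apply vertexForm_injective
  rw [hM]
  refine act_realForm_eq_of_sets (lorentz_vertexForm_self q) ?_ ?_
  · rw [← hM]; exact congrArg OrientedCircle.carrier h
  · rw [← hM]; exact congrArg OrientedCircle.interior h

theorem OrientedCircle.IsGaussian.exists_vertexCircle {C : OrientedCircle} (h : C.IsGaussian) :
    ∃ p, vertexCircle p = C := by
  obtain ⟨M, rfl⟩ := OrientedCircle.isGaussian_iff.1 h
  exact ⟨(stdUltrabasis M 1).vertex 0, circle_congr (form_stdUltrabasis M 1 0) _ _⟩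

theorem isTangencyLabel_vertex (T : Ultrabasis) {i j : Fin 4} (h : i ≠ j) :
    IsTangencyLabel (vertexCircle (T.vertex i)) (vertexCircle (T.vertex j))
      (T.label (tetraEdge i j h)) :=
  zeroSet_inter_of_add (T.lorentz_form_self i) (T.lorentz_form_self j) (T.form_add_form h)

theorem tangent_vertex (T : Ultrabasis) {i j : Fin 4} (h : i ≠ j) :
    Tangent (vertexCircle (T.vertex i)) (vertexCircle (T.vertex j)) :=
  ⟨_, isTangencyLabel_vertex T h⟩

theorem disjoint_vertex (T : Ultrabasis) {i j : Fin 4} (h : i ≠ j) :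
    Disjoint (vertexCircle (T.vertex i)).interior (vertexCircle (T.vertex j)).interior :=
  disjoint_negSet_of_nonneg fun v => by
    rw [vertexForm_vertex, vertexForm_vertex, T.form_add_form h, eval_smul_form]
    exact mul_nonneg zero_le_two (LaxVector.eval_form_nonneg _ _)

theorem not_tangent_self (p : kingdom.Vert) : ¬ Tangent (vertexCircle p) (vertexCircle p) := by
  rintro ⟨x, hx⟩
  obtain ⟨M, hM⟩ := exists_vertexForm_eq_act p
  replace hx : (vertexForm p).zeroSet ∩ (vertexForm p).zeroSet = {x} := hx
  rw [hM] at hx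
  -- After transport the circle is the real line, whose form is not of the shape that tangency to the
  -- real line requires.
  have h := act_zero_sets hx
  rw [act_inv_act] at h
  have hR : realForm = ((0, 0, ⟨0, -1⟩) : HermForm) := by ext <;> simp [realForm]
  rw [hR] at h
  nth_rewrite 1 [← hR] at h
  obtain ⟨-, h | h⟩ := tangent_realForm (by norm_num) h
  · exact h.2.2 rfl
  · obtain ⟨_, h, -⟩ := h
    exact h rfl

/-- Two circles that touch externally, with disjoint interiors. -/
def Touching (C D : OrientedCircle) : Prop := Tangent C D ∧ Disjoint C.interior D.interior

theorem Touching.extTangent {p : kingdom.Vert} {H : HermForm} {h : lorentz H H = 1}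
    (ht : Touching (vertexCircle p) (H.circle h)) : ExtTangent (vertexForm p) H := by
  obtain ⟨M, hM⟩ := exists_vertexForm_eq_act p
  obtain ⟨⟨x, hx⟩, hd⟩ := ht
  replace hx : (vertexForm p).zeroSet ∩ H.zeroSet = {x} := hx
  replace hd : Disjoint (vertexForm p).negSet H.negSet := hd
  rw [hM] at hx hd ⊢
  exact extTangent_of_tangent h hx hd

theorem exists_lax_of_touching {p q r : kingdom.Vert}
    (h₁ : Touching (vertexCircle p) (vertexCircle q))
    (h₂ : Touching (vertexCircle p) (vertexCircle r))
    (h₃ : Touching (vertexCircle q) (vertexCircle r)) :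
    ∃ l : LaxVector, vertexForm p + vertexForm q = (2 : ℝ) • l.form := by
  have e₁ := h₁.extTangent
  have e₂ := h₂.extTangent
  have e₃ := h₃.extTangent
  obtain ⟨M, hM⟩ := exists_vertexForm_eq_act p
  obtain ⟨N, hN⟩ := exists_vertexForm_eq_act q
  obtain ⟨P, hP⟩ := exists_vertexForm_eq_act r
  rw [hM, hN] at e₁
  rw [hM, hP] at e₂
  rw [hN, hP] at e₃
  rw [hM, hN]
  exact exists_lax_of_triple e₁ e₂ e₃.lorentz_eq

theorem Touching.symm {C D : OrientedCircle} (h : Touching C D) : Touching D C := by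
  obtain ⟨⟨x, hx⟩, hd⟩ := h
  exact ⟨⟨x, by rw [inter_comm, hx]⟩, hd.symm⟩

theorem exists_vertex_eq_of_touching {c : Fin 4 → kingdom.Vert}
    (h : ∀ i j, i ≠ j → Touching (vertexCircle (c i)) (vertexCircle (c j))) :
    ∃ T : Ultrabasis, T.vertex = c := by
  obtain ⟨T, hT⟩ := Ultrabasis.exists_form_eq (h := fun i => vertexForm (c i))
    (fun i j => by
      split_ifs with hij
      · rw [hij, lorentz_vertexForm_self]
      · exact (h i j hij).extTangent.lorentz_eq)
    (fun i j hij => by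
      obtain ⟨k, hik, hjk⟩ : ∃ k, i ≠ k ∧ j ≠ k :=
        (by decide : ∀ i j : Fin 4, ∃ k, i ≠ k ∧ j ≠ k) i j
      exact exists_lax_of_touching (h i j hij) (h i k hik) (h j k hjk))
  exact ⟨T, funext fun i => vertexForm_injective (congrFun hT i)⟩

theorem exists_std_of_touching {p q r : kingdom.Vert}
    (h₁ : Touching (vertexCircle p) (vertexCircle q))
    (h₂ : Touching (vertexCircle p) (vertexCircle r))
    (h₃ : Touching (vertexCircle q) (vertexCircle r)) :
    ∃ M, ∀ η, (stdUltrabasis M η).vertex 0 = p ∧ (stdUltrabasis M η).vertex 1 = q ∧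
      (stdUltrabasis M η).vertex 2 = r := by
  obtain ⟨l₁, hl₁⟩ := exists_lax_of_touching h₁ h₂ h₃
  obtain ⟨l₂, hl₂⟩ := exists_lax_of_touching h₂ h₁ h₃.symm
  obtain ⟨l₃, hl₃⟩ := exists_lax_of_touching h₃ h₁.symm h₂.symm
  obtain ⟨M, m₀, m₁, m₂⟩ := exists_act_eq_of_triple (lorentz_vertexForm_self p)
    (lorentz_vertexForm_self q) (lorentz_vertexForm_self r) h₁.extTangent.lorentz_eq
    h₂.extTangent.lorentz_eq h₃.extTangent.lorentz_eq hl₁ hl₂ hl₃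
  refine ⟨M, fun η => ⟨?_, ?_, ?_⟩⟩ <;> apply vertexForm_injective <;>
    rw [vertexForm_vertex, form_stdUltrabasis, stdQuad_eq_of_ne η (by decide)]
  exacts [m₀.symm, m₁.symm, m₂.symm]

/-- A circle, Gaussian or not, that completes three mutually tangent Gaussian circles to a Descartes
quadruple is the fourth circle of a chamber. -/
theorem exists_completion {p q r : kingdom.Vert} {D : OrientedCircle}
    (h₁ : Touching (vertexCircle p) (vertexCircle q))
    (h₂ : Touching (vertexCircle p) (vertexCircle r))
    (h₃ : Touching (vertexCircle q) (vertexCircle r)) (hp : Touching (vertexCircle p) D)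
    (hq : Touching (vertexCircle q) D) (hr : Touching (vertexCircle r) D) :
    ∃ T : Ultrabasis, T.vertex 0 = p ∧ vertexCircle (T.vertex 3) = D := by
  obtain ⟨M, hM⟩ := exists_std_of_touching h₁ h₂ h₃
  obtain ⟨H, h, rfl⟩ := D.exists_eq_circle
  have key : ∀ i, lorentz ((stdUltrabasis M 1).form i) H = -1 →
      lorentz (stdQuad 1 i) (act M⁻¹ H) = -1 := fun i hi => by
    rw [← lorentz_act M, act_act_inv, ← form_stdUltrabasis, hi]
  obtain ⟨m₀, m₁, m₂⟩ := hM 1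
  obtain ⟨η, hη⟩ := exists_eq_stdQuad (H := act M⁻¹ H) (by rw [lorentz_act, h])
    (key 0 (by rw [← vertexForm_vertex, m₀]; exact hp.extTangent.lorentz_eq))
    (key 1 (by rw [← vertexForm_vertex, m₁]; exact hq.extTangent.lorentz_eq))
    (key 2 (by rw [← vertexForm_vertex, m₂]; exact hr.extTangent.lorentz_eq))
  refine ⟨stdUltrabasis M η, (hM η).1, circle_congr ?_ _ _⟩
  rw [vertexForm_vertex, form_stdUltrabasis, ← hη, act_act_inv]

/-! ### Chambers and Descartes quadruples -/

theorem exists_range_eq_of_ncard {α : Type*} {s : Set α} {n : ℕ} (hn : n ≠ 0) (h : s.ncard = n) :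
    ∃ f : Fin n → α, Function.Injective f ∧ range f = s := by
  have : Finite s := Set.finite_of_ncard_ne_zero (h ▸ hn)
  have e := Finite.equivFinOfCardEq (α := s) (n := n) h
  refine ⟨fun i => (e.symm i).1, Subtype.val_injective.comp e.symm.injective, ?_⟩
  change range (Subtype.val ∘ e.symm) = s
  rw [e.symm.surjective.range_comp, Subtype.range_coe]

theorem ncard_range {α : Type*} {n : ℕ} {f : Fin n → α} (h : Function.Injective f) :
    (range f).ncard = n := by
  rw [← image_univ, ncard_image_of_injective _ h, ncard_univ, Nat.card_eq_fintype_card,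
    Fintype.card_fin]

theorem isGaussianDescartesQuadruple_range (T : Ultrabasis) :
    IsGaussianDescartesQuadruple (range fun i => vertexCircle (T.vertex i)) := by
  refine ⟨⟨ncard_range (vertexCircle_injective.comp (vertex_injective T)), ?_⟩, ?_⟩
  · rintro _ ⟨i, rfl⟩ _ ⟨j, rfl⟩ hne
    have hij : i ≠ j := fun h => hne (by rw [h])
    exact ⟨tangent_vertex T hij, disjoint_vertex T hij⟩
  · rintro _ ⟨i, rfl⟩
    exact vertexCircle_isGaussian _

theorem IsGaussianDescartesQuadruple.exists_ultrabasis {q : Set OrientedCircle}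
    (h : IsGaussianDescartesQuadruple q) :
    ∃ T : Ultrabasis, q = range fun i => vertexCircle (T.vertex i) := by
  obtain ⟨⟨hcard, hmut⟩, hgauss⟩ := h
  obtain ⟨c, hc, rfl⟩ := exists_range_eq_of_ncard four_ne_zero hcard
  choose p hp using fun i => (hgauss (c i) ⟨i, rfl⟩).exists_vertexCircle
  obtain ⟨T, rfl⟩ := exists_vertex_eq_of_touching (c := p) fun i j hij => by
    rw [hp, hp]
    exact hmut ⟨i, rfl⟩ ⟨j, rfl⟩ (hc.ne hij)
  exact ⟨T, by rw [funext hp]⟩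

theorem image_vertices (T : Ultrabasis) :
    vertexCircle '' Chamber.vertices (Quotient.mk _ T) =
      range fun i => vertexCircle (T.vertex i) :=
  (range_comp vertexCircle T.vertex).symm

theorem bijOn_chambers : BijOn (fun c : Chamber => vertexCircle '' c.vertices) univ
    {q | IsGaussianDescartesQuadruple q} := by
  refine ⟨fun c _ => ?_, fun c _ c' _ h => ?_, fun q hq => ?_⟩
  · obtain ⟨T, rfl⟩ := Quotient.exists_rep c
    change IsGaussianDescartesQuadruple _
    dsimp only
    rw [image_vertices]
    exact isGaussianDescartesQuadruple_range T
  · obtain ⟨T, rfl⟩ := Quotient.exists_rep c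
    obtain ⟨T', rfl⟩ := Quotient.exists_rep c'
    have h' : range T.vertex = range T'.vertex := vertexCircle_injective.image_injective h
    have hσ : ∀ i, ∃ j, T'.vertex j = T.vertex i := fun i => by
      rw [← mem_range, ← h']; exact ⟨i, rfl⟩
    choose σ hσ using hσ
    have hinj : Function.Injective σ := fun i j hij => by
      apply vertex_injective T
      rw [← hσ, ← hσ, hij]
    refine Quotient.sound ⟨Equiv.ofBijective σ (Finite.injective_iff_bijective.1 hinj), ?_⟩
    intro i j hij
    exact Ultrabasis.label_eq_of_form_eq _ _ (congrArg vertexForm (hσ i).symm)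
      (congrArg vertexForm (hσ j).symm)
  · obtain ⟨T, rfl⟩ := IsGaussianDescartesQuadruple.exists_ultrabasis hq
    exact ⟨Quotient.mk _ T, trivial, image_vertices T⟩

/-! ### Walls and triples of circles -/

/-- The label of the side of a triangle opposite to one of its vertices. -/
def oppositeLabel (T : Ultrabasis) (f : Fin 3 ↪ Fin 4) (k : Fin 3) : LaxVector :=
  T.label (side f (k + 1) (k + 2) (by revert k; decide))

theorem range_oppositeLabel (T : Ultrabasis) (f : Fin 3 ↪ Fin 4) :
    range (oppositeLabel T f) = sideLabels T.label f := by
  ext l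
  constructor
  · rintro ⟨k, rfl⟩
    exact ⟨_, _, _, rfl⟩
  · rw [sideLabels_eq]
    rintro (rfl | rfl | rfl)
    · exact ⟨2, rfl⟩
    · exact ⟨1, congrArg T.label (tetraEdge_comm _ _ _)⟩
    · exact ⟨0, rfl⟩

theorem oppositeLabel_injective (T : Ultrabasis) (f : Fin 3 ↪ Fin 4) :
    Function.Injective (oppositeLabel T f) := by
  intro k k' h
  have h' := Sym2.eq_iff.1 (congrArg Subtype.val (T.label_injective h))
  simp only [f.injective.eq_iff] at h'
  clear h
  revert k k'
  decide

/-- The form of a vertex of a wall in terms of the labels on the wall. -/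
theorem form_eq_finsum (T : Ultrabasis) (f : Fin 3 ↪ Fin 4) (k : Fin 3) :
    T.form (f k) = ∑ᶠ l ∈ sideLabels T.label f, l.form - (2 : ℝ) • (oppositeLabel T f k).form := by
  rw [← range_oppositeLabel, finsum_mem_range (oppositeLabel_injective T f),
    finsum_eq_sum_of_fintype]
  have hopp : ∀ k, (2 : ℝ) • (oppositeLabel T f k).form = T.form (f (k + 1)) + T.form (f (k + 2)) :=
    fun k => (T.form_add_form _).symm
  have h0 : T.form (f 1) + T.form (f 2) = (2 : ℝ) • (oppositeLabel T f 0).form := (hopp 0).symm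
  have h1 : T.form (f 2) + T.form (f 0) = (2 : ℝ) • (oppositeLabel T f 1).form := (hopp 1).symm
  have h2 : T.form (f 0) + T.form (f 1) = (2 : ℝ) • (oppositeLabel T f 2).form := (hopp 2).symm
  rw [Fin.sum_univ_three]
  fin_cases k
  · show T.form (f 0) = _ - (2 : ℝ) • (oppositeLabel T f 0).form
    linear_combination (norm := module) (1 / 2 : ℝ) • (h1 + h2 - h0)
  · show T.form (f 1) = _ - (2 : ℝ) • (oppositeLabel T f 1).form
    linear_combination (norm := module) (1 / 2 : ℝ) • (h0 + h2 - h1)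
  · show T.form (f 2) = _ - (2 : ℝ) • (oppositeLabel T f 2).form
    linear_combination (norm := module) (1 / 2 : ℝ) • (h0 + h1 - h2)

/-- All triangles with the same labels have the same vertices. -/
theorem wallVertices_sideLabels (T : Ultrabasis) (f : Fin 3 ↪ Fin 4) :
    wallVertices (sideLabels T.label f) = range fun k => T.vertex (f k) := by
  ext p
  constructor
  · rintro ⟨T', f', k, hs, rfl⟩
    obtain ⟨k', hk'⟩ : oppositeLabel T' f' k ∈ range (oppositeLabel T f) := by
      rw [range_oppositeLabel, ← hs, ← range_oppositeLabel]; exact ⟨k, rfl⟩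
    refine ⟨k', vertexForm_injective ?_⟩
    rw [vertexForm_vertex, vertexForm_vertex, form_eq_finsum, form_eq_finsum, hs, hk']
  · rintro ⟨k, rfl⟩
    exact ⟨T, f, k, rfl, rfl⟩

theorem IsSuperbasis.exists_wall {s : Set LaxVector} (h : IsSuperbasis s) :
    ∃ (T : Ultrabasis) (f : Fin 3 ↪ Fin 4), sideLabels T.label f = s := by
  obtain ⟨l₁, l₂, l₃, h₁₂, h₁₃, h₂₃, rfl⟩ := ncard_eq_three.1 h.1
  have hb : ∀ l ∈ ({l₁, l₂, l₃} : Set LaxVector), ∀ m ∈ ({l₁, l₂, l₃} : Set LaxVector), l ≠ m →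
      lorentz l.form m.form = -1 / 2 := fun l hl m hm hne => formBasis_iff.1 (h.2 hl hm hne)
  obtain ⟨M, m₁, m₂, m₃⟩ := exists_act_of_superbasis (hb l₁ (by simp) l₂ (by simp) h₁₂)
    (hb l₁ (by simp) l₃ (by simp) h₁₃) (hb l₂ (by simp) l₃ (by simp) h₂₃)
  have key : ∀ (i j : Fin 4) (hij : i ≠ j) (l : LaxVector),
      act M (stdQuad 1 i + stdQuad 1 j) = (2 : ℝ) • l.form →
      (stdUltrabasis M 1).label (tetraEdge i j hij) = l := fun i j hij l hl => by
    apply LaxVector.form_injective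
    refine smul_right_injective _ (two_ne_zero' ℝ) ?_
    change (2 : ℝ) • _ = (2 : ℝ) • _
    rw [← hl, ← Ultrabasis.form_add_form, form_stdUltrabasis, form_stdUltrabasis, map_add]
  have e₀₁ := key 0 1 (by decide) l₁ (by
    rw [m₁, ← LinearMap.map_smul]
    congr 1
    ext <;> simp [stdQuad, realForm, null])
  have e₀₂ := key 0 2 (by decide) l₂ (by
    rw [m₂, ← LinearMap.map_smul]
    congr 1
    ext <;> simp [stdQuad, realForm, null])
  have e₁₂ := key 1 2 (by decide) l₃ (by
    rw [m₃, ← LinearMap.map_smul]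
    congr 1
    ext <;> simp [stdQuad, null]; norm_num)
  refine ⟨stdUltrabasis M 1, triangle₀₁₂, ?_⟩
  rw [sideLabels_eq, ← e₀₁, ← e₀₂, ← e₁₂]
  rfl

theorem bijOn_walls : BijOn (fun s : Set LaxVector => vertexCircle '' wallVertices s)
    {s | IsSuperbasis s}
    {t | t.ncard = 3 ∧ ∃ q, IsGaussianDescartesQuadruple q ∧ t ⊆ q} := by
  have himage : ∀ (T : Ultrabasis) (f : Fin 3 ↪ Fin 4),
      vertexCircle '' wallVertices (sideLabels T.label f) =
        range fun k => vertexCircle (T.vertex (f k)) := fun T f => by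
    rw [wallVertices_sideLabels, ← range_comp]; rfl
  refine ⟨fun s hs => ?_, fun s hs s' hs' h => ?_, fun t ht => ?_⟩
  · obtain ⟨T, f, rfl⟩ := IsSuperbasis.exists_wall hs
    dsimp only
    rw [himage]
    refine ⟨ncard_range (vertexCircle_injective.comp ((vertex_injective T).comp f.injective)), _,
      isGaussianDescartesQuadruple_range T, ?_⟩
    rintro _ ⟨k, rfl⟩
    exact ⟨f k, rfl⟩
  · obtain ⟨T, f, rfl⟩ := IsSuperbasis.exists_wall hs
    obtain ⟨T', f', rfl⟩ := IsSuperbasis.exists_wall hs'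
    have h' := vertexCircle_injective.image_injective h
    rw [wallVertices_sideLabels, wallVertices_sideLabels] at h'
    have hsub : ∀ (T T' : Ultrabasis) (f f' : Fin 3 ↪ Fin 4),
        (range fun k => T.vertex (f k)) = (range fun k => T'.vertex (f' k)) →
        sideLabels T.label f ⊆ sideLabels T'.label f' := by
      rintro T T' f f' h _ ⟨i, j, hij, rfl⟩
      obtain ⟨i', hi'⟩ : T.vertex (f i) ∈ range fun k => T'.vertex (f' k) := h ▸ ⟨i, rfl⟩
      obtain ⟨j', hj'⟩ : T.vertex (f j) ∈ range fun k => T'.vertex (f' k) := h ▸ ⟨j, rfl⟩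
      dsimp only at hi' hj'
      refine ⟨i', j', ?_, Ultrabasis.label_eq_of_form_eq _ _ (congrArg vertexForm hi'.symm)
        (congrArg vertexForm hj'.symm)⟩
      rintro rfl
      exact hij (f.injective (vertex_injective T (hi'.symm.trans hj')))
    exact Subset.antisymm (hsub _ _ _ _ h') (hsub _ _ _ _ h'.symm)
  · obtain ⟨hcard, q, hq, htq⟩ := ht
    obtain ⟨T, rfl⟩ := hq.exists_ultrabasis
    obtain ⟨c, hc, rfl⟩ := exists_range_eq_of_ncard three_ne_zero hcard
    choose f hf using fun k => htq ⟨k, rfl⟩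
    have hinj : Function.Injective f := fun i j hij => hc (by rw [← hf, ← hf, hij])
    refine ⟨_, T.superbasis ⟨f, hinj⟩, ?_⟩
    dsimp only
    rw [himage]
    exact congrArg range (funext hf)

/-! ### Edges and tangencies -/

theorem edge_injective : Function.Injective
    fun e : kingdom.Edge => (kingdom.ends e).map vertexCircle := by
  intro e e' h
  obtain ⟨T, i, j, hij, rfl⟩ := exists_edge e
  obtain ⟨T', i', j', hij', rfl⟩ := exists_edge e'
  have h' := Sym2.map.injective vertexCircle_injective h
  rw [ends_edge, ends_edge, Sym2.eq_iff] at h'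
  rcases h' with ⟨h₁, h₂⟩ | ⟨h₁, h₂⟩
  · exact edge_eq_of_form_eq _ _ (congrArg vertexForm h₁) (congrArg vertexForm h₂)
  · rw [edge_comm T']
    exact edge_eq_of_form_eq _ _ (congrArg vertexForm h₁) (congrArg vertexForm h₂)

theorem bijOn_edges : BijOn (fun e : kingdom.Edge => (kingdom.ends e).map vertexCircle) univ
    {x | ∃ C D, x = s(C, D) ∧ Tangent C D ∧
      ∃ q, IsGaussianDescartesQuadruple q ∧ C ∈ q ∧ D ∈ q} := by
  refine ⟨fun e _ => ?_, edge_injective.injOn, ?_⟩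
  · obtain ⟨T, i, j, hij, rfl⟩ := exists_edge e
    exact ⟨_, _, rfl, tangent_vertex T hij, _, isGaussianDescartesQuadruple_range T, ⟨i, rfl⟩,
      ⟨j, rfl⟩⟩
  · rintro _ ⟨C, D, rfl, ht, q, hq, hC, hD⟩
    obtain ⟨T, rfl⟩ := hq.exists_ultrabasis
    obtain ⟨i, rfl⟩ := hC
    obtain ⟨j, rfl⟩ := hD
    have hij : i ≠ j := by
      rintro rfl
      exact not_tangent_self _ ht
    exact ⟨T.edge i j hij, trivial, rfl⟩

/-- Circles of the same component of the kingdom that are tangent are tangent in a chamber. -/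
theorem exists_edge_of_tangent {p q : kingdom.Vert} (hr : kingdom.toSimpleGraph.Reachable p q)
    (hne : p ≠ q) (ht : Tangent (vertexCircle p) (vertexCircle q)) :
    ∃ e, kingdom.ends e = s(p, q) := by
  have hval : lorentz (vertexForm p) (vertexForm q) = 1 ∨
      lorentz (vertexForm p) (vertexForm q) = -1 := by
    obtain ⟨M, hM⟩ := exists_vertexForm_eq_act p
    obtain ⟨x, hx⟩ := ht
    replace hx : (vertexForm p).zeroSet ∩ (vertexForm q).zeroSet = {x} := hx
    rw [hM] at hx ⊢
    exact lorentz_of_tangent (lorentz_vertexForm_self q) hx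
  have hedge : ∀ (T : Ultrabasis) (k l : Fin 4), k ≠ l → T.form k = vertexForm p →
      T.form l = vertexForm q → ∃ e, kingdom.ends e = s(p, q) := fun T k l hkl hk hl =>
    ⟨T.edge k l hkl, by
      rw [ends_edge, vertexForm_injective (a₁ := T.vertex k) hk,
        vertexForm_injective (a₁ := T.vertex l) hl]⟩
  obtain ⟨T, i, rfl⟩ := exists_vertex p
  obtain ⟨T', j, rfl⟩ := exists_vertex q
  rcases wall_induction (mem_or_away (C := T.form i)) hr (Or.inl ⟨i, rfl⟩) with ⟨k, hk⟩ | ⟨m, hm⟩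
  · refine hedge T' k j ?_ hk rfl
    rintro rfl
    exact hne (vertexForm_injective hk.symm)
  · obtain ⟨h₁, -, h₃⟩ := hm.lorentz_le
    rcases hval with hv | hv
    · have := h₁ j
      rw [vertexForm_vertex, vertexForm_vertex] at hv
      linarith
    · obtain ⟨T₀, k, l, hkl, hk, hl⟩ := h₃ j hv
      exact hedge T₀ k l hkl hk hl

/-! ### Components and packings -/

theorem isPalaceIso_vertexCircle (K : kingdom.Component) :
    IsPalaceIso kingdom vertexCircle K (vertexCircle '' K.supp) where
  vertices := vertexCircle_injective.injOn.bijOn_image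
  edges := by
    refine ⟨fun e he => ?_, edge_injective.injOn, ?_⟩
    · obtain ⟨T, i, j, hij, rfl⟩ := exists_edge e
      have hi : T.vertex i ∈ K.supp := he _ (by rw [ends_edge]; exact Sym2.mem_mk_left _ _)
      have hj : T.vertex j ∈ K.supp := he _ (by rw [ends_edge]; exact Sym2.mem_mk_right _ _)
      refine ⟨s(⟨_, mem_image_of_mem _ hi⟩, ⟨_, mem_image_of_mem _ hj⟩), ⟨?_, ?_⟩, rfl⟩
      · intro h
        exact hij (vertex_injective T (vertexCircle_injective (congrArg Subtype.val h)))
      · exact tangent_vertex T hij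
    · rintro _ ⟨x, hx, rfl⟩
      induction x using Sym2.inductionOn with
      | hf C D =>
        obtain ⟨_, p, hp, rfl⟩ := C
        obtain ⟨_, q, hq, rfl⟩ := D
        obtain ⟨hne, ht⟩ := hx
        obtain ⟨e, he⟩ := exists_edge_of_tangent (p := p) (q := q)
          (SimpleGraph.ConnectedComponent.exact (hp.trans hq.symm))
          (by rintro rfl; exact hne rfl) ht
        refine ⟨e, ?_, ?_⟩
        · intro r hr
          rw [he, Sym2.mem_iff] at hr
          rcases hr with rfl | rfl
          exacts [hp, hq]
        · dsimp only
          rw [he]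
          rfl
  labels := by
    intro e p q he _ _
    obtain ⟨T, i, j, hij, rfl⟩ := exists_edge e
    rw [label_edge]
    rw [ends_edge, Sym2.eq_iff] at he
    rcases he with ⟨rfl, rfl⟩ | ⟨rfl, rfl⟩
    · exact isTangencyLabel_vertex T hij
    · rw [tetraEdge_comm]
      exact isTangencyLabel_vertex T hij.symm

theorem generated_vertex {t : Set OrientedCircle} {T : Ultrabasis} {g : Fin 3 ↪ Fin 4}
    (h : ∀ k, Generated t (vertexCircle (T.vertex (g k)))) (i : Fin 4) :
    Generated t (vertexCircle (T.vertex i)) := by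
  obtain ⟨j, -, hg⟩ := exists_opposite g
  by_cases hi : i = j
  · subst hi
    refine Generated.completion _ _ _ _ (h 0) (h 1) (h 2) ?_
    have : ({vertexCircle (T.vertex (g 0)), vertexCircle (T.vertex (g 1)),
        vertexCircle (T.vertex (g 2)), vertexCircle (T.vertex i)} : Set OrientedCircle) =
        range fun i => vertexCircle (T.vertex i) := by
      ext C
      constructor
      · rintro (rfl | rfl | rfl | rfl) <;> exact ⟨_, rfl⟩
      · rintro ⟨k, rfl⟩
        by_cases hk : k = i
        · subst hk; simp
        · obtain ⟨l, rfl⟩ := hg k hk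
          fin_cases l <;> simp
    rw [this]
    exact (isGaussianDescartesQuadruple_range T).1
  · obtain ⟨k, rfl⟩ := hg i hi
    exact h k

theorem touching_of_quadruple {f : Fin 4 → OrientedCircle} (h : IsDescartesQuadruple (range f))
    {i j : Fin 4} (hij : i ≠ j) : Touching (f i) (f j) := by
  have hinj : Function.Injective f := by
    have := h.1
    rw [← image_univ] at this
    exact injOn_univ.1 ((ncard_image_iff (s := univ) (f := f)).1 (by rw [this, ncard_univ]; simp))
  exact h.2 ⟨i, rfl⟩ ⟨j, rfl⟩ (hinj.ne hij)

/-- The component of a chamber is the packing generated by three of its circles. -/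
theorem image_supp_eq_generated (T : Ultrabasis) :
    vertexCircle '' (kingdom.toSimpleGraph.connectedComponentMk (T.vertex 0)).supp =
      {C | Generated (range fun k => vertexCircle (T.vertex (triangle₀₁₂ k))) C} := by
  ext C
  constructor
  · rintro ⟨p, hp, rfl⟩
    obtain ⟨T', i, rfl⟩ := exists_vertex p
    refine wall_induction (Q := fun T' => ∀ i,
      Generated (range fun k => vertexCircle (T.vertex (triangle₀₁₂ k)))
        (vertexCircle (T'.vertex i))) ?_
      (SimpleGraph.ConnectedComponent.exact hp).symm
      (generated_vertex (g := triangle₀₁₂) fun k => Generated.seed _ ⟨k, rfl⟩) i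
    intro T T' f g h hT
    refine generated_vertex (g := g) fun k => ?_
    rw [← vertex_eq_of_wall h]
    exact hT _
  · intro hC
    induction hC with
    | seed C hC =>
      obtain ⟨k, rfl⟩ := hC
      exact ⟨_, SimpleGraph.ConnectedComponent.sound (reachable_vertex T _ _), rfl⟩
    | completion A B C D _ _ _ hq ihA ihB ihC =>
      obtain ⟨a, ha, rfl⟩ := ihA
      obtain ⟨b, hb, rfl⟩ := ihB
      obtain ⟨c, hc, rfl⟩ := ihC
      have hrange : ({vertexCircle a, vertexCircle b, vertexCircle c, D} : Set OrientedCircle) =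
          range ![vertexCircle a, vertexCircle b, vertexCircle c, D] := by
        ext x
        constructor
        · rintro (rfl | rfl | rfl | rfl)
          exacts [⟨0, rfl⟩, ⟨1, rfl⟩, ⟨2, rfl⟩, ⟨3, rfl⟩]
        · rintro ⟨k, rfl⟩
          fin_cases k <;> simp
      rw [hrange] at hq
      have ht := fun {i j : Fin 4} (hij : i ≠ j) => touching_of_quadruple hq hij
      obtain ⟨T', rfl, rfl⟩ := exists_completion (p := a) (q := b) (r := c) (D := D)
        (ht (i := 0) (j := 1) (by decide)) (ht (i := 0) (j := 2) (by decide))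
        (ht (i := 1) (j := 2) (by decide)) (ht (i := 0) (j := 3) (by decide))
        (ht (i := 1) (j := 3) (by decide)) (ht (i := 2) (j := 3) (by decide))
      exact ⟨_, (SimpleGraph.ConnectedComponent.sound (reachable_vertex T' 3 0)).trans ha, rfl⟩

theorem bijOn_components :
    BijOn (fun K : kingdom.Component => vertexCircle '' K.supp) univ {P | IsGaussianPacking P} := by
  refine ⟨fun K _ => ?_, fun K _ K' _ h => ?_, fun P hP => ?_⟩
  · induction K using SimpleGraph.ConnectedComponent.ind with
    | h p =>
      obtain ⟨T, i, rfl⟩ := exists_vertex p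
      rw [SimpleGraph.ConnectedComponent.sound (reachable_vertex T i 0)]
      refine ⟨⟨_, ?_, ?_, image_supp_eq_generated T⟩, ?_⟩
      · exact ncard_range (vertexCircle_injective.comp
          ((vertex_injective T).comp triangle₀₁₂.injective))
      · rintro _ ⟨i, rfl⟩ _ ⟨j, rfl⟩ hne
        have hij : triangle₀₁₂ i ≠ triangle₀₁₂ j := fun h => hne (by dsimp only; rw [h])
        exact ⟨tangent_vertex T hij, disjoint_vertex T hij⟩
      · rintro _ ⟨q, -, rfl⟩
        exact vertexCircle_isGaussian q
  · exact SimpleGraph.ConnectedComponent.supp_injective (vertexCircle_injective.image_injective h)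
  · obtain ⟨⟨t, hcard, hmut, rfl⟩, hgauss⟩ := hP
    obtain ⟨c, hc, rfl⟩ := exists_range_eq_of_ncard three_ne_zero hcard
    choose p hp using fun k => (hgauss (c k) (Generated.seed _ ⟨k, rfl⟩)).exists_vertexCircle
    have ht : ∀ i j, i ≠ j → Touching (vertexCircle (p i)) (vertexCircle (p j)) := fun i j hij => by
      rw [hp, hp]
      exact hmut ⟨i, rfl⟩ ⟨j, rfl⟩ (hc.ne hij)
    obtain ⟨M, hM⟩ := exists_std_of_touching (ht 0 1 (by decide)) (ht 0 2 (by decide))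
      (ht 1 2 (by decide))
    obtain ⟨h₀, h₁, h₂⟩ := hM 1
    have hc' : (fun k => vertexCircle ((stdUltrabasis M 1).vertex (triangle₀₁₂ k))) = c := by
      funext k
      rw [← hp]
      fin_cases k
      exacts [congrArg vertexCircle h₀, congrArg vertexCircle h₁, congrArg vertexCircle h₂]
    refine ⟨_, trivial, (image_supp_eq_generated (stdUltrabasis M 1)).trans ?_⟩
    rw [hc']

end Apollonian

end

theorem theorem2 :
    ∃ Φ : Apollonian.kingdom.Vert → Apollonian.OrientedCircle,
      -- vertices of the kingdom correspond bijectively to oriented Gaussian circles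
      Set.BijOn Φ Set.univ {C | C.IsGaussian} ∧
      -- the components are exactly the edge-labelled palaces of all Gaussian packings
      (∀ K : Apollonian.kingdom.Component,
        Apollonian.IsPalaceIso Apollonian.kingdom Φ K (Φ '' K.supp)) ∧
      Set.BijOn (fun K : Apollonian.kingdom.Component => Φ '' K.supp) Set.univ
        {P | Apollonian.IsGaussianPacking P} ∧
      -- chambers correspond bijectively to Descartes quadruples of Gaussian circles
      Set.BijOn (fun c : Apollonian.Chamber => Φ '' c.vertices) Set.univ
        {q | Apollonian.IsGaussianDescartesQuadruple q} ∧
      -- walls (superbases) correspond bijectively to triples of circles within such quadruples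
      Set.BijOn (fun s : Set Apollonian.LaxVector => Φ '' Apollonian.wallVertices s)
        {s | Apollonian.IsSuperbasis s}
        {t | t.ncard = 3 ∧ ∃ q, Apollonian.IsGaussianDescartesQuadruple q ∧ t ⊆ q} ∧
      -- edges correspond bijectively to tangencies within such quadruples
      Set.BijOn (fun e : Apollonian.kingdom.Edge => (Apollonian.kingdom.ends e).map Φ) Set.univ
        {x | ∃ C D, x = s(C, D) ∧ Apollonian.Tangent C D ∧
          ∃ q, Apollonian.IsGaussianDescartesQuadruple q ∧ C ∈ q ∧ D ∈ q} := by
  exact ⟨Apollonian.vertexCircle,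
    ⟨fun p _ => Apollonian.vertexCircle_isGaussian p, Apollonian.vertexCircle_injective.injOn,
      fun _ hC => (Apollonian.OrientedCircle.IsGaussian.exists_vertexCircle hC).imp
        fun _ h => ⟨trivial, h⟩⟩,
    Apollonian.isPalaceIso_vertexCircle, Apollonian.bijOn_components, Apollonian.bijOn_chambers,
    Apollonian.bijOn_walls, Apollonian.bijOn_edges⟩
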